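/- Let $\mathbb{H}^n=\mathbb{R}^{2n}\times\mathbb{R}$ be the Heisenberg group with product $(x,t)\cdot(x',t')=(x+x',\,t+t'+\omega(x,x'))$, where $\omega(x,x')=\frac12\sum_{i=1}^n (x_ix'_{n+i}-x_{n+i}x'_i)$, and with the Korányi metric $d(p,q)=\|p^{-1}\cdot q\|$, $\|(x,t)\|=(|x|^4+16t^2)^{1/4}$. For $1\le k\le n$ let $\mathcal V^k(\mathbb{H}^n)$ be the family of affine horizontal $k$-planes $\mathbb V=q\cdot(V'\times\{0\})$, where $q\in\mathbb H^n$ and $V'\subset\mathbb R^{2n}$ is a $k$-dimensional subspace with $\omega|_{V'\times V'}=0$. The horizontal projection onto $\mathbb V$ is $P_{\mathbb V}(p)=q\cdot(\pi_{V'}([q^{-1}\cdot p]),0)$, where $[(x,t)]=x$ and $\pi_{V'}$ is the orthogonal projection of $\mathbb R^{2n}$ onto $V'$; it does not depend on the choice of $q$. A closed set $E\subset\mathbb{H}^n$ with $\operatorname{diam}(E)>0$ belongs to $\mathrm{Reg}_k(C)$, $C\ge1$, if $C^{-1}r^k\le\mathcal H^k(B_r(x)\cap E)\le Cr^k$ for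 all $x\in E$ and $0<r<2\operatorname{diam}(E)$ (with $\operatorname{diam}(E)=\infty$ if $E$ is unbounded). Put $\mu=\mathcal H^k\lfloor_E$. For $q\in[1,\infty)$ and a bounded Borel set $S\subset E$ with $\mu(S)>0$ let $$\beta_{q,\mathcal V^k}(S)=\inf_{\mathbb V\in\mathcal V^k(\mathbb H^n)}\left(\frac1{\mu(S)}\int_S\left[\frac{d(x,\mathbb V)}{\operatorname{diam}(S)}\right]^qd\mu(x)\right)^{1/q},$$ $$\iota_{q,\mathcal V^k}(S)=\inf_{\mathbb V\in\mathcal V^k(\mathbb H^n)}\left(\frac1{\mu(S)^2}\int_S\int_S\left[\frac{|d(x,y)-d(P_{\mathbb V}(x),P_{\mathbb V}(y))|}{\operatorname{diam}(S)}\right]^qd\mu(x)\,d\mu(y)\right)^{1/q}.$$ Let $\mathbb J=\{j\in\mathbb Z: 2^{-j}\le\operatorname{diam}(E)\}$. A dyadic system on $E$ with constant $c_0$ is a family $\Delta=\bigcup_{j\in\mathbb J}\Delta_j$, where each $\Delta_j$ consists of pairwise disjoint Borel sets ("cubes") with union $E$, such that: for $i\le j$, $Q\in\Delta_i$, $Q'\in\Delta_j$,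 either $Q'\subset Q$ or $Q\cap Q'=\emptyset$; for $i<j$ each $Q'\in\Delta_j$ is contained in a unique $Q\in\Delta_i$; and each $Q\in\Delta_j$ satisfies $\operatorname{diam}(Q)\le c_0^{-1}2^{-j}$ and $B_{c_02^{-j}}(x_Q)\cap E\subset Q$ for some $x_Q\in E$. Write $2Q=\{x\in E:\operatorname{dist}(x,Q)\le\operatorname{diam}(Q)\}$. For a coefficient function $h$, $q>0$ and $M\ge0$, the condition $E\in\mathrm{GLem}(h,q,M)$ means that for every dyadic system $\Delta$ on $E$ (with constant $c_0$) and every $Q_0\in\Delta$, $$\sum_{Q\in\Delta,\ Q\subset Q_0}h(2Q)^q\,\mu(Q)\le M\,\mu(Q_0).$$ Here $c_0=c_0(k,C)$ is a constant that is fixed once and for all in terms of $k$ and $C$; it may be any number in $(0,1/2]$. **Theorem.** Let $k\ge1$ be an integer, $1\le p<\infty$, $C\ge1$ and $0<c_0\le\frac12$. There is a constant $\hat C=\hat C(k,p,C,c_0)$ (hence $\hat C=\hat C(k,p,C)$ when $c_0=c_0(k,C)$) such that for every integer $n\ge k$, every $M\ge0$ and every set $E\subset\mathbb{H}^n$ with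 $$E\in\mathrm{Reg}_k(C)\cap\mathrm{GLem}(\beta_{2p,\mathcal V^k(\mathbb H^n)},2p,M)$$ one has $E\in\mathrm{GLem}(\iota_{p,\mathcal V^k(\mathbb H^n)},p,\hat C M)$. -/

import Mathlib

open MeasureTheory Measure Set
open scoped ENNReal NNReal MeasureTheory

noncomputable section

/-! ### The Heisenberg group with the Korányi metric -/

/-- Points `(z, t)` of the Heisenberg group `ℍⁿ = ℝ²ⁿ × ℝ`. The `2n` horizontal coordinates
are indexed by `Fin n ⊕ Fin n`: `x_i` is `z (inl i)` and `x_{n+i}` is `z (inr i)`. -/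
@[ext]
structure Heisenberg (n : ℕ) where
  z : EuclideanSpace ℝ (Fin n ⊕ Fin n)
  t : ℝ

namespace Heisenberg

variable {n : ℕ}

/-- The symplectic form `ω(x, x') = ½ ∑ (x_i x'_{n+i} - x_{n+i} x'_i)`. -/
def omega (x y : EuclideanSpace ℝ (Fin n ⊕ Fin n)) : ℝ :=
  (1 / 2) * ∑ i : Fin n, (x (Sum.inl i) * y (Sum.inr i) - x (Sum.inr i) * y (Sum.inl i))

lemma omega_add_left (x x' y : EuclideanSpace ℝ (Fin n ⊕ Fin n)) :
    omega (x + x') y = omega x y + omega x' y := by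
  simp only [omega, PiLp.add_apply, ← mul_add, ← Finset.sum_add_distrib]
  congr 1
  exact Finset.sum_congr rfl fun i _ => by ring

lemma omega_swap (x y : EuclideanSpace ℝ (Fin n ⊕ Fin n)) : omega y x = -omega x y := by
  simp only [omega, ← mul_neg, ← Finset.sum_neg_distrib]
  congr 1
  exact Finset.sum_congr rfl fun i _ => by ring

lemma omega_add_right (x y y' : EuclideanSpace ℝ (Fin n ⊕ Fin n)) :
    omega x (y + y') = omega x y + omega x y' := by
  rw [omega_swap, omega_add_left, omega_swap x y, omega_swap x y']
  ring

lemma omega_neg_left (x y : EuclideanSpace ℝ (Fin n ⊕ Fin n)) :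
    omega (-x) y = -omega x y := by
  simp only [omega, PiLp.neg_apply, ← mul_neg, ← Finset.sum_neg_distrib]
  congr 1
  exact Finset.sum_congr rfl fun i _ => by ring

lemma omega_self (x : EuclideanSpace ℝ (Fin n ⊕ Fin n)) : omega x x = 0 := by
  have := omega_swap x x
  linarith

lemma omega_zero_left (y : EuclideanSpace ℝ (Fin n ⊕ Fin n)) : omega 0 y = 0 := by
  simp [omega]

lemma omega_zero_right (y : EuclideanSpace ℝ (Fin n ⊕ Fin n)) : omega y 0 = 0 := by
  simp [omega]

instance : Mul (Heisenberg n) := ⟨fun p q => ⟨p.z + q.z, p.t + q.t + omega p.z q.z⟩⟩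

instance : One (Heisenberg n) := ⟨⟨0, 0⟩⟩

instance : Inv (Heisenberg n) := ⟨fun p => ⟨-p.z, -p.t⟩⟩

@[simp] lemma mul_z (p q : Heisenberg n) : (p * q).z = p.z + q.z := rfl
@[simp] lemma mul_t (p q : Heisenberg n) : (p * q).t = p.t + q.t + omega p.z q.z := rfl
@[simp] lemma one_z : (1 : Heisenberg n).z = 0 := rfl
@[simp] lemma one_t : (1 : Heisenberg n).t = 0 := rfl
@[simp] lemma inv_z (p : Heisenberg n) : (p⁻¹).z = -p.z := rfl
@[simp] lemma inv_t (p : Heisenberg n) : (p⁻¹).t = -p.t := rfl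

instance : Group (Heisenberg n) :=
  Group.ofLeftAxioms
    (fun p q r => by
      ext1
      · simp [add_assoc]
      · simp only [mul_t, mul_z, omega_add_left, omega_add_right]; ring)
    (fun p => by ext1 <;> simp [omega_zero_left])
    (fun p => by ext1 <;> simp [omega_neg_left, omega_self])

/-- The Korányi norm `‖(x, t)‖ = (|x|⁴ + 16 t²)^{1/4}`. -/
def koranyiNorm (p : Heisenberg n) : ℝ := (‖p.z‖ ^ 4 + 16 * p.t ^ 2) ^ (1 / 4 : ℝ)

lemma koranyiNorm_nonneg (p : Heisenberg n) : 0 ≤ koranyiNorm p :=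
  Real.rpow_nonneg (by positivity) _

lemma koranyiNorm_sq (p : Heisenberg n) :
    koranyiNorm p ^ 2 = ‖(⟨‖p.z‖ ^ 2, 4 * p.t⟩ : ℂ)‖ := by
  rw [Complex.norm_def, Complex.normSq_mk, Real.sqrt_eq_rpow, koranyiNorm, ← Real.rpow_natCast,
    ← Real.rpow_mul (by positivity)]
  congr 1
  · ring
  · norm_num

lemma inner_sq_add_omega_sq_le (x y : EuclideanSpace ℝ (Fin n ⊕ Fin n)) :
    ‖(⟨inner ℝ x y, 2 * omega x y⟩ : ℂ)‖ ≤ ‖x‖ * ‖y‖ := by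
  let c : EuclideanSpace ℝ (Fin n ⊕ Fin n) → EuclideanSpace ℂ (Fin n) :=
    fun x => WithLp.toLp 2 fun i => (⟨x (Sum.inl i), x (Sum.inr i)⟩ : ℂ)
  have hc : ∀ x, ‖c x‖ = ‖x‖ := by
    intro x
    rw [EuclideanSpace.norm_eq, EuclideanSpace.norm_eq, Fintype.sum_sum_type,
      ← Finset.sum_add_distrib]
    congr 1
    refine Finset.sum_congr rfl fun i _ => ?_
    rw [Complex.sq_norm, Complex.normSq_mk]
    simp [pow_two]
  have hi : (⟨inner ℝ x y, 2 * omega x y⟩ : ℂ) = inner ℂ (c x) (c y) := by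
    simp only [PiLp.inner_apply]
    apply Complex.ext
    · rw [Complex.re_sum]
      simp only [Fintype.sum_sum_type]
      rw [← Finset.sum_add_distrib]
      refine Finset.sum_congr rfl fun i _ => ?_
      simp [c]
    · rw [Complex.im_sum]
      simp only [omega]
      rw [← mul_assoc, show (2 : ℝ) * (1 / 2) = 1 by norm_num, one_mul]
      refine Finset.sum_congr rfl fun i _ => ?_
      simp [c]
      ring
  rw [hi, ← hc x, ← hc y]
  exact norm_inner_le_norm _ _

lemma koranyiNorm_mul_le (p q : Heisenberg n) :
    koranyiNorm (p * q) ≤ koranyiNorm p + koranyiNorm q := by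
  have hz : ∀ r : Heisenberg n, ‖r.z‖ ≤ koranyiNorm r := by
    intro r
    refine le_of_sq_le_sq ?_ (koranyiNorm_nonneg r)
    rw [koranyiNorm_sq]
    calc ‖r.z‖ ^ 2 ≤ |(⟨‖r.z‖ ^ 2, 4 * r.t⟩ : ℂ).re| := le_abs_self _
      _ ≤ _ := Complex.abs_re_le_norm _
  refine le_of_sq_le_sq ?_ (add_nonneg (koranyiNorm_nonneg p) (koranyiNorm_nonneg q))
  have key : (⟨‖(p * q).z‖ ^ 2, 4 * (p * q).t⟩ : ℂ) =
      ⟨‖p.z‖ ^ 2, 4 * p.t⟩ + ⟨‖q.z‖ ^ 2, 4 * q.t⟩ +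
        2 * ⟨inner ℝ p.z q.z, 2 * omega p.z q.z⟩ := by
    apply Complex.ext
    · simp [norm_add_sq_real]
      ring
    · simp
      ring
  have h1 := inner_sq_add_omega_sq_le p.z q.z
  have h2 : ‖p.z‖ * ‖q.z‖ ≤ koranyiNorm p * koranyiNorm q :=
    mul_le_mul (hz p) (hz q) (norm_nonneg _) (koranyiNorm_nonneg p)
  have h3 : ‖(2 : ℂ) * ⟨inner ℝ p.z q.z, 2 * omega p.z q.z⟩‖ ≤
      2 * (koranyiNorm p * koranyiNorm q) := by
    rw [norm_mul]
    simp only [Complex.norm_ofNat]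
    linarith
  calc koranyiNorm (p * q) ^ 2 = _ := koranyiNorm_sq _
    _ ≤ koranyiNorm p ^ 2 + koranyiNorm q ^ 2 + 2 * (koranyiNorm p * koranyiNorm q) := by
      rw [key, koranyiNorm_sq p, koranyiNorm_sq q]
      exact (norm_add_le _ _).trans (add_le_add (norm_add_le _ _) h3)
    _ = (koranyiNorm p + koranyiNorm q) ^ 2 := by ring

lemma koranyiNorm_one : koranyiNorm (1 : Heisenberg n) = 0 := by
  simp [koranyiNorm]

lemma koranyiNorm_inv (p : Heisenberg n) : koranyiNorm p⁻¹ = koranyiNorm p := by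
  simp [koranyiNorm]

lemma eq_one_of_koranyiNorm_eq_zero {p : Heisenberg n} (h : koranyiNorm p = 0) : p = 1 := by
  have h0 : ‖p.z‖ ^ 4 + 16 * p.t ^ 2 = 0 :=
    ((Real.rpow_eq_zero_iff_of_nonneg (by positivity)).1 h).1
  have h1 : 0 ≤ ‖p.z‖ ^ 4 := by positivity
  have h2 : 0 ≤ p.t ^ 2 := by positivity
  ext1
  · exact norm_eq_zero.1 (pow_eq_zero_iff (by norm_num) |>.1 (by linarith : ‖p.z‖ ^ 4 = 0))
  · exact pow_eq_zero_iff (by norm_num) |>.1 (by linarith : p.t ^ 2 = 0)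

/-- The left-invariant Korányi metric `d(p, q) = ‖p⁻¹ · q‖`. -/
instance : MetricSpace (Heisenberg n) where
  dist p q := koranyiNorm (p⁻¹ * q)
  dist_self p := by rw [inv_mul_cancel, koranyiNorm_one]
  dist_comm p q := by rw [← koranyiNorm_inv (p⁻¹ * q)]; simp [mul_inv_rev]
  dist_triangle p q r := by
    have := koranyiNorm_mul_le (p⁻¹ * q) (q⁻¹ * r)
    rwa [mul_assoc, mul_inv_cancel_left] at this
  eq_of_dist_eq_zero {p q} h := by
    have := eq_one_of_koranyiNorm_eq_zero h
    exact (inv_mul_eq_one.1 this)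

lemma dist_def (p q : Heisenberg n) : dist p q = koranyiNorm (p⁻¹ * q) := rfl

instance : MeasurableSpace (Heisenberg n) := borel _

instance : BorelSpace (Heisenberg n) := ⟨rfl⟩

/-- An affine horizontal `k`-plane `q · (V' × {0})`, given by a base point `q` and an isotropic
`k`-dimensional subspace `V'` of `ℝ²ⁿ`. -/
structure HorizontalPlane (n k : ℕ) where
  base : Heisenberg n
  dir : Submodule ℝ (EuclideanSpace ℝ (Fin n ⊕ Fin n))
  isotropic : ∀ x ∈ dir, ∀ y ∈ dir, omega x y = 0
  finrank_dir : Module.finrank ℝ dir = k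

namespace HorizontalPlane

variable {k : ℕ}

/-- The underlying set `q · (V' × {0})`. The sets of this form are the members of the family
`𝒱^k(ℍⁿ)`. -/
def carrier (V : HorizontalPlane n k) : Set (Heisenberg n) :=
  {p | ∃ v ∈ V.dir, p = V.base * ⟨v, 0⟩}

/-- The horizontal projection `P(p) = q · P'(q⁻¹ · p)` onto `q · (V' × {0})`, where
`P'(x, t) = (π(x), 0)` and `π` is the orthogonal projection of `ℝ²ⁿ` onto `V'`. -/
def proj (V : HorizontalPlane n k) (p : Heisenberg n) : Heisenberg n :=
  V.base * ⟨V.dir.starProjection (V.base⁻¹ * p).z, 0⟩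

lemma proj_mem (V : HorizontalPlane n k) (p : Heisenberg n) : V.proj p ∈ V.carrier :=
  ⟨_, Submodule.starProjection_apply_mem _ _, rfl⟩

/-- The horizontal projection depends only on the plane as a set, not on the way in which it is
written as `q · (V' × {0})`. -/
lemma proj_eq_of_carrier_eq {V W : HorizontalPlane n k} (h : V.carrier = W.carrier) :
    V.proj = W.proj := by
  have hb : W.base ∈ V.carrier := by
    rw [h]; exact ⟨0, W.dir.zero_mem, by ext1 <;> simp [omega_zero_right]⟩
  obtain ⟨v, hv, hvb⟩ := hb
  have hmul : ∀ w ∈ V.dir, W.base * ⟨w, 0⟩ = V.base * ⟨v + w, 0⟩ := by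
    intro w hw
    rw [hvb, mul_assoc]
    congr 1
    ext1 <;> simp [V.isotropic v hv w hw]
  have hdir : V.dir = W.dir := by
    apply le_antisymm
    · intro w hw
      have : W.base * ⟨w, 0⟩ ∈ W.carrier := by
        rw [← h, hmul w hw]; exact ⟨_, V.dir.add_mem hv hw, rfl⟩
      obtain ⟨u, hu, hu'⟩ := this
      have := congrArg Heisenberg.z (mul_left_cancel hu')
      simp only at this
      rwa [this]
    · intro w hw
      have : W.base * ⟨w, 0⟩ ∈ V.carrier := by rw [h]; exact ⟨w, hw, rfl⟩
      obtain ⟨u, hu, hu'⟩ := this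
      rw [hvb, mul_assoc] at hu'
      have := congrArg Heisenberg.z (mul_left_cancel hu')
      simp only [mul_z] at this
      rw [show w = u - v by rw [← this]; abel]
      exact V.dir.sub_mem hu hv
  funext p
  have hz : (W.base⁻¹ * p).z = (V.base⁻¹ * p).z - v := by
    rw [hvb]; simp only [mul_z, inv_z]; abel
  have hmem := Submodule.starProjection_apply_mem V.dir (V.base⁻¹ * p).z
  unfold proj
  simp only [← hdir]
  rw [hz, map_sub, Submodule.starProjection_eq_self_iff.2 hv,
    hmul _ (V.dir.sub_mem hmem hv)]
  simp

end HorizontalPlane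

end Heisenberg

/-! ### Regular sets, dyadic systems and geometric lemmas in metric spaces -/

section Metric

variable {X : Type*} [MetricSpace X] [MeasurableSpace X] [BorelSpace X]

/-- `E ∈ Reg_s(C)`: the closed set `E`, of positive (possibly infinite) diameter, is `s`-regular
with regularity constant `C`. -/
structure IsRegularSet (s C : ℝ) (E : Set X) : Prop where
  one_le : 1 ≤ C
  isClosed : IsClosed E
  ediam_pos : 0 < Metric.ediam E
  lower : ∀ x ∈ E, ∀ r : ℝ, 0 < r → ENNReal.ofReal r < 2 * Metric.ediam E →
    ENNReal.ofReal (C⁻¹ * r ^ s) ≤ μH[s] (Metric.ball x r ∩ E)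
  upper : ∀ x ∈ E, ∀ r : ℝ, 0 < r → ENNReal.ofReal r < 2 * Metric.ediam E →
    μH[s] (Metric.ball x r ∩ E) ≤ ENNReal.ofReal (C * r ^ s)

/-- The index set `𝕁` of generations of dyadic cubes of `E`. If `E` is unbounded, this is all
of `ℤ`; if `2⁻ⁿ ≤ diam E < 2⁻ⁿ⁺¹`, it is `{j | n ≤ j}`. -/
def dyadicIndex (E : Set X) : Set ℤ :=
  {j | ENNReal.ofReal ((2 : ℝ) ^ (-j)) ≤ Metric.ediam E}

/-- `Δ` is a system of dyadic cubes on `E` with constant `c₀`; `Δ j` is the family of cubes of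
generation `j`, for `j` in the index set of `E`. -/
structure IsDyadicSystem (E : Set X) (c₀ : ℝ) (Δ : ℤ → Set (Set X)) : Prop where
  subset : ∀ j ∈ dyadicIndex E, ∀ Q ∈ Δ j, Q ⊆ E
  measurableSet : ∀ j ∈ dyadicIndex E, ∀ Q ∈ Δ j, MeasurableSet Q
  pairwiseDisjoint : ∀ j ∈ dyadicIndex E, (Δ j).PairwiseDisjoint id
  cover : ∀ j ∈ dyadicIndex E, E = ⋃₀ Δ j
  nested : ∀ i ∈ dyadicIndex E, ∀ j ∈ dyadicIndex E, i ≤ j → ∀ Q ∈ Δ i, ∀ Q' ∈ Δ j,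
    Q' ⊆ Q ∨ Q ∩ Q' = ∅
  ancestor : ∀ i ∈ dyadicIndex E, ∀ j ∈ dyadicIndex E, i < j → ∀ Q' ∈ Δ j,
    ∃! Q, Q ∈ Δ i ∧ Q' ⊆ Q
  ediam_le : ∀ j ∈ dyadicIndex E, ∀ Q ∈ Δ j,
    Metric.ediam Q ≤ ENNReal.ofReal (c₀⁻¹ * (2 : ℝ) ^ (-j))
  center : ∀ j ∈ dyadicIndex E, ∀ Q ∈ Δ j,
    ∃ x ∈ E, Metric.ball x (c₀ * (2 : ℝ) ^ (-j)) ∩ E ⊆ Q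

/-- The family `⋃_{j ∈ 𝕁} Δ_j` of all cubes. -/
def dyadicCubes (E : Set X) (Δ : ℤ → Set (Set X)) : Set (Set X) :=
  ⋃ j ∈ dyadicIndex E, Δ j

/-- The enlarged cube `KQ = {x ∈ E | dist(x, Q) ≤ (K - 1) diam Q}`. -/
def dilateCube (E : Set X) (K : ℝ) (Q : Set X) : Set X :=
  {x ∈ E | Metric.infEDist x Q ≤ ENNReal.ofReal (K - 1) * Metric.ediam Q}

/-- `E ∈ GLem(h, p, M)` for the `s`-dimensional set `E`, where the dyadic systems are those with
constant `c₀`: for every dyadic system and every cube `Q₀` in it, the sum of `h(2Q)^p μ(Q)` over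
the cubes `Q ⊆ Q₀` is at most `M μ(Q₀)`, where `μ` is the restriction to `E` of the
`s`-dimensional Hausdorff measure. -/
def GLem (s c₀ : ℝ) (E : Set X) (h : Set X → ℝ≥0∞) (p : ℝ) (M : ℝ≥0) : Prop :=
  ∀ Δ : ℤ → Set (Set X), IsDyadicSystem E c₀ Δ → ∀ Q₀ ∈ dyadicCubes E Δ,
    ∑' Q : {Q : Set X // Q ∈ dyadicCubes E Δ ∧ Q ⊆ Q₀},
      h (dilateCube E 2 Q.1) ^ p * (μH[s]).restrict E Q.1 ≤ M * (μH[s]).restrict E Q₀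

/-- The number `β_{p,V}(S)` with respect to a measure `μ` and a single set `V`. -/
def betaOne (μ : Measure X) (p : ℝ) (V S : Set X) : ℝ≥0∞ :=
  ((μ S)⁻¹ * ∫⁻ x in S, (Metric.infEDist x V / Metric.ediam S) ^ p ∂μ) ^ (1 / p)

/-- The number `β_{p,𝒱}(S)` for a family `𝒱` of sets. -/
def betaNumber {ι : Type*} (μ : Measure X) (p : ℝ) (𝒱 : ι → Set X) (S : Set X) : ℝ≥0∞ :=
  ⨅ i, betaOne μ p (𝒱 i) S

/-- The number `ι_{p,V}(S)` with respect to a measure `μ`, for a plane `V` with projection `π`. -/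
def iotaOne (μ : Measure X) (p : ℝ) (π : X → X) (S : Set X) : ℝ≥0∞ :=
  (((μ S) ^ 2)⁻¹ * ∫⁻ y in S, ∫⁻ x in S,
    (ENNReal.ofReal |dist x y - dist (π x) (π y)| / Metric.ediam S) ^ p ∂μ ∂μ) ^ (1 / p)

/-- The number `ι_{p,𝒱}(S)` for a family of planes with projections `π i`. -/
def iotaNumber {ι : Type*} (μ : Measure X) (p : ℝ) (π : ι → X → X) (S : Set X) : ℝ≥0∞ :=
  ⨅ i, iotaOne μ p (π i) S

end Metric

namespace Heisenberg

/-- The coefficients `β_{p,𝒱^k(ℍⁿ)}` of a `k`-regular set `E ⊆ ℍⁿ`. -/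
def horizontalBeta {n : ℕ} (k : ℕ) (E : Set (Heisenberg n)) (p : ℝ) :
    Set (Heisenberg n) → ℝ≥0∞ :=
  betaNumber ((μH[(k : ℝ)] : Measure (Heisenberg n)).restrict E) p
    (fun V : HorizontalPlane n k => V.carrier)

/-- The coefficients `ι_{p,𝒱^k(ℍⁿ)}` of a `k`-regular set `E ⊆ ℍⁿ`. -/
def horizontalIota {n : ℕ} (k : ℕ) (E : Set (Heisenberg n)) (p : ℝ) :
    Set (Heisenberg n) → ℝ≥0∞ :=
  iotaNumber ((μH[(k : ℝ)] : Measure (Heisenberg n)).restrict E) p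
    (fun V : HorizontalPlane n k => V.proj)

end Heisenberg

end

/-!
For `x ∈ E` and `t ∈ ℕ` let `U_t(x)` be a plane that is nearly optimal for `β_{2p}` of a fixed
ancestor of the cube of generation `J + t` containing `x`. The exponents `p` and `2p` are linked
by an elementary estimate: `|d(x, y) - d(P x, P y)| d(x, y)` is at most
`4 (d(x, P x) + d(y, P y))² + |π_⊥(y - x)|²` for the projection `P` onto a horizontal plane, so that
the loss of distance is quadratic in the distances from the plane. These distances should be
small relative to `d(x, y)`, so for pairs of points at distance about `2^{-s}` times the size of the
cube one passes to the planes on that smaller scale. The part `π_⊥(y - x)` is then controlled by the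
angle between planes of different scales: two planes that approximate a regular set in the same ball
have close directions, because a regular set is not contained in a thin slab, and summing over the
intermediate scales costs a factor `s + 1`. Integration over dyadic annuli gains `2^{-s}`, and the
Carleson condition for `β_{2p}` bounds the sum of the resulting error terms over all cubes.
-/

noncomputable section

/-! ### Loss of distance under horizontal projections -/

lemma ennreal_add_sq_le (a b : ℝ≥0∞) : (a + b) ^ 2 ≤ 2 * (a ^ 2 + b ^ 2) := by
  have h : (2 : ℝ) - 1 = 1 := by norm_num
  simpa [h] using ENNReal.rpow_add_le_mul_rpow_add_rpow a b one_le_two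

section InnerProduct

variable {F : Type*} [NormedAddCommGroup F] [InnerProductSpace ℝ F]

lemma exists_orthonormalBasis_apply_zero_eq {d : ℕ} (hd : Module.finrank ℝ F = d + 1) {u : F}
    (hu : ‖u‖ = 1) : ∃ b : OrthonormalBasis (Fin (d + 1)) ℝ F, b 0 = u := by
  have : FiniteDimensional ℝ F := Module.finite_of_finrank_pos (by omega)
  have hv : Orthonormal ℝ (({0} : Set (Fin (d + 1))).domRestrict fun _ => u) := by
    rw [orthonormal_iff_ite]
    rintro ⟨i, rfl⟩ ⟨j, rfl⟩
    simp [domRestrict, hu]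
  obtain ⟨b, hb⟩ := hv.exists_orthonormalBasis_extension_of_card_eq (by simp [hd])
  exact ⟨b, hb 0 rfl⟩

lemma norm_starProjection_le_sum_abs_inner {ι : Type*} [Fintype ι] {W : Submodule ℝ F}
    [W.HasOrthogonalProjection] (b : OrthonormalBasis ι ℝ W) (z : F) :
    ‖W.starProjection z‖ ≤ ∑ i, |inner ℝ (b i : F) z| := by
  rw [Submodule.starProjection_apply, b.orthogonalProjectionOnto_apply_eq_sum]
  push_cast
  refine (norm_sum_le _ _).trans_eq (Finset.sum_congr rfl fun i _ => ?_)
  rw [norm_smul, Submodule.norm_coe, b.norm_eq_one, mul_one, Real.norm_eq_abs]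

variable (V W : Submodule ℝ F) [V.HasOrthogonalProjection] [W.HasOrthogonalProjection]

lemma abs_inner_starProjection_orthogonal_le (w z : F) :
    |inner ℝ (W.starProjection (Vᗮ.starProjection w)) z| ≤
      ‖Vᗮ.starProjection w‖ * (‖Vᗮ.starProjection z‖ + ‖Wᗮ.starProjection z‖) := by
  have hidem : Vᗮ.starProjection (Vᗮ.starProjection w) = Vᗮ.starProjection w :=
    Submodule.starProjection_eq_self_iff.2 (Submodule.starProjection_apply_mem _ _)
  have hsub : W.starProjection z = z - Wᗮ.starProjection z := by
    rw [Submodule.starProjection_orthogonal_val, sub_sub_cancel]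
  rw [Submodule.inner_starProjection_left_eq_right, ← hidem,
    Submodule.inner_starProjection_left_eq_right, hidem, hsub, map_sub]
  refine (abs_real_inner_le_norm _ _).trans ?_
  gcongr
  exact (norm_sub_le _ _).trans (by gcongr; exact Vᗮ.norm_starProjection_apply_le _)

lemma norm_sq_starProjection_orthogonal_le {w : F} (hw : w ∈ W) :
    ‖Vᗮ.starProjection w‖ ^ 2 ≤ ‖W.starProjection (Vᗮ.starProjection w)‖ * ‖w‖ := by
  have h : ‖Vᗮ.starProjection w‖ ^ 2 =
      inner ℝ (W.starProjection (Vᗮ.starProjection w)) w := by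
    rw [Submodule.inner_starProjection_left_eq_right, Submodule.starProjection_eq_self_iff.2 hw]
    exact (Vᗮ.re_inner_starProjection_eq_normSq w).symm
  exact h ▸ real_inner_le_norm _ _

lemma exists_unit_mem_norm_mul_abs_inner_le {w : F} (hw : w ∈ W)
    (hne : Vᗮ.starProjection w ≠ 0) :
    ∃ u ∈ W, ‖u‖ = 1 ∧ ∀ z, ‖Vᗮ.starProjection w‖ * |inner ℝ u z| ≤
      ‖w‖ * (‖Vᗮ.starProjection z‖ + ‖Wᗮ.starProjection z‖) := by
  set t := Vᗮ.starProjection w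
  set u := W.starProjection t
  have ht : 0 < ‖t‖ := norm_pos_iff.2 hne
  have hut : ‖t‖ ^ 2 ≤ ‖u‖ * ‖w‖ := norm_sq_starProjection_orthogonal_le V W hw
  have hu : 0 < ‖u‖ := by
    refine norm_pos_iff.2 fun h0 => ?_
    rw [h0, norm_zero, zero_mul] at hut
    exact (pow_pos ht 2).not_ge hut
  refine ⟨‖u‖⁻¹ • u, W.smul_mem _ (Submodule.starProjection_apply_mem _ _), ?_, fun z => ?_⟩
  · rw [norm_smul, norm_inv, norm_norm, inv_mul_cancel₀ hu.ne']
  set s := ‖Vᗮ.starProjection z‖ + ‖Wᗮ.starProjection z‖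
  rw [real_inner_smul_left, abs_mul, abs_inv, abs_norm, mul_left_comm, inv_mul_le_iff₀ hu]
  calc ‖t‖ * |inner ℝ u z| ≤ ‖t‖ * (‖t‖ * s) := by
        gcongr
        exact abs_inner_starProjection_orthogonal_le V W w z
    _ = ‖t‖ ^ 2 * s := by ring
    _ ≤ ‖u‖ * ‖w‖ * s := by gcongr
    _ = ‖u‖ * (‖w‖ * s) := mul_assoc _ _ _

lemma norm_starProjection_orthogonal_le_add {θ : ℝ} (hθ : 0 ≤ θ)
    (h : ∀ w ∈ W, ‖Vᗮ.starProjection w‖ ≤ θ * ‖w‖) (z : F) :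
    ‖Vᗮ.starProjection z‖ ≤ ‖Wᗮ.starProjection z‖ + θ * ‖z‖ := by
  conv_lhs => rw [← W.starProjection_add_starProjection_orthogonal z, map_add, add_comm]
  refine (norm_add_le _ _).trans (add_le_add (Vᗮ.norm_starProjection_apply_le _) ?_)
  refine (h _ (Submodule.starProjection_apply_mem _ _)).trans ?_
  gcongr
  exact W.norm_starProjection_apply_le z

end InnerProduct

namespace Heisenberg

variable {n k : ℕ}

lemma koranyiNorm_pow_four (p : Heisenberg n) :
    koranyiNorm p ^ 4 = ‖p.z‖ ^ 4 + 16 * p.t ^ 2 := by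
  rw [koranyiNorm, ← Real.rpow_natCast, ← Real.rpow_mul (by positivity)]
  norm_num

lemma norm_z_le_koranyiNorm (p : Heisenberg n) : ‖p.z‖ ≤ koranyiNorm p := by
  refine le_of_pow_le_pow_left₀ (n := 4) (by norm_num) (koranyiNorm_nonneg p) ?_
  rw [koranyiNorm_pow_four]
  exact le_add_of_nonneg_right (by positivity)

lemma four_mul_abs_t_le (p : Heisenberg n) : 4 * |p.t| ≤ koranyiNorm p ^ 2 := by
  refine le_of_pow_le_pow_left₀ (n := 2) (by norm_num) (by positivity) ?_
  rw [← pow_mul, koranyiNorm_pow_four, mul_pow, sq_abs]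
  linarith [pow_nonneg (norm_nonneg p.z) 4]

lemma koranyiNorm_horizontal (v : EuclideanSpace ℝ (Fin n ⊕ Fin n)) :
    koranyiNorm (⟨v, 0⟩ : Heisenberg n) = ‖v‖ := by
  refine (pow_left_inj₀ (koranyiNorm_nonneg _) (norm_nonneg v) (n := 4) (by norm_num)).1 ?_
  rw [koranyiNorm_pow_four]
  simp

lemma two_mul_abs_omega_le (x y : EuclideanSpace ℝ (Fin n ⊕ Fin n)) :
    2 * |omega x y| ≤ ‖x‖ * ‖y‖ := by
  have h := (Complex.abs_im_le_norm _).trans (inner_sq_add_omega_sq_le x y)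
  simpa [abs_mul] using h

lemma inv_mul_z (p q : Heisenberg n) : (p⁻¹ * q).z = q.z - p.z := by
  simp only [mul_z, inv_z]
  abel

lemma norm_z_sub_le_dist (p q : Heisenberg n) : ‖q.z - p.z‖ ≤ dist p q := by
  rw [dist_def, ← inv_mul_z]
  exact norm_z_le_koranyiNorm _

lemma four_mul_abs_t_inv_mul_horizontal_mul_le (a b : Heisenberg n)
    (v : EuclideanSpace ℝ (Fin n ⊕ Fin n)) :
    4 * |(a⁻¹ * ⟨v, 0⟩ * b).t| ≤
      (koranyiNorm a + koranyiNorm b) ^ 2 + 2 * (‖v‖ * (koranyiNorm a + koranyiNorm b)) := by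
  have ht : (a⁻¹ * ⟨v, 0⟩ * b).t =
      b.t - a.t - omega a.z b.z + (omega v b.z + omega v a.z) := by
    simp only [mul_t, mul_z, inv_t, inv_z, omega_add_left, omega_neg_left]
    rw [omega_swap v a.z]
    ring
  have htri : |(a⁻¹ * ⟨v, 0⟩ * b).t| ≤
      |b.t| + |a.t| + |omega a.z b.z| + (|omega v b.z| + |omega v a.z|) := by
    rw [ht]
    exact (abs_add_le _ _).trans (add_le_add
      ((abs_sub _ _).trans (add_le_add_left (abs_sub _ _) _)) (abs_add_le _ _))
  have hab : ‖a.z‖ * ‖b.z‖ ≤ koranyiNorm a * koranyiNorm b :=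
    mul_le_mul (norm_z_le_koranyiNorm a) (norm_z_le_koranyiNorm b) (norm_nonneg _)
      (koranyiNorm_nonneg a)
  have hva := mul_le_mul_of_nonneg_left (norm_z_le_koranyiNorm a) (norm_nonneg v)
  have hvb := mul_le_mul_of_nonneg_left (norm_z_le_koranyiNorm b) (norm_nonneg v)
  linarith [four_mul_abs_t_le a, four_mul_abs_t_le b, two_mul_abs_omega_le a.z b.z,
    two_mul_abs_omega_le v b.z, two_mul_abs_omega_le v a.z]

namespace HorizontalPlane

variable (V : HorizontalPlane n k)

/-- The orthogonal projection of `ℝ²ⁿ` onto the orthogonal complement of the direction `V'` of a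
horizontal plane `q · (V' × {0})`; `‖V.perp z‖` is the distance of `z` to `V'`. -/
def perp : EuclideanSpace ℝ (Fin n ⊕ Fin n) →L[ℝ] EuclideanSpace ℝ (Fin n ⊕ Fin n) :=
  V.dirᗮ.starProjection

lemma norm_perp_le (z : EuclideanSpace ℝ (Fin n ⊕ Fin n)) : ‖V.perp z‖ ≤ ‖z‖ :=
  V.dirᗮ.norm_starProjection_apply_le z

lemma inv_proj_mul_proj (x y : Heisenberg n) :
    (V.proj x)⁻¹ * V.proj y = ⟨V.dir.starProjection (y.z - x.z), 0⟩ := by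
  unfold proj
  rw [mul_inv_rev, mul_assoc, inv_mul_cancel_left]
  ext1
  · simp only [mul_z, inv_z, map_sub, map_add]
    abel
  · simp only [mul_t, inv_t, inv_z, omega_neg_left,
      V.isotropic _ (Submodule.starProjection_apply_mem V.dir _) _
        (Submodule.starProjection_apply_mem V.dir _)]
    simp

lemma dist_proj_proj (x y : Heisenberg n) :
    dist (V.proj x) (V.proj y) = ‖V.dir.starProjection (y.z - x.z)‖ := by
  rw [dist_def, inv_proj_mul_proj, koranyiNorm_horizontal]

lemma norm_z_sub_sq_eq (x y : Heisenberg n) :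
    ‖y.z - x.z‖ ^ 2 = dist (V.proj x) (V.proj y) ^ 2 + ‖V.perp (y.z - x.z)‖ ^ 2 := by
  rw [dist_proj_proj]
  exact V.dir.norm_sq_eq_add_norm_sq_starProjection _

lemma proj_eq_self_of_mem {v : Heisenberg n} (hv : v ∈ V.carrier) : V.proj v = v := by
  obtain ⟨w, hw, rfl⟩ := hv
  rw [proj, inv_mul_cancel_left, Submodule.starProjection_eq_self_iff.2 hw]

lemma dist_proj_proj_le (x y : Heisenberg n) : dist (V.proj x) (V.proj y) ≤ dist x y := by
  rw [dist_proj_proj]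
  exact (V.dir.norm_starProjection_apply_le _).trans (norm_z_sub_le_dist x y)

lemma edist_proj_le (x : Heisenberg n) :
    edist x (V.proj x) ≤ 2 * Metric.infEDist x V.carrier := by
  rw [mul_comm, ← ENNReal.div_le_iff (by simp) (by simp), Metric.le_infEDist]
  intro v hv
  rw [ENNReal.div_le_iff (by simp) (by simp), mul_two]
  have hproj : edist v (V.proj x) ≤ edist x v := by
    have h := V.dist_proj_proj_le v x
    rw [V.proj_eq_self_of_mem hv, dist_comm v x] at h
    rw [edist_dist, edist_dist]
    exact ENNReal.ofReal_le_ofReal h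
  exact (edist_triangle x v _).trans (by gcongr)

lemma perp_z_sub_eq (x y : Heisenberg n) :
    V.perp (y.z - x.z) = ((V.proj y)⁻¹ * y).z - ((V.proj x)⁻¹ * x).z := by
  have h := congrArg Heisenberg.z (V.inv_proj_mul_proj x y)
  simp only [inv_mul_z] at h
  rw [perp, Submodule.starProjection_orthogonal_val, ← h, inv_mul_z, inv_mul_z]
  abel

lemma norm_perp_z_sub_le (x y : Heisenberg n) :
    ‖V.perp (y.z - x.z)‖ ≤ dist x (V.proj x) + dist y (V.proj y) := by
  rw [perp_z_sub_eq, inv_mul_z, inv_mul_z, add_comm, dist_comm x, dist_comm y]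
  exact (norm_sub_le _ _).trans (add_le_add (norm_z_sub_le_dist _ _) (norm_z_sub_le_dist _ _))

lemma four_mul_abs_t_le_sq_add (x y : Heisenberg n) :
    4 * |(x⁻¹ * y).t| ≤ (dist x (V.proj x) + dist y (V.proj y)) ^ 2 +
      2 * (dist (V.proj x) (V.proj y) * (dist x (V.proj x) + dist y (V.proj y))) := by
  have h := four_mul_abs_t_inv_mul_horizontal_mul_le ((V.proj x)⁻¹ * x) ((V.proj y)⁻¹ * y)
    (V.dir.starProjection (y.z - x.z))
  have hxy : ((V.proj x)⁻¹ * x)⁻¹ * ⟨V.dir.starProjection (y.z - x.z), 0⟩ *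
      ((V.proj y)⁻¹ * y) = x⁻¹ * y := by
    rw [← inv_proj_mul_proj]
    group
  rwa [hxy, ← dist_def, ← dist_def, ← dist_proj_proj, dist_comm (V.proj x) x,
    dist_comm (V.proj y) y] at h

lemma dist_sq_le (x y : Heisenberg n) :
    dist x y ^ 2 ≤ dist (V.proj x) (V.proj y) ^ 2 +
      4 * (dist x (V.proj x) + dist y (V.proj y)) ^ 2 := by
  set v := dist (V.proj x) (V.proj y)
  set A := dist x (V.proj x) + dist y (V.proj y)
  have : 0 ≤ A := by positivity
  have : 0 ≤ v := dist_nonneg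
  have hz : ‖y.z - x.z‖ ^ 2 ≤ v ^ 2 + A ^ 2 := by
    rw [V.norm_z_sub_sq_eq]
    gcongr
    exact V.norm_perp_z_sub_le x y
  have ht : 4 * |(x⁻¹ * y).t| ≤ A ^ 2 + 2 * (v * A) := V.four_mul_abs_t_le_sq_add x y
  refine le_of_pow_le_pow_left₀ (n := 2) (by norm_num) (by positivity) ?_
  calc (dist x y ^ 2) ^ 2 = (‖y.z - x.z‖ ^ 2) ^ 2 + (4 * |(x⁻¹ * y).t|) ^ 2 := by
        rw [← pow_mul, dist_def, koranyiNorm_pow_four, inv_mul_z, mul_pow, sq_abs]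
        ring
    _ ≤ (v ^ 2 + A ^ 2) ^ 2 + (A ^ 2 + 2 * (v * A)) ^ 2 := by gcongr
    _ ≤ (v ^ 2 + 4 * A ^ 2) ^ 2 := by
        nlinarith [mul_nonneg (sq_nonneg A) (sq_nonneg (v - A)),
          mul_nonneg (sq_nonneg A) (sq_nonneg A), mul_nonneg (sq_nonneg A) (sq_nonneg v)]

/-- The loss of distance `|d(x, y) - d(P(x), P(y))|` under the projection `P` onto a horizontal
plane; these are the quantities averaged in the coefficients `ι`. -/
def projDefect (x y : Heisenberg n) : ℝ≥0∞ :=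
  ENNReal.ofReal |dist x y - dist (V.proj x) (V.proj y)|

lemma abs_dist_sub_dist_proj_mul_dist_le (U : HorizontalPlane n k) (x y : Heisenberg n) :
    |dist x y - dist (U.proj x) (U.proj y)| * dist x y ≤
      4 * (dist x (V.proj x) + dist y (V.proj y)) ^ 2 + ‖U.perp (y.z - x.z)‖ ^ 2 := by
  have hU : dist (U.proj x) (U.proj y) ≤ dist x y := U.dist_proj_proj_le x y
  rw [abs_of_nonneg (sub_nonneg.2 hU)]
  nlinarith [V.dist_sq_le x y, V.norm_z_sub_sq_eq x y, U.norm_z_sub_sq_eq x y,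
    sq_nonneg ‖V.perp (y.z - x.z)‖, dist_nonneg (x := U.proj x) (y := U.proj y)]

lemma edist_proj_add_edist_proj_le (x y : Heisenberg n) :
    edist x (V.proj x) + edist y (V.proj y) ≤
      2 * (Metric.infEDist x V.carrier + Metric.infEDist y V.carrier) := by
  rw [mul_add]
  exact add_le_add (V.edist_proj_le x) (V.edist_proj_le y)

lemma enorm_perp_z_sub_le (x y : Heisenberg n) :
    ‖V.perp (y.z - x.z)‖ₑ ≤
      2 * (Metric.infEDist x V.carrier + Metric.infEDist y V.carrier) := by
  refine le_trans ?_ (V.edist_proj_add_edist_proj_le x y)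
  rw [edist_dist, edist_dist, ← ENNReal.ofReal_add dist_nonneg dist_nonneg, ← ofReal_norm]
  exact ENNReal.ofReal_le_ofReal (V.norm_perp_z_sub_le x y)

lemma projDefect_mul_edist_le (U : HorizontalPlane n k) (x y : Heisenberg n) :
    U.projDefect x y * edist x y ≤
      16 * (Metric.infEDist x V.carrier + Metric.infEDist y V.carrier) ^ 2 +
        ‖U.perp (y.z - x.z)‖ₑ ^ 2 := by
  calc U.projDefect x y * edist x y
      = ENNReal.ofReal (|dist x y - dist (U.proj x) (U.proj y)| * dist x y) := by
        rw [projDefect, edist_dist, ENNReal.ofReal_mul (abs_nonneg _)]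
    _ ≤ ENNReal.ofReal (4 * (dist x (V.proj x) + dist y (V.proj y)) ^ 2 +
          ‖U.perp (y.z - x.z)‖ ^ 2) :=
        ENNReal.ofReal_le_ofReal (V.abs_dist_sub_dist_proj_mul_dist_le U x y)
    _ = 4 * (edist x (V.proj x) + edist y (V.proj y)) ^ 2 + ‖U.perp (y.z - x.z)‖ₑ ^ 2 := by
        rw [ENNReal.ofReal_add (by positivity) (by positivity), ENNReal.ofReal_mul (by norm_num),
          ENNReal.ofReal_pow (by positivity), ENNReal.ofReal_pow (norm_nonneg _),
          ENNReal.ofReal_add dist_nonneg dist_nonneg, ← edist_dist, ← edist_dist, ofReal_norm,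
          ENNReal.ofReal_ofNat]
    _ ≤ 4 * (2 * (Metric.infEDist x V.carrier + Metric.infEDist y V.carrier)) ^ 2 +
          ‖U.perp (y.z - x.z)‖ₑ ^ 2 := by
        gcongr
        exact V.edist_proj_add_edist_proj_le x y
    _ = _ := by ring

lemma projDefect_mul_edist_le_of_enorm_perp_le {U : HorizontalPlane n k} {x y : Heisenberg n}
    {Θ : ℝ≥0∞}
    (hΘ : ‖U.perp (y.z - x.z)‖ₑ ≤ ‖V.perp (y.z - x.z)‖ₑ + Θ * ‖y.z - x.z‖ₑ) :
    U.projDefect x y * edist x y ≤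
      24 * (Metric.infEDist x V.carrier + Metric.infEDist y V.carrier) ^ 2 +
        2 * (Θ * edist x y) ^ 2 := by
  set D := Metric.infEDist x V.carrier + Metric.infEDist y V.carrier
  have hz : ‖y.z - x.z‖ₑ ≤ edist x y := by
    rw [← ofReal_norm, edist_dist]
    exact ENNReal.ofReal_le_ofReal (norm_z_sub_le_dist x y)
  have hperp : ‖U.perp (y.z - x.z)‖ₑ ≤ 2 * D + Θ * edist x y :=
    hΘ.trans (add_le_add (V.enorm_perp_z_sub_le x y) (by gcongr))
  calc U.projDefect x y * edist x y ≤ 16 * D ^ 2 + ‖U.perp (y.z - x.z)‖ₑ ^ 2 :=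
        V.projDefect_mul_edist_le U x y
    _ ≤ 16 * D ^ 2 + 2 * ((2 * D) ^ 2 + (Θ * edist x y) ^ 2) := by
        gcongr
        exact (pow_le_pow_left' hperp 2).trans (ennreal_add_sq_le _ _)
    _ = _ := by ring

end HorizontalPlane

end Heisenberg

/-! ### Directions of planes close to a regular set -/

section Grid

variable {F ι : Type*} [NormedAddCommGroup F] [InnerProductSpace ℝ F] {d : ℕ}

/-- The cell containing `v` in the grid of mesh `δ` in the directions `b i`; cells are labelled by
their integer coordinates. It is used to cover a set by balls of radius comparable to `δ`. -/
def gridCell (b : ι → F) (δ : ℝ) (v : F) : ι → ℤ := fun i => ⌊inner ℝ (b i) v / δ⌋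

lemma abs_inner_sub_le_of_gridCell_eq {b : ι → F} {δ : ℝ} (hδ : 0 < δ) {v w : F}
    (h : gridCell b δ v = gridCell b δ w) (i : ι) : |inner ℝ (b i) (v - w)| ≤ δ := by
  have h1 := (Int.abs_sub_lt_one_of_floor_eq_floor (congrFun h i)).le
  rwa [← sub_div, abs_div, abs_of_pos hδ, div_le_one hδ, ← inner_sub_right] at h1

/-- The cells of a grid in dimension `d + 1` whose coordinate of index `0` is in `[-1, 1]` and whose
other coordinates are in `[-N, N]`. They cover the slab of points at distance at most one mesh
from a hyperplane, in a ball of radius `N` meshes. -/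
def slabCells (d : ℕ) (N : ℤ) : Finset (Fin (d + 1) → ℤ) :=
  Fintype.piFinset (Fin.cons (Finset.Icc (-1) 1) fun _ => Finset.Icc (-N) N)

lemma floor_mem_Icc_of_abs_le {a : ℝ} {N : ℤ} (h : |a| ≤ N) : ⌊a⌋ ∈ Finset.Icc (-N) N := by
  rw [Finset.mem_Icc, Int.le_floor]
  refine ⟨by exact_mod_cast (abs_le.1 h).1, ?_⟩
  exact_mod_cast (Int.floor_le a).trans (abs_le.1 h).2

lemma gridCell_mem_slabCells {b : Fin (d + 1) → F} (hb : ∀ i, ‖b i‖ = 1) {δ : ℝ} (hδ : 0 < δ)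
    {N : ℤ} {v : F} (h0 : |inner ℝ (b 0) v| ≤ δ) (hv : ‖v‖ ≤ N * δ) :
    gridCell b δ v ∈ slabCells d N := by
  rw [slabCells, Fintype.mem_piFinset]
  refine Fin.cases ?_ fun i => ?_
  · refine floor_mem_Icc_of_abs_le (N := 1) ?_
    rwa [abs_div, abs_of_pos hδ, Int.cast_one, div_le_one hδ]
  · refine floor_mem_Icc_of_abs_le ?_
    rw [abs_div, abs_of_pos hδ, div_le_iff₀ hδ]
    refine (abs_real_inner_le_norm _ _).trans ?_
    rwa [hb, one_mul]

lemma card_slabCells_le {ε : ℝ} (hε : 0 < ε) (hε1 : ε ≤ 1) :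
    ((slabCells d ⌈1 / ε⌉).card : ℝ) ≤ 3 * (5 / ε) ^ d := by
  set N := ⌈1 / ε⌉
  have hinv : 1 ≤ 1 / ε := (one_le_div hε).2 hε1
  have hN : 0 ≤ N := Int.ceil_nonneg (by linarith)
  have hside : (((N + 1 - -N).toNat : ℕ) : ℝ) ≤ 5 / ε := by
    have hcast : (((N + 1 - -N).toNat : ℕ) : ℝ) = 2 * N + 1 := by
      have : (((N + 1 - -N).toNat : ℕ) : ℤ) = 2 * N + 1 := by omega
      exact_mod_cast this
    have hceil : (N : ℝ) < 1 / ε + 1 := Int.ceil_lt_add_one _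
    have hfive : 5 / ε = 5 * (1 / ε) := by ring
    rw [hcast]
    linarith
  simp only [slabCells, Fintype.card_piFinset, Fin.prod_univ_succ, Fin.cons_zero, Fin.cons_succ,
    Finset.prod_const, Finset.card_univ, Fintype.card_fin, Int.card_Icc]
  push_cast
  gcongr

end Grid

lemma measure_inter_le_of_setLIntegral_rpow_le {X : Type*} [MeasurableSpace X] {μ : Measure X}
    {f : X → ℝ≥0∞} (hf : Measurable f) {s : Set X} {a c : ℝ≥0∞} {q : ℝ} (hq : 0 < q)
    (ha0 : a ≠ 0) (ha : a ≠ ⊤) (h : ∫⁻ x in s, f x ^ q ∂μ ≤ c * a ^ q) :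
    μ (s ∩ {x | a ≤ f x}) ≤ c := by
  have hmarkov := meas_ge_le_lintegral_div (μ := μ.restrict s) (hf.pow_const q).aemeasurable
    (ε := a ^ q) (by simp [ha0, ha, hq]) (by simp [hq.le, ha])
  simp only [ENNReal.rpow_le_rpow_iff hq] at hmarkov
  rw [Measure.restrict_apply (measurableSet_le measurable_const hf), inter_comm] at hmarkov
  exact hmarkov.trans (ENNReal.div_le_of_le_mul h)

/-- The measure of a ball of radius `r` centred on `E` is at most `C r ^ k`: the upper half of
`k`-regularity, for all radii. -/
def IsUpperRegular {X : Type*} [PseudoMetricSpace X] [MeasurableSpace X] (k : ℕ) (C : ℝ)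
    (E : Set X) (μ : Measure X) : Prop :=
  ∀ x ∈ E, ∀ r : ℝ, 0 < r → μ (Metric.ball x r) ≤ ENNReal.ofReal (C * r ^ k)

namespace Heisenberg

variable {n k : ℕ}

/-- The constant in the bound for the measure of the part of a `k`-dimensional set that lies close
to a horizontal `k`-plane and to a hyperplane of that plane. -/
def slabConst (k : ℕ) (C : ℝ) : ℝ := 3 * 5 ^ k * C * (3 + k) ^ k

lemma one_le_slabConst {C : ℝ} (hC : 1 ≤ C) : 1 ≤ slabConst k C := by
  have h3 : (1 : ℝ) ≤ 3 + k := by linarith [(Nat.cast_nonneg k : (0 : ℝ) ≤ k)]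
  exact one_le_mul_of_one_le_of_one_le (one_le_mul_of_one_le_of_one_le
    (one_le_mul_of_one_le_of_one_le (by norm_num) (one_le_pow₀ (by norm_num))) hC)
    (one_le_pow₀ h3)

namespace HorizontalPlane

lemma dist_lt_of_gridCell_eq {W : HorizontalPlane n k} (b : OrthonormalBasis (Fin k) ℝ W.dir)
    {δ : ℝ} (hδ : 0 < δ) {x x' y : Heisenberg n} (hx : dist x (W.proj x) ≤ δ)
    (hx' : dist x' (W.proj x') ≤ δ)
    (h : gridCell (fun i => (b i : EuclideanSpace ℝ (Fin n ⊕ Fin n))) δ (x'.z - y.z) =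
      gridCell (fun i => (b i : EuclideanSpace ℝ (Fin n ⊕ Fin n))) δ (x.z - y.z)) :
    dist x x' < (3 + k) * δ := by
  have hproj : dist (W.proj x) (W.proj x') ≤ k * δ :=
    calc dist (W.proj x) (W.proj x') = ‖W.dir.starProjection (x'.z - x.z)‖ := W.dist_proj_proj x x'
      _ ≤ ∑ i, |inner ℝ (b i : EuclideanSpace ℝ (Fin n ⊕ Fin n)) (x'.z - x.z)| :=
          norm_starProjection_le_sum_abs_inner b _
      _ ≤ ∑ _i : Fin k, δ := Finset.sum_le_sum fun i _ => by
          simpa only [sub_sub_sub_cancel_right] using abs_inner_sub_le_of_gridCell_eq hδ h i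
      _ = k * δ := by simp
  have htri := dist_triangle4 x (W.proj x) (W.proj x') x'
  rw [dist_comm (W.proj x')] at htri
  linarith

lemma measure_inter_gridCell_le {C : ℝ} {E : Set (Heisenberg n)} {μ : Measure (Heisenberg n)}
    (hup : IsUpperRegular k C E μ) {W : HorizontalPlane n k}
    (b : OrthonormalBasis (Fin k) ℝ W.dir) {G : Set (Heisenberg n)} (hGE : G ⊆ E) {δ : ℝ}
    (hδ : 0 < δ) (hGW : ∀ x ∈ G, dist x (W.proj x) ≤ δ) (y : Heisenberg n) (c : Fin k → ℤ) :
    μ (G ∩ {x | gridCell (fun i => (b i : EuclideanSpace ℝ (Fin n ⊕ Fin n))) δ (x.z - y.z) = c}) ≤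
      ENNReal.ofReal (C * ((3 + k) * δ) ^ k) := by
  rcases eq_empty_or_nonempty (G ∩ {x | gridCell
    (fun i => (b i : EuclideanSpace ℝ (Fin n ⊕ Fin n))) δ (x.z - y.z) = c}) with h | ⟨x', hx', hc'⟩
  · rw [h, measure_empty]
    exact zero_le
  · refine (measure_mono ?_).trans (hup x' (hGE hx') _ (by positivity))
    rintro x ⟨hx, hc⟩
    exact dist_lt_of_gridCell_eq b hδ (hGW x hx) (hGW x' hx') (hc'.trans hc.symm)

lemma pos_of_mem_dir (W : HorizontalPlane n k) {u : EuclideanSpace ℝ (Fin n ⊕ Fin n)}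
    (hu : u ∈ W.dir) (hu0 : u ≠ 0) : 0 < k := by
  rw [← W.finrank_dir]
  exact Module.finrank_pos_iff_exists_ne_zero.2 ⟨⟨u, hu⟩, by simpa using hu0⟩

lemma measure_slab_le {C : ℝ} (hC : 0 ≤ C) {E : Set (Heisenberg n)} {μ : Measure (Heisenberg n)}
    (hup : IsUpperRegular k C E μ) {W : HorizontalPlane n k}
    {u : EuclideanSpace ℝ (Fin n ⊕ Fin n)} (hu : u ∈ W.dir) (hu1 : ‖u‖ = 1)
    {G : Set (Heisenberg n)} (hGE : G ⊆ E) {y : Heisenberg n} {r ε : ℝ} (hr : 0 < r)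
    (hε : 0 < ε) (hε1 : ε ≤ 1) (hGr : G ⊆ Metric.ball y r)
    (hGW : ∀ x ∈ G, dist x (W.proj x) ≤ ε * r)
    (hslab : ∀ x ∈ G, |inner ℝ u (x.z - y.z)| ≤ ε * r) :
    μ G ≤ ENNReal.ofReal (slabConst k C * ε * r ^ k) := by
  have hu0 : u ≠ 0 := norm_ne_zero_iff.1 (hu1.trans_ne one_ne_zero)
  obtain ⟨d, rfl⟩ := Nat.exists_eq_add_one.2 (W.pos_of_mem_dir hu hu0)
  obtain ⟨b, hb⟩ := exists_orthonormalBasis_apply_zero_eq W.finrank_dir (u := ⟨u, hu⟩) hu1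
  have hb1 : ∀ i, ‖(b i : EuclideanSpace ℝ (Fin n ⊕ Fin n))‖ = 1 := b.norm_eq_one
  have hεr : 0 < ε * r := by positivity
  set cell : Heisenberg n → Fin (d + 1) → ℤ := fun x =>
    gridCell (fun i => (b i : EuclideanSpace ℝ (Fin n ⊕ Fin n))) (ε * r) (x.z - y.z)
  have hcell : ∀ x ∈ G, cell x ∈ slabCells d ⌈1 / ε⌉ := by
    intro x hx
    have hslab0 : |inner ℝ (b 0 : EuclideanSpace ℝ (Fin n ⊕ Fin n)) (x.z - y.z)| ≤ ε * r := by
      rw [hb]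
      exact hslab x hx
    refine gridCell_mem_slabCells hb1 hεr hslab0 ?_
    calc ‖x.z - y.z‖ ≤ dist y x := norm_z_sub_le_dist y x
      _ ≤ r := (dist_comm y x).trans_le (hGr hx).le
      _ = 1 / ε * (ε * r) := by field_simp
      _ ≤ ⌈1 / ε⌉ * (ε * r) := by gcongr; exact Int.le_ceil _
  have hcover : G ⊆ ⋃ c ∈ slabCells d ⌈1 / ε⌉, G ∩ {x | cell x = c} := fun x hx =>
    mem_iUnion₂.2 ⟨cell x, hcell x hx, hx, rfl⟩
  set B : ℝ := C * ((3 + (d + 1 : ℕ)) * (ε * r)) ^ (d + 1)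
  calc μ G ≤ ∑ c ∈ slabCells d ⌈1 / ε⌉, μ (G ∩ {x | cell x = c}) :=
        (measure_mono hcover).trans (measure_biUnion_finset_le _ _)
    _ ≤ ∑ _c ∈ slabCells d ⌈1 / ε⌉, ENNReal.ofReal B :=
        Finset.sum_le_sum fun c _ => measure_inter_gridCell_le hup b hGE hεr hGW y c
    _ = ENNReal.ofReal ((slabCells d ⌈1 / ε⌉).card * B) := by
        rw [Finset.sum_const, nsmul_eq_mul, ENNReal.ofReal_mul (Nat.cast_nonneg _),
          ENNReal.ofReal_natCast]
    _ ≤ ENNReal.ofReal (3 * (5 / ε) ^ d * B) := by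
        gcongr
        exact card_slabCells_le hε hε1
    _ ≤ ENNReal.ofReal (slabConst (d + 1) C * ε * r ^ (d + 1)) := by
        refine ENNReal.ofReal_le_ofReal ?_
        calc 3 * (5 / ε) ^ d * B =
              3 * 5 ^ d * C * (3 + (d + 1 : ℕ)) ^ (d + 1) * ε * r ^ (d + 1) := by
              simp only [B, mul_pow, div_pow, pow_succ]
              field_simp
          _ ≤ slabConst (d + 1) C * ε * r ^ (d + 1) := by
              rw [slabConst]
              gcongr <;> norm_num

/-- The points of a ball that are at distance less than `δ` from each of two planes. -/
def nearBoth (V W : HorizontalPlane n k) (y : Heisenberg n) (r δ : ℝ) : Set (Heisenberg n) :=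
  {x ∈ Metric.ball y r | Metric.infEDist x V.carrier < ENNReal.ofReal δ ∧
    Metric.infEDist x W.carrier < ENNReal.ofReal δ}

variable {V W : HorizontalPlane n k} {y : Heisenberg n} {r δ : ℝ}

lemma nearBoth_comm : nearBoth V W y r δ = nearBoth W V y r δ := by
  ext x
  simp only [nearBoth, mem_ofPred_eq, and_comm]

lemma dist_proj_le_of_mem_nearBoth {x : Heisenberg n} (hδ : 0 ≤ δ)
    (hx : x ∈ nearBoth V W y r δ) : dist x (V.proj x) ≤ 2 * δ := by
  have h : edist x (V.proj x) ≤ ENNReal.ofReal (2 * δ) :=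
    calc edist x (V.proj x) ≤ 2 * Metric.infEDist x V.carrier := V.edist_proj_le x
      _ ≤ 2 * ENNReal.ofReal δ := by gcongr; exact hx.2.1.le
      _ = ENNReal.ofReal (2 * δ) := by rw [ENNReal.ofReal_mul zero_le_two, ENNReal.ofReal_ofNat]
  rwa [edist_dist, ENNReal.ofReal_le_ofReal_iff (by positivity)] at h

lemma norm_perp_z_sub_le_of_mem_nearBoth {x x' : Heisenberg n} (hδ : 0 ≤ δ)
    (hx : x ∈ nearBoth V W y r δ) (hx' : x' ∈ nearBoth V W y r δ) :
    ‖V.perp (x'.z - x.z)‖ ≤ 4 * δ := by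
  linarith [V.norm_perp_z_sub_le x x', dist_proj_le_of_mem_nearBoth hδ hx,
    dist_proj_le_of_mem_nearBoth hδ hx']

lemma lt_measure_nearBoth {μ : Measure (Heisenberg n)} (hδ : 0 < δ) {q : ℝ} (hq : 0 < q)
    {c : ℝ≥0∞} (hc0 : c ≠ 0) (hc : c ≠ ⊤) (hlow : 4 * c ≤ μ (Metric.ball y r))
    (hV : ∫⁻ x in Metric.ball y r, Metric.infEDist x V.carrier ^ q ∂μ ≤ c * ENNReal.ofReal δ ^ q)
    (hW : ∫⁻ x in Metric.ball y r, Metric.infEDist x W.carrier ^ q ∂μ ≤ c * ENNReal.ofReal δ ^ q) :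
    c < μ (nearBoth V W y r δ) := by
  have far : ∀ U : HorizontalPlane n k,
      ∫⁻ x in Metric.ball y r, Metric.infEDist x U.carrier ^ q ∂μ ≤ c * ENNReal.ofReal δ ^ q →
      μ (Metric.ball y r ∩ {x | ENNReal.ofReal δ ≤ Metric.infEDist x U.carrier}) ≤ c := fun U =>
    measure_inter_le_of_setLIntegral_rpow_le measurable_infEDist hq (by simpa using hδ) (by simp)
  have hcover : Metric.ball y r ⊆ nearBoth V W y r δ ∪
      (Metric.ball y r ∩ {x | ENNReal.ofReal δ ≤ Metric.infEDist x V.carrier}) ∪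
      (Metric.ball y r ∩ {x | ENNReal.ofReal δ ≤ Metric.infEDist x W.carrier}) := by
    intro x hx
    rcases lt_or_ge (Metric.infEDist x V.carrier) (ENNReal.ofReal δ) with hxV | hxV
    · rcases lt_or_ge (Metric.infEDist x W.carrier) (ENNReal.ofReal δ) with hxW | hxW
      · exact .inl (.inl ⟨hx, hxV, hxW⟩)
      · exact .inr ⟨hx, hxW⟩
    · exact .inl (.inr ⟨hx, hxV⟩)
  have hsum : 4 * c ≤ μ (nearBoth V W y r δ) + c + c :=
    calc 4 * c ≤ μ (Metric.ball y r) := hlow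
      _ ≤ _ := (measure_mono hcover).trans (measure_union_le _ _)
      _ ≤ _ := add_le_add ((measure_union_le _ _).trans (add_le_add_right (far V hV) _)) (far W hW)
  by_contra! hcon
  have h3 : 4 * c ≤ 3 * c := hsum.trans ((by gcongr : _ ≤ c + c + c).trans_eq (by ring))
  exact absurd (ENNReal.mul_le_mul_iff_left hc0 hc |>.1 h3) (by norm_num)

/-- The relative width of a slab that cannot contain a quarter of a `k`-regular set in a ball. -/
def slabWidth (k : ℕ) (C : ℝ) : ℝ := (4 * slabConst k C * 2 ^ k * C)⁻¹

lemma slabWidth_pos {C : ℝ} (hC : 1 ≤ C) : 0 < slabWidth k C := by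
  have := one_le_slabConst (k := k) hC
  unfold slabWidth
  positivity

lemma slabWidth_le_one {C : ℝ} (hC : 1 ≤ C) : slabWidth k C ≤ 1 :=
  inv_le_one_of_one_le₀ (one_le_mul_of_one_le_of_one_le (one_le_mul_of_one_le_of_one_le
    (one_le_mul_of_one_le_of_one_le (by norm_num) (one_le_slabConst hC))
    (one_le_pow₀ one_le_two)) hC)

lemma exists_mem_nearBoth_slabWidth_lt_inner {C : ℝ} (hC : 1 ≤ C) {E : Set (Heisenberg n)}
    {μ : Measure (Heisenberg n)} (hup : IsUpperRegular k C E μ) (hE : μ Eᶜ = 0)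
    {u : EuclideanSpace ℝ (Fin n ⊕ Fin n)} (hu : u ∈ W.dir) (hu1 : ‖u‖ = 1) (hr : 0 < r)
    (hδ : 0 ≤ δ) (hδr : δ ≤ slabWidth k C * r)
    (hlow : ENNReal.ofReal ((4 * C)⁻¹ * r ^ k) < μ (nearBoth V W y r δ)) :
    ∃ x ∈ nearBoth V W y r δ, ∃ x' ∈ nearBoth V W y r δ,
      slabWidth k C * (2 * r) < |inner ℝ u (x'.z - x.z)| := by
  have hε := slabWidth_pos (k := k) hC
  rw [← measure_inter_conull' (t := E) (measure_mono_null (fun x hx => hx.2) hE)] at hlow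
  obtain ⟨x, hx, -⟩ := nonempty_of_measure_ne_zero (bot_le.trans_lt hlow).ne'
  refine ⟨x, hx, ?_⟩
  by_contra! hcon
  refine hlow.not_ge ((measure_slab_le (by linarith) hup hu hu1 inter_subset_right (y := x)
    (r := 2 * r) (by positivity) hε (slabWidth_le_one hC) ?_ ?_ fun x' hx' => hcon x' hx'.1).trans
    (ENNReal.ofReal_le_ofReal (le_of_eq ?_)))
  · intro x' hx'
    have := dist_triangle_right x' x y
    rw [Metric.mem_ball]
    linarith [Metric.mem_ball.1 hx.1, Metric.mem_ball.1 hx'.1.1]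
  · intro x' hx'
    have := dist_proj_le_of_mem_nearBoth hδ (nearBoth_comm.subset hx'.1)
    linarith
  · have := one_le_slabConst (k := k) hC
    rw [slabWidth, mul_pow]
    field_simp

lemma norm_perp_le_of_mem_dir {C : ℝ} (hC : 1 ≤ C) {E : Set (Heisenberg n)}
    {μ : Measure (Heisenberg n)} (hup : IsUpperRegular k C E μ) (hE : μ Eᶜ = 0) (hr : 0 < r)
    {l : ℝ} (hl : 0 ≤ l) (hlow : ENNReal.ofReal ((4 * C)⁻¹ * r ^ k) < μ (nearBoth V W y r (l * r)))
    {w : EuclideanSpace ℝ (Fin n ⊕ Fin n)} (hw : w ∈ W.dir) :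
    ‖V.perp w‖ ≤ 4 / slabWidth k C * l * ‖w‖ := by
  set ε := slabWidth k C
  have hε : 0 < ε := slabWidth_pos hC
  have hlr : 0 ≤ l * r := by positivity
  rcases eq_or_ne (V.perp w) 0 with h0 | hne
  · rw [h0, norm_zero]
    positivity
  rcases le_or_gt l ε with hlε | hlε
  · obtain ⟨u, huW, hu1, hu⟩ := exists_unit_mem_norm_mul_abs_inner_le V.dir W.dir hw hne
    obtain ⟨x, hx, x', hx', hlt⟩ := exists_mem_nearBoth_slabWidth_lt_inner hC hup hE huW hu1 hr
      hlr (mul_le_mul_of_nonneg_right hlε hr.le) hlow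
    have hVW : ‖V.perp (x'.z - x.z)‖ + ‖W.perp (x'.z - x.z)‖ ≤ 8 * (l * r) := by
      linarith [norm_perp_z_sub_le_of_mem_nearBoth hlr hx hx',
        norm_perp_z_sub_le_of_mem_nearBoth hlr (nearBoth_comm.subset hx)
          (nearBoth_comm.subset hx')]
    have h : ‖V.perp w‖ * ε * (2 * r) ≤ 4 * l * ‖w‖ * (2 * r) :=
      calc ‖V.perp w‖ * ε * (2 * r) ≤ ‖V.perp w‖ * |inner ℝ u (x'.z - x.z)| := by
            rw [mul_assoc]
            gcongr
        _ ≤ ‖w‖ * (‖V.perp (x'.z - x.z)‖ + ‖W.perp (x'.z - x.z)‖) := hu _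
        _ ≤ ‖w‖ * (8 * (l * r)) := by gcongr
        _ = 4 * l * ‖w‖ * (2 * r) := by ring
    rw [div_mul_eq_mul_div, div_mul_eq_mul_div, le_div_iff₀ hε]
    exact le_of_mul_le_mul_right h (by positivity)
  · refine (V.norm_perp_le w).trans (le_mul_of_one_le_left (norm_nonneg w) ?_)
    rw [div_mul_eq_mul_div, le_div_iff₀ hε]
    linarith

/-- The constant in the comparison of the directions of two planes that approximate a `k`-regular
set in the same ball. -/
def angleConst (k : ℕ) (C : ℝ) : ℝ≥0 := (4 / slabWidth k C * (4 * C)).toNNReal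

lemma norm_perp_le_add {C : ℝ} (hC : 1 ≤ C) {E : Set (Heisenberg n)}
    {μ : Measure (Heisenberg n)} (hup : IsUpperRegular k C E μ) (hE : μ Eᶜ = 0) (hr : 0 < r)
    {l q : ℝ} (hl : 0 < l) (hq : 0 < q)
    (hlow : ENNReal.ofReal (C⁻¹ * r ^ k) ≤ μ (Metric.ball y r))
    (hV : ∫⁻ x in Metric.ball y r, Metric.infEDist x V.carrier ^ q ∂μ ≤
      ENNReal.ofReal ((4 * C)⁻¹ * r ^ k) * ENNReal.ofReal (l * r) ^ q)
    (hW : ∫⁻ x in Metric.ball y r, Metric.infEDist x W.carrier ^ q ∂μ ≤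
      ENNReal.ofReal ((4 * C)⁻¹ * r ^ k) * ENNReal.ofReal (l * r) ^ q)
    (z : EuclideanSpace ℝ (Fin n ⊕ Fin n)) :
    ‖V.perp z‖ ≤ ‖W.perp z‖ + 4 / slabWidth k C * l * ‖z‖ := by
  have hε := slabWidth_pos (k := k) hC
  have hc : 0 < (4 * C)⁻¹ * r ^ k := by positivity
  refine norm_starProjection_orthogonal_le_add V.dir W.dir (by positivity) (fun w hw =>
    norm_perp_le_of_mem_dir (y := y) hC hup hE hr hl.le ?_ hw) z
  refine lt_measure_nearBoth (by positivity) hq (by simpa using hc) (by simp) ?_ hV hW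
  rw [← ENNReal.ofReal_ofNat 4, ← ENNReal.ofReal_mul (by norm_num)]
  convert hlow using 2
  field_simp

lemma mul_rpow_le_inv_mul_mul_rpow {A f r q : ℝ} (hA : 1 ≤ A) (hf : 0 ≤ f) (hr : 0 < r)
    (hq : 1 ≤ q) : f * r ^ (q + k) ≤ A⁻¹ * r ^ k * (A * f ^ (1 / q) * r) ^ q := by
  have hq0 : 0 < q := by linarith
  have hpow : (A * f ^ (1 / q) * r) ^ q = A ^ q * f * r ^ q := by
    rw [Real.mul_rpow (by positivity) hr.le, Real.mul_rpow (by positivity) (by positivity),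
      ← Real.rpow_mul hf, one_div_mul_cancel hq0.ne', Real.rpow_one]
  have hA' : 1 ≤ A⁻¹ * A ^ q := by
    rw [inv_mul_eq_div, one_le_div (by positivity)]
    exact Real.self_le_rpow_of_one_le hA hq
  rw [hpow, Real.rpow_add hr, Real.rpow_natCast]
  calc f * (r ^ q * r ^ k) ≤ A⁻¹ * A ^ q * (f * (r ^ q * r ^ k)) :=
        le_mul_of_one_le_left (by positivity) hA'
    _ = _ := by ring

lemma enorm_perp_le_add {C : ℝ} (hC : 1 ≤ C) {E : Set (Heisenberg n)}
    {μ : Measure (Heisenberg n)} (hup : IsUpperRegular k C E μ) (hE : μ Eᶜ = 0) (hr : 0 < r)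
    {q : ℝ} (hq : 1 ≤ q) {f : ℝ≥0∞} (hf : f ≠ 0)
    (hlow : ENNReal.ofReal (C⁻¹ * r ^ k) ≤ μ (Metric.ball y r))
    (hV : ∫⁻ x in Metric.ball y r, Metric.infEDist x V.carrier ^ q ∂μ ≤
      f * ENNReal.ofReal r ^ (q + k))
    (hW : ∫⁻ x in Metric.ball y r, Metric.infEDist x W.carrier ^ q ∂μ ≤
      f * ENNReal.ofReal r ^ (q + k))
    (z : EuclideanSpace ℝ (Fin n ⊕ Fin n)) :
    ‖V.perp z‖ₑ ≤ ‖W.perp z‖ₑ + angleConst k C * f ^ (1 / q) * ‖z‖ₑ := by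
  have hε := slabWidth_pos (k := k) hC
  have hK : 0 < 4 / slabWidth k C * (4 * C) := by positivity
  have hcoe : (angleConst k C : ℝ≥0∞) = ENNReal.ofReal (4 / slabWidth k C * (4 * C)) := rfl
  rcases eq_or_ne f ⊤ with rfl | hftop
  · rcases eq_or_ne z 0 with rfl | hz
    · simp
    · have htop : angleConst k C * (⊤ : ℝ≥0∞) ^ (1 / q) * ‖z‖ₑ = ⊤ := by
        rw [ENNReal.top_rpow_of_pos (by positivity), hcoe, ENNReal.mul_top (by simpa using hK),
          ENNReal.top_mul (by simpa using hz)]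
      exact le_add_left (le_top.trans_eq htop.symm)
  lift f to ℝ≥0 using hftop
  have hf0 : 0 < (f : ℝ) := NNReal.coe_pos.2 (pos_iff_ne_zero.2 (by simpa using hf))
  have hsmall : (f : ℝ≥0∞) * ENNReal.ofReal r ^ (q + k) ≤
      ENNReal.ofReal ((4 * C)⁻¹ * r ^ k) * ENNReal.ofReal (4 * C * (f : ℝ) ^ (1 / q) * r) ^ q := by
    rw [ENNReal.ofReal_rpow_of_pos hr, ENNReal.ofReal_rpow_of_pos (by positivity),
      ← ENNReal.ofReal_coe_nnreal, ← ENNReal.ofReal_mul f.coe_nonneg,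
        ← ENNReal.ofReal_mul (by positivity)]
    exact ENNReal.ofReal_le_ofReal (mul_rpow_le_inv_mul_mul_rpow (by linarith) f.2 hr hq)
  have h := norm_perp_le_add hC hup hE hr (l := 4 * C * (f : ℝ) ^ (1 / q)) (by positivity)
    (by linarith) hlow (hV.trans hsmall) (hW.trans hsmall) z
  rw [← ofReal_norm, ← ofReal_norm, ← ofReal_norm, hcoe, ← ENNReal.ofReal_coe_nnreal (p := f),
    ENNReal.ofReal_rpow_of_pos hf0, ← ENNReal.ofReal_mul hK.le,
    ← ENNReal.ofReal_mul (by positivity), ← ENNReal.ofReal_add (norm_nonneg _) (by positivity)]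
  exact ENNReal.ofReal_le_ofReal (h.trans_eq (by ring))

end HorizontalPlane

end Heisenberg

/-! ### Systems of approximating planes -/

lemma ennreal_inv_two_pow_mul_two_pow (s : ℕ) : (2⁻¹ : ℝ≥0∞) ^ s * 2 ^ s = 1 := by
  rw [← mul_pow, ENNReal.inv_mul_cancel two_ne_zero ENNReal.ofNat_ne_top, one_pow]

lemma ennreal_inv_two_pow_le_one (s : ℕ) : (2⁻¹ : ℝ≥0∞) ^ s ≤ 1 :=
  pow_le_one₀ zero_le (ENNReal.inv_le_one.2 one_le_two)

lemma tsum_geometric_mul_rpow_ne_top (q : ℝ) :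
    ∑' s : ℕ, (2⁻¹ : ℝ≥0∞) ^ s * ((s : ℝ≥0∞) + 1) ^ q ≠ ⊤ := by
  set m : ℕ := ⌈q⌉₊
  have hsum : Summable fun s : ℕ => 2 * (((s + 1 : ℕ) : ℝ) ^ m * (2⁻¹ : ℝ) ^ (s + 1)) :=
    ((summable_nat_add_iff 1 (f := fun s : ℕ => (s : ℝ) ^ m * (2⁻¹ : ℝ) ^ s)).2
      (summable_pow_mul_geometric_of_norm_lt_one m (by norm_num))).mul_left 2
  refine ne_top_of_le_ne_top hsum.tsum_ofReal_ne_top (ENNReal.tsum_le_tsum fun s => ?_)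
  have hterm : (2 : ℝ) * (((s + 1 : ℕ) : ℝ) ^ m * (2⁻¹ : ℝ) ^ (s + 1)) =
      (2⁻¹ : ℝ) ^ s * ((s + 1 : ℕ) : ℝ) ^ m := by
    rw [pow_succ]
    ring
  rw [hterm, ENNReal.ofReal_mul (by positivity), ENNReal.ofReal_pow (by norm_num),
    ENNReal.ofReal_pow (by positivity), ENNReal.ofReal_inv_of_pos two_pos,
    ENNReal.ofReal_natCast, ENNReal.ofReal_ofNat, ← ENNReal.rpow_natCast _ m, Nat.cast_succ]
  exact mul_le_mul' le_rfl (ENNReal.rpow_le_rpow_of_exponent_le le_add_self (Nat.le_ceil q))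

lemma le_of_mul_le_sq_add_sq {u e X Θ ρ K : ℝ≥0∞} (he : ρ ≤ 2 * e) (he' : e ≤ K * ρ) (hK : 1 ≤ K)
    (he0 : e ≠ 0) (he_top : e ≠ ⊤) (h : u * e ≤ 24 * (X * ρ) ^ 2 + 2 * (Θ * e) ^ 2) :
    u ≤ 48 * K * (X ^ 2 + Θ ^ 2) * ρ := by
  rw [← ENNReal.mul_le_mul_iff_left he0 he_top]
  calc u * e ≤ 24 * (X * ρ) ^ 2 + 2 * (Θ * e) ^ 2 := h
    _ = 24 * X ^ 2 * ρ * (1 * ρ) + 2 * Θ ^ 2 * e * e := by ring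
    _ ≤ 24 * X ^ 2 * ρ * (K * (2 * e)) + 48 * Θ ^ 2 * e * (K * ρ) := by
        gcongr
        norm_num
    _ = 48 * K * (X ^ 2 + Θ ^ 2) * ρ * e := by ring

lemma div_rpow_le_of_le {u d X Θ ρ τ κ A : ℝ≥0∞} {p : ℝ} (hp : 1 ≤ p) (hτ : τ ≤ 1)
    (hu : u ≤ A * (X ^ 2 + Θ ^ 2) * (τ * ρ)) (hd : ρ ≤ κ * d) :
    (u / d) ^ p ≤ (A * κ) ^ p * 2 ^ (p - 1) * (τ * (X ^ (2 * p) + Θ ^ (2 * p))) := by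
  have hp0 : 0 ≤ p := by linarith
  have hdiv : u / d ≤ A * κ * τ * (X ^ 2 + Θ ^ 2) := by
    refine ENNReal.div_le_of_le_mul (hu.trans ?_)
    calc A * (X ^ 2 + Θ ^ 2) * (τ * ρ) ≤ A * (X ^ 2 + Θ ^ 2) * (τ * (κ * d)) := by gcongr
      _ = A * κ * τ * (X ^ 2 + Θ ^ 2) * d := by ring
  have hpow : (X ^ 2 + Θ ^ 2) ^ p ≤ 2 ^ (p - 1) * (X ^ (2 * p) + Θ ^ (2 * p)) := by
    simpa only [ENNReal.rpow_mul, ENNReal.rpow_two] using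
      ENNReal.rpow_add_le_mul_rpow_add_rpow (X ^ 2) (Θ ^ 2) hp
  calc (u / d) ^ p ≤ (A * κ * τ * (X ^ 2 + Θ ^ 2)) ^ p := by gcongr
    _ = (A * κ) ^ p * τ ^ p * (X ^ 2 + Θ ^ 2) ^ p := by
        rw [ENNReal.mul_rpow_of_nonneg _ _ hp0, ENNReal.mul_rpow_of_nonneg _ _ hp0]
    _ ≤ (A * κ) ^ p * τ * (2 ^ (p - 1) * (X ^ (2 * p) + Θ ^ (2 * p))) := by
        gcongr
        simpa only [ENNReal.rpow_one] using ENNReal.rpow_le_rpow_of_exponent_ge hτ hp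
    _ = (A * κ) ^ p * 2 ^ (p - 1) * (τ * (X ^ (2 * p) + Θ ^ (2 * p))) := by ring

/-- The dyadic scale `R / 2 ^ t`. -/
def scale (R : ℝ) (t : ℕ) : ℝ := R / 2 ^ t

lemma scale_pos {R : ℝ} (hR : 0 < R) (t : ℕ) : 0 < scale R t := by
  unfold scale
  positivity

lemma scale_add (R : ℝ) (j s : ℕ) : scale R (j + s) = 2⁻¹ ^ s * scale R j := by
  rw [scale, scale, pow_add, inv_pow]
  field_simp

lemma two_mul_scale_succ (R : ℝ) (t : ℕ) : 2 * scale R (t + 1) = scale R t := by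
  rw [scale_add]
  ring

lemma ofReal_scale_ne_zero {R : ℝ} (hR : 0 < R) (t : ℕ) : ENNReal.ofReal (scale R t) ≠ 0 := by
  simpa using scale_pos hR t

lemma ofReal_scale_add (R : ℝ) (j s : ℕ) :
    ENNReal.ofReal (scale R (j + s)) = 2⁻¹ ^ s * ENNReal.ofReal (scale R j) := by
  rw [scale_add, ENNReal.ofReal_mul (by positivity), ENNReal.ofReal_pow (by norm_num),
    ENNReal.ofReal_inv_of_pos two_pos, ENNReal.ofReal_ofNat]

lemma ofReal_scale_add_pow_le {k : ℕ} (hk : 1 ≤ k) (R : ℝ) (j s : ℕ) :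
    ENNReal.ofReal (scale R (j + s)) ^ k ≤ 2⁻¹ ^ s * ENNReal.ofReal (scale R j) ^ k := by
  rw [ofReal_scale_add, mul_pow]
  exact mul_le_mul' (pow_le_of_le_one zero_le (ennreal_inv_two_pow_le_one s) (by lia)) le_rfl

lemma inv_ofReal_scale_rpow_mul_cancel {R : ℝ} (hR : 0 < R) (t : ℕ) {q : ℝ} :
    (ENNReal.ofReal (scale R t) ^ q)⁻¹ * ENNReal.ofReal (scale R t) ^ q = 1 :=
  ENNReal.inv_mul_cancel (by simp [scale_pos hR t]) (by simp [scale_pos hR t])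

lemma exists_scale_lt_le {R a : ℝ} (hR : 0 < R) {j : ℕ} (ha : 0 < a) (haR : a ≤ scale R j) :
    ∃ s, scale R (j + s + 1) < a ∧ a ≤ scale R (j + s) := by
  have hr := scale_pos hR j
  obtain ⟨s, hlt, hle⟩ := exists_nat_pow_near_of_lt_one (x := a / scale R j) (y := (2⁻¹ : ℝ))
    (by positivity) ((div_le_one hr).2 haR) (by norm_num) (by norm_num)
  refine ⟨s, ?_, ?_⟩
  · rwa [add_assoc, scale_add, ← lt_div_iff₀ hr]
  · rwa [scale_add, ← div_le_iff₀ hr]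

section TailSum

variable {X : Type*} (F : ℕ → X → ℝ≥0∞)

/-- The sum of the error terms `F t x` over all `t ≥ j`, with geometric weights. -/
def tailSum (j : ℕ) (x : X) : ℝ≥0∞ := ∑' l : ℕ, 2⁻¹ ^ l * F (j + l) x

/-- A common bound for the error term at `c` on the scale of index `j` and those at `x` on the
scales of index `j, …, j + s`. -/
def chainError (j s : ℕ) (c x : X) : ℝ≥0∞ := F j c + 2 ^ s * tailSum F j x

lemma aemeasurable_tailSum [MeasurableSpace X] {μ : Measure X} {F : ℕ → X → ℝ≥0∞}
    (hF : ∀ t, AEMeasurable (F t) μ) (j : ℕ) : AEMeasurable (tailSum F j) μ :=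
  AEMeasurable.tsum fun l => (hF (j + l)).const_mul _

lemma le_two_pow_mul_tailSum (j : ℕ) (x : X) {l s : ℕ} (h : l ≤ s) :
    F (j + l) x ≤ 2 ^ s * tailSum F j x :=
  calc F (j + l) x = 2 ^ l * (2⁻¹ ^ l * F (j + l) x) := by
        rw [← mul_assoc, mul_comm (2 ^ l), ennreal_inv_two_pow_mul_two_pow, one_mul]
    _ ≤ 2 ^ s * tailSum F j x := by
        gcongr
        · norm_num
        · exact ENNReal.le_tsum (f := fun l => 2⁻¹ ^ l * F (j + l) x) l

lemma le_chainError (j : ℕ) (c x : X) {l s : ℕ} (h : l ≤ s) :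
    F (j + l) x ≤ chainError F j s c x :=
  (le_two_pow_mul_tailSum F j x h).trans le_add_self

end TailSum

namespace Heisenberg

/-- A choice `U t x` of horizontal planes that approximate `E` in mean near the points `x` of `E` on
the scales `R / 2 ^ t`, with error terms `F t x`. The field `diag` concerns the distances of the
points `x` to their own planes `U t x`, which vary with `x`. -/
structure IsApproxSystem {n : ℕ} (k : ℕ) (q C K₀ K₁ R : ℝ) (L : ℝ≥0∞) (E : Set (Heisenberg n))
    (μ : Measure (Heisenberg n)) (U : ℕ → Heisenberg n → HorizontalPlane n k)
    (F : ℕ → Heisenberg n → ℝ≥0∞) : Prop where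
  R_pos : 0 < R
  upper : IsUpperRegular k C E μ
  null : μ Eᶜ = 0
  lower : ∀ t, ∀ x ∈ E,
    ENNReal.ofReal (C⁻¹ * scale R t ^ k) ≤ μ (Metric.ball x (scale R t))
  pos : ∀ t, ∀ x ∈ E, 0 < F t x
  approx : ∀ t, ∀ x ∈ E, ∫⁻ y in Metric.ball x (K₀ * scale R t),
    Metric.infEDist y (U t x).carrier ^ q ∂μ ≤ F t x * ENNReal.ofReal (scale R t) ^ (q + k)
  diag : ∀ j s : ℕ, ∀ c ∈ E, ∫⁻ x in Metric.ball c (K₀ * scale R j),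
    Metric.infEDist x (U (j + s) x).carrier ^ q ∂μ ≤
      L * ENNReal.ofReal (scale R (j + s)) ^ q *
        ∫⁻ x in Metric.ball c (K₁ * scale R j), F (j + s) x ∂μ
  aemeasurable : ∀ t, AEMeasurable (F t) μ
  aemeasurable_infEDist : ∀ t, AEMeasurable (fun x => Metric.infEDist x (U t x).carrier) μ

/-- The constant in the comparison of the directions of two planes of an approximating system whose
scales differ by a factor of at most `2`. -/
def chainConst (k : ℕ) (q C : ℝ) : ℝ≥0∞ :=
  HorizontalPlane.angleConst k C * (2 ^ (q + k)) ^ (1 / q)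

lemma chainConst_ne_top (k : ℕ) {q : ℝ} (hq : 0 < q) (C : ℝ) : chainConst k q C ≠ ⊤ := by
  unfold chainConst
  finiteness

/-- The constant in the pointwise bound for the projection defect. -/
def defectConst (k : ℕ) (p C K₀ : ℝ) (κ : ℝ≥0∞) : ℝ≥0∞ :=
  (48 * ENNReal.ofReal K₀ * κ) ^ p * 2 ^ (p - 1) *
    (2 ^ (2 * p - 1) + chainConst k (2 * p) C ^ (2 * p))

/-- The constant in the bound for the integral of the projection defect in one variable. -/
def innerConst (k : ℕ) (p C K₀ : ℝ) (κ : ℝ≥0∞) : ℝ≥0∞ :=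
  defectConst k p C K₀ κ * (ENNReal.ofReal (C * K₀ ^ k) + 1)

/-- The constant in the bound for `ι` by the error terms of an approximating system. -/
def iotaConst (k : ℕ) (p C K₀ : ℝ) (L κ : ℝ≥0∞) : ℝ≥0∞ :=
  innerConst k p C K₀ κ * (∑' s : ℕ, 2⁻¹ ^ s * ((s : ℝ≥0∞) + 1) ^ (2 * p)) * (L + 1) *
    (κ * (κ + 1))

lemma iotaConst_ne_top (k : ℕ) {p : ℝ} (hp : 1 ≤ p) (C K₀ : ℝ) {L κ : ℝ≥0∞} (hL : L ≠ ⊤)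
    (hκ : κ ≠ ⊤) : iotaConst k p C K₀ L κ ≠ ⊤ := by
  have hchain := chainConst_ne_top k (q := 2 * p) (by linarith) C
  have hsum := tsum_geometric_mul_rpow_ne_top (2 * p)
  have hp0 : 0 ≤ p := by linarith
  unfold iotaConst innerConst defectConst
  finiteness

namespace IsApproxSystem

variable {n k : ℕ} {p q C K₀ K₁ R : ℝ} {L κ : ℝ≥0∞} {E : Set (Heisenberg n)}
  {μ : Measure (Heisenberg n)} {U : ℕ → Heisenberg n → HorizontalPlane n k}
  {F : ℕ → Heisenberg n → ℝ≥0∞}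

lemma setLIntegral_ball_le (h : IsApproxSystem k q C K₀ K₁ R L E μ U F) (hq : 0 ≤ q)
    {x y : Heisenberg n} {t t' : ℕ} {f : ℝ≥0∞} (hy : y ∈ E)
    (hsub : Metric.ball x (scale R t) ⊆ Metric.ball y (K₀ * scale R t'))
    (ht : scale R t' ≤ 2 * scale R t) (hf : F t' y ≤ f) :
    ∫⁻ z in Metric.ball x (scale R t), Metric.infEDist z (U t' y).carrier ^ q ∂μ ≤
      2 ^ (q + k) * f * ENNReal.ofReal (scale R t) ^ (q + k) :=
  calc ∫⁻ z in Metric.ball x (scale R t), Metric.infEDist z (U t' y).carrier ^ q ∂μ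
      ≤ F t' y * ENNReal.ofReal (scale R t') ^ (q + k) :=
        (lintegral_mono_set hsub).trans (h.approx t' y hy)
    _ ≤ f * (2 * ENNReal.ofReal (scale R t)) ^ (q + k) := by
        gcongr
        rw [← ENNReal.ofReal_ofNat 2, ← ENNReal.ofReal_mul zero_le_two]
        exact ENNReal.ofReal_le_ofReal ht
    _ = 2 ^ (q + k) * f * ENNReal.ofReal (scale R t) ^ (q + k) := by
        rw [ENNReal.mul_rpow_of_nonneg _ _ (by positivity)]
        ring

lemma enorm_perp_le_of_ball_subset (h : IsApproxSystem k q C K₀ K₁ R L E μ U F) (hC : 1 ≤ C)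
    (hq : 1 ≤ q) {x y y' : Heisenberg n} {t i i' : ℕ} {f : ℝ≥0∞} (hx : x ∈ E)
    (hy : y ∈ E) (hy' : y' ∈ E)
    (hsub : Metric.ball x (scale R t) ⊆ Metric.ball y (K₀ * scale R i))
    (hsub' : Metric.ball x (scale R t) ⊆ Metric.ball y' (K₀ * scale R i'))
    (ht : scale R i ≤ 2 * scale R t) (ht' : scale R i' ≤ 2 * scale R t)
    (hf : F i y ≤ f) (hf' : F i' y' ≤ f) (z : EuclideanSpace ℝ (Fin n ⊕ Fin n)) :
    ‖(U i y).perp z‖ₑ ≤ ‖(U i' y').perp z‖ₑ + chainConst k q C * f ^ (1 / q) * ‖z‖ₑ := by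
  have hq0 : 0 ≤ q := by linarith
  have hf0 : f ≠ 0 := ((h.pos i y hy).trans_le hf).ne'
  refine (HorizontalPlane.enorm_perp_le_add hC h.upper h.null (scale_pos h.R_pos t) hq
    (f := 2 ^ (q + k) * f) (by simp [hf0]) (h.lower t x hx)
    (h.setLIntegral_ball_le hq0 hy hsub ht hf)
    (h.setLIntegral_ball_le hq0 hy' hsub' ht' hf') z).trans_eq ?_
  rw [ENNReal.mul_rpow_of_nonneg _ f (by positivity), chainConst]
  ring

lemma enorm_perp_le_same_point (h : IsApproxSystem k q C K₀ K₁ R L E μ U F) (hC : 1 ≤ C)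
    (hq : 1 ≤ q) (hK₀ : 1 ≤ K₀) {x : Heisenberg n} (hx : x ∈ E) {j : ℕ} {f : ℝ≥0∞} {s : ℕ}
    (hf : ∀ l ≤ s, F (j + l) x ≤ f) (z : EuclideanSpace ℝ (Fin n ⊕ Fin n)) :
    ‖(U j x).perp z‖ₑ ≤
      ‖(U (j + s) x).perp z‖ₑ + s * (chainConst k q C * f ^ (1 / q) * ‖z‖ₑ) := by
  induction s with
  | zero => simp
  | succ s ih =>
    have hr := scale_pos h.R_pos (j + (s + 1))
    have hr2 := two_mul_scale_succ R (j + s)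
    have hstep : ‖(U (j + s) x).perp z‖ₑ ≤
        ‖(U (j + (s + 1)) x).perp z‖ₑ + chainConst k q C * f ^ (1 / q) * ‖z‖ₑ := by
      refine h.enorm_perp_le_of_ball_subset hC hq hx hx hx (t := j + (s + 1))
        (Metric.ball_subset_ball ?_) (Metric.ball_subset_ball ?_) hr2.ge (by linarith)
        (hf s s.le_succ) (hf (s + 1) le_rfl) z
      · rw [← hr2, ← add_assoc]
        rw [← add_assoc] at hr
        nlinarith
      · nlinarith
    calc ‖(U j x).perp z‖ₑ
        ≤ ‖(U (j + s) x).perp z‖ₑ + s * (chainConst k q C * f ^ (1 / q) * ‖z‖ₑ) :=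
          ih fun l hl => hf l (hl.trans s.le_succ)
      _ ≤ ‖(U (j + (s + 1)) x).perp z‖ₑ + chainConst k q C * f ^ (1 / q) * ‖z‖ₑ +
            s * (chainConst k q C * f ^ (1 / q) * ‖z‖ₑ) := by gcongr
      _ = _ := by
          push_cast
          ring

lemma enorm_perp_le_chain (h : IsApproxSystem k q C K₀ K₁ R L E μ U F) (hC : 1 ≤ C) (hq : 1 ≤ q)
    (hK₀ : 2 ≤ K₀) {c x : Heisenberg n} (hc : c ∈ E) (hx : x ∈ E) {j : ℕ}
    (hxc : dist x c ≤ K₀ / 2 * scale R j) (s : ℕ) (z : EuclideanSpace ℝ (Fin n ⊕ Fin n)) :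
    ‖(U j c).perp z‖ₑ ≤ ‖(U (j + s) x).perp z‖ₑ +
      (s + 1) * (chainConst k q C * chainError F j s c x ^ (1 / q)) * ‖z‖ₑ := by
  have hr := scale_pos h.R_pos j
  have hFc : F j c ≤ chainError F j s c x := le_self_add
  have hFx : F j x ≤ chainError F j s c x := le_chainError F j c x s.zero_le
  have hbase := h.enorm_perp_le_of_ball_subset hC hq hx hc hx (t := j)
    (Metric.ball_subset_ball' (by nlinarith)) (Metric.ball_subset_ball (by nlinarith))
    (by linarith) (by linarith) hFc hFx z
  have hchain := h.enorm_perp_le_same_point hC hq (by linarith) hx (s := s)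
    (fun l hl => le_chainError F j c x hl) z
  calc ‖(U j c).perp z‖ₑ ≤ _ := hbase
    _ ≤ _ := add_le_add_left hchain _
    _ = _ := by ring

/-- The contribution of the scale of index `j + s` to the projection defect at `x`. -/
def scaleError (q R : ℝ) (U : ℕ → Heisenberg n → HorizontalPlane n k)
    (F : ℕ → Heisenberg n → ℝ≥0∞) (j s : ℕ) (c x : Heisenberg n) : ℝ≥0∞ :=
  (ENNReal.ofReal (scale R (j + s)) ^ q)⁻¹ * Metric.infEDist x (U (j + s) x).carrier ^ q +
    (s + 1) ^ q * chainError F j s c x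

lemma le_scaleError (hq : 0 < q) (j s : ℕ) (c x : Heisenberg n) :
    F (j + s) x ≤ scaleError q R U F j s c x :=
  calc F (j + s) x ≤ 1 * chainError F j s c x := by
        rw [one_mul]
        exact le_chainError F j c x le_rfl
    _ ≤ (s + 1) ^ q * chainError F j s c x := by
        gcongr
        exact ENNReal.one_le_rpow le_add_self hq
    _ ≤ scaleError q R U F j s c x := le_add_self

lemma projDefect_le (h : IsApproxSystem k q C K₀ K₁ R L E μ U F) (hC : 1 ≤ C)
    (hq : 1 ≤ q) (hK₀ : 2 ≤ K₀) {c x y : Heisenberg n} (hc : c ∈ E) (hx : x ∈ E) {j s : ℕ}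
    (hxc : dist x c ≤ K₀ / 2 * scale R j) (hxy : scale R (j + s) ≤ 2 * dist x y)
    (hyx : dist x y ≤ K₀ * scale R (j + s)) :
    (U j c).projDefect x y ≤ 48 * ENNReal.ofReal K₀ *
      (((Metric.infEDist x (U (j + s) x).carrier + Metric.infEDist y (U (j + s) x).carrier) /
          ENNReal.ofReal (scale R (j + s))) ^ 2 +
        ((s + 1) * (chainConst k q C * chainError F j s c x ^ (1 / q))) ^ 2) *
      ENNReal.ofReal (scale R (j + s)) := by
  have hr := scale_pos h.R_pos (j + s)
  have he0 : edist x y ≠ 0 := by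
    rw [edist_dist, ne_eq, ENNReal.ofReal_eq_zero, not_le]
    linarith
  refine le_of_mul_le_sq_add_sq ?_ ?_ (by simpa using by linarith) he0 (edist_ne_top x y) ?_
  · rw [edist_dist, ← ENNReal.ofReal_ofNat 2, ← ENNReal.ofReal_mul zero_le_two]
    exact ENNReal.ofReal_le_ofReal hxy
  · rw [edist_dist, ← ENNReal.ofReal_mul (by linarith)]
    exact ENNReal.ofReal_le_ofReal hyx
  · rw [ENNReal.div_mul_cancel (ofReal_scale_ne_zero h.R_pos _) ENNReal.ofReal_ne_top]
    exact HorizontalPlane.projDefect_mul_edist_le_of_enorm_perp_le _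
      (h.enorm_perp_le_chain hC hq hK₀ hc hx hxc s _)

lemma projDefect_div_rpow_le (h : IsApproxSystem k (2 * p) C K₀ K₁ R L E μ U F) (hC : 1 ≤ C)
    (hp : 1 ≤ p) (hK₀ : 2 ≤ K₀) {c x y : Heisenberg n} (hc : c ∈ E) (hx : x ∈ E) {j s : ℕ}
    (hxc : dist x c ≤ K₀ / 2 * scale R j) {d : ℝ≥0∞} (hd : ENNReal.ofReal (scale R j) ≤ κ * d)
    (hxy : scale R (j + s) ≤ 2 * dist x y) (hyx : dist x y ≤ K₀ * scale R (j + s)) :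
    ((U j c).projDefect x y / d) ^ p ≤ defectConst k p C K₀ κ * 2⁻¹ ^ s *
      (scaleError (2 * p) R U F j s c x + (ENNReal.ofReal (scale R (j + s)) ^ (2 * p))⁻¹ *
          Metric.infEDist y (U (j + s) x).carrier ^ (2 * p)) := by
  have : 0 < p := by linarith
  have hdefect := h.projDefect_le hC (by linarith) hK₀ hc hx hxc hxy hyx
  set ρ := ENNReal.ofReal (scale R (j + s))
  set Dx := Metric.infEDist x (U (j + s) x).carrier
  set Dy := Metric.infEDist y (U (j + s) x).carrier
  set Θ : ℝ≥0∞ := (s + 1) * (chainConst k (2 * p) C * chainError F j s c x ^ (1 / (2 * p)))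
  set B := 2 ^ (2 * p - 1) + chainConst k (2 * p) C ^ (2 * p)
  have hX : ((Dx + Dy) / ρ) ^ (2 * p) ≤ B * ((ρ ^ (2 * p))⁻¹ * (Dx ^ (2 * p) + Dy ^ (2 * p))) := by
    rw [ENNReal.div_rpow_of_nonneg _ _ (by positivity), div_eq_mul_inv, mul_comm, mul_left_comm]
    gcongr
    exact (ENNReal.rpow_add_le_mul_rpow_add_rpow _ _ (by linarith)).trans
      (mul_le_mul_left le_self_add _)
  have hΘ : Θ ^ (2 * p) ≤ B * ((s + 1) ^ (2 * p) * chainError F j s c x) := by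
    rw [ENNReal.mul_rpow_of_nonneg _ _ (by positivity),
      ENNReal.mul_rpow_of_nonneg _ _ (by positivity), ← ENNReal.rpow_mul,
      one_div_mul_cancel (by positivity), ENNReal.rpow_one, mul_left_comm]
    exact mul_le_mul_left le_add_self _
  have hρs : ρ = 2⁻¹ ^ s * ENNReal.ofReal (scale R j) := ofReal_scale_add R j s
  calc ((U j c).projDefect x y / d) ^ p
      ≤ (48 * ENNReal.ofReal K₀ * κ) ^ p * 2 ^ (p - 1) *
          (2⁻¹ ^ s * (((Dx + Dy) / ρ) ^ (2 * p) + Θ ^ (2 * p))) :=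
        div_rpow_le_of_le hp (ennreal_inv_two_pow_le_one s)
          (hdefect.trans_eq (congrArg _ hρs)) hd
    _ ≤ (48 * ENNReal.ofReal K₀ * κ) ^ p * 2 ^ (p - 1) *
          (2⁻¹ ^ s * (B * ((ρ ^ (2 * p))⁻¹ * (Dx ^ (2 * p) + Dy ^ (2 * p))) +
            B * ((s + 1) ^ (2 * p) * chainError F j s c x))) := by gcongr
    _ = _ := by
        rw [defectConst, scaleError]
        ring

lemma setLIntegral_ball_defect_le (h : IsApproxSystem k q C K₀ K₁ R L E μ U F) (hC : 0 ≤ C)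
    (hq : 0 < q) (hK₀ : 0 < K₀) (c : Heisenberg n) {x : Heisenberg n} (hx : x ∈ E) (j s : ℕ) :
    ∫⁻ y in Metric.ball x (K₀ * scale R (j + s)), (scaleError q R U F j s c x +
      (ENNReal.ofReal (scale R (j + s)) ^ q)⁻¹ * Metric.infEDist y (U (j + s) x).carrier ^ q) ∂μ ≤
      (ENNReal.ofReal (C * K₀ ^ k) + 1) * ENNReal.ofReal (scale R (j + s)) ^ k *
        scaleError q R U F j s c x := by
  have hr := scale_pos h.R_pos (j + s)
  set ρ := ENNReal.ofReal (scale R (j + s)) with hρ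
  set B := Metric.ball x (K₀ * scale R (j + s))
  have hB : μ B ≤ ENNReal.ofReal (C * K₀ ^ k) * ρ ^ k := by
    refine (h.upper x hx _ (by positivity)).trans_eq ?_
    rw [hρ, ← ENNReal.ofReal_pow hr.le, ← ENNReal.ofReal_mul (by positivity), mul_pow, mul_assoc]
  calc ∫⁻ y in B, (scaleError q R U F j s c x +
        (ρ ^ q)⁻¹ * Metric.infEDist y (U (j + s) x).carrier ^ q) ∂μ
      = scaleError q R U F j s c x * μ B +
          (ρ ^ q)⁻¹ * ∫⁻ y in B, Metric.infEDist y (U (j + s) x).carrier ^ q ∂μ := by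
        rw [lintegral_add_left measurable_const, setLIntegral_const,
          lintegral_const_mul _ (measurable_infEDist.pow_const _)]
    _ ≤ scaleError q R U F j s c x * (ENNReal.ofReal (C * K₀ ^ k) * ρ ^ k) +
          (ρ ^ q)⁻¹ * (scaleError q R U F j s c x * (ρ ^ q * ρ ^ k)) := by
        gcongr
        refine (h.approx (j + s) x hx).trans ?_
        rw [ENNReal.rpow_add _ _ (ofReal_scale_ne_zero h.R_pos _) ENNReal.ofReal_ne_top,
          ENNReal.rpow_natCast]
        gcongr
        exact le_scaleError hq j s c x
    _ = (ENNReal.ofReal (C * K₀ ^ k) + (ρ ^ q)⁻¹ * ρ ^ q) * ρ ^ k *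
          scaleError q R U F j s c x := by ring
    _ = _ := by rw [inv_ofReal_scale_rpow_mul_cancel h.R_pos]

lemma exists_projDefect_div_rpow_le (h : IsApproxSystem k (2 * p) C K₀ K₁ R L E μ U F)
    (hC : 1 ≤ C) (hp : 1 ≤ p) (hK₀ : 2 ≤ K₀) {c x y : Heisenberg n} (hc : c ∈ E) (hx : x ∈ E)
    {j : ℕ} (hxc : dist x c < K₀ / 4 * scale R j) (hyc : dist y c < K₀ / 4 * scale R j)
    {d : ℝ≥0∞} (hd : ENNReal.ofReal (scale R j) ≤ κ * d) :
    ∃ s, y ∈ Metric.ball x (K₀ * scale R (j + s)) ∧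
      ((U j c).projDefect x y / d) ^ p ≤ defectConst k p C K₀ κ * 2⁻¹ ^ s *
        (scaleError (2 * p) R U F j s c x + (ENNReal.ofReal (scale R (j + s)) ^ (2 * p))⁻¹ *
          Metric.infEDist y (U (j + s) x).carrier ^ (2 * p)) := by
  have hr₀ := scale_pos h.R_pos j
  rcases eq_or_ne x y with rfl | hxy
  · refine ⟨0, Metric.mem_ball_self (by simpa using by nlinarith), ?_⟩
    simp [HorizontalPlane.projDefect, show 0 < p by linarith]
  have hxy0 : 0 < dist x y := dist_pos.2 hxy
  have hxyj : dist x y ≤ K₀ / 2 * scale R j := by linarith [dist_triangle_right x y c]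
  obtain ⟨s, hlt, hle⟩ := exists_scale_lt_le h.R_pos (a := dist x y / (K₀ / 2)) (by positivity)
    ((div_le_iff₀' (by positivity)).2 hxyj)
  rw [lt_div_iff₀' (by positivity)] at hlt
  rw [div_le_iff₀' (by positivity)] at hle
  have hr := scale_pos h.R_pos (j + s)
  have hr2 := two_mul_scale_succ R (j + s)
  refine ⟨s, ?_, h.projDefect_div_rpow_le hC hp hK₀ hc hx (by nlinarith) hd (by nlinarith)
    (by nlinarith)⟩
  rw [Metric.mem_ball, dist_comm]
  nlinarith

lemma lintegral_projDefect_le (h : IsApproxSystem k (2 * p) C K₀ K₁ R L E μ U F) (hC : 1 ≤ C)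
    (hp : 1 ≤ p) (hK₀ : 2 ≤ K₀) {c x : Heisenberg n} (hc : c ∈ E) (hx : x ∈ E) {j : ℕ}
    {S : Set (Heisenberg n)} (hS : MeasurableSet S)
    (hSc : S ⊆ Metric.ball c (K₀ / 4 * scale R j)) (hxS : x ∈ S) {d : ℝ≥0∞}
    (hd : ENNReal.ofReal (scale R j) ≤ κ * d) :
    ∫⁻ y in S, ((U j c).projDefect x y / d) ^ p ∂μ ≤ innerConst k p C K₀ κ *
      ∑' s : ℕ, 2⁻¹ ^ s * ENNReal.ofReal (scale R (j + s)) ^ k *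
        scaleError (2 * p) R U F j s c x := by
  set T : ℕ → Set (Heisenberg n) := fun s => Metric.ball x (K₀ * scale R (j + s))
  set g : ℕ → Heisenberg n → ℝ≥0∞ := fun s y => scaleError (2 * p) R U F j s c x +
    (ENNReal.ofReal (scale R (j + s)) ^ (2 * p))⁻¹ *
      Metric.infEDist y (U (j + s) x).carrier ^ (2 * p)
  have hg : ∀ s, Measurable (g s) := fun s =>
    ((measurable_infEDist.pow_const _).const_mul _).const_add _
  have hpoint : ∀ y ∈ S, ((U j c).projDefect x y / d) ^ p ≤
      ∑' s, (T s).indicator (fun y => defectConst k p C K₀ κ * 2⁻¹ ^ s * g s y) y := by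
    intro y hy
    obtain ⟨s, hyT, hs⟩ := h.exists_projDefect_div_rpow_le hC hp hK₀ hc hx
      (Metric.mem_ball.1 (hSc hxS)) (Metric.mem_ball.1 (hSc hy)) hd
    refine le_trans ?_ (ENNReal.le_tsum s)
    rwa [indicator_of_mem hyT]
  calc ∫⁻ y in S, ((U j c).projDefect x y / d) ^ p ∂μ
      ≤ ∫⁻ y, ∑' s, (T s).indicator (fun y => defectConst k p C K₀ κ * 2⁻¹ ^ s * g s y) y ∂μ :=
        (setLIntegral_mono' hS hpoint).trans (setLIntegral_le_lintegral _ _)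
    _ = ∑' s, defectConst k p C K₀ κ * 2⁻¹ ^ s * ∫⁻ y in T s, g s y ∂μ := by
        rw [lintegral_tsum fun s => (((hg s).const_mul _).indicator
          measurableSet_ball).aemeasurable]
        refine tsum_congr fun s => ?_
        rw [lintegral_indicator measurableSet_ball, lintegral_const_mul _ (hg s)]
    _ ≤ ∑' s, defectConst k p C K₀ κ * 2⁻¹ ^ s * ((ENNReal.ofReal (C * K₀ ^ k) + 1) *
          ENNReal.ofReal (scale R (j + s)) ^ k * scaleError (2 * p) R U F j s c x) := by
        gcongr with s
        exact h.setLIntegral_ball_defect_le (by linarith) (by linarith) (by linarith) c hx j s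
    _ = _ := by
        rw [← ENNReal.tsum_mul_left]
        exact tsum_congr fun s => by rw [innerConst]; ring

lemma aemeasurable_chainError (h : IsApproxSystem k q C K₀ K₁ R L E μ U F) (j s : ℕ)
    (c : Heisenberg n) : AEMeasurable (chainError F j s c) μ :=
  ((aemeasurable_tailSum h.aemeasurable j).const_mul _).const_add _

lemma aemeasurable_scaleError (h : IsApproxSystem k q C K₀ K₁ R L E μ U F) (j s : ℕ)
    (c : Heisenberg n) : AEMeasurable (scaleError q R U F j s c) μ :=
  (((h.aemeasurable_infEDist (j + s)).pow_const _).const_mul _).add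
    ((h.aemeasurable_chainError j s c).const_mul _)

lemma setLIntegral_infEDist_self_le (h : IsApproxSystem k q C K₀ K₁ R L E μ U F)
    {c : Heisenberg n} (hc : c ∈ E) {j : ℕ} {S : Set (Heisenberg n)}
    (hS : S ⊆ Metric.ball c (K₀ * scale R j)) (s : ℕ) :
    (ENNReal.ofReal (scale R (j + s)) ^ q)⁻¹ *
        ∫⁻ x in S, Metric.infEDist x (U (j + s) x).carrier ^ q ∂μ ≤
      L * (2 ^ s * ∫⁻ x in Metric.ball c (K₁ * scale R j), tailSum F j x ∂μ) := by
  set ρ := ENNReal.ofReal (scale R (j + s))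
  set B := Metric.ball c (K₁ * scale R j)
  calc (ρ ^ q)⁻¹ * ∫⁻ x in S, Metric.infEDist x (U (j + s) x).carrier ^ q ∂μ
      ≤ (ρ ^ q)⁻¹ * (L * ρ ^ q * ∫⁻ x in B, F (j + s) x ∂μ) := by
        gcongr
        exact (lintegral_mono_set hS).trans (h.diag j s c hc)
    _ ≤ (ρ ^ q)⁻¹ * (L * ρ ^ q * (2 ^ s * ∫⁻ x in B, tailSum F j x ∂μ)) := by
        gcongr
        rw [← lintegral_const_mul'' _ (aemeasurable_tailSum h.aemeasurable j).restrict]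
        exact lintegral_mono fun x => le_two_pow_mul_tailSum F j x le_rfl
    _ = (ρ ^ q)⁻¹ * ρ ^ q * (L * (2 ^ s * ∫⁻ x in B, tailSum F j x ∂μ)) := by ring
    _ = _ := by rw [inv_ofReal_scale_rpow_mul_cancel h.R_pos, one_mul]

lemma setLIntegral_scaleError_le (h : IsApproxSystem k q C K₀ K₁ R L E μ U F) (hq : 0 < q)
    {c : Heisenberg n} (hc : c ∈ E) {j : ℕ} {S : Set (Heisenberg n)}
    (hS₀ : S ⊆ Metric.ball c (K₀ * scale R j)) (hS₁ : S ⊆ Metric.ball c (K₁ * scale R j)) (s : ℕ) :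
    ∫⁻ x in S, scaleError q R U F j s c x ∂μ ≤ (s + 1) ^ q * 2 ^ s * (L + 1) *
      (F j c * μ S + ∫⁻ x in Metric.ball c (K₁ * scale R j), tailSum F j x ∂μ) := by
  set ρ := ENNReal.ofReal (scale R (j + s))
  set H := ∫⁻ x in Metric.ball c (K₁ * scale R j), tailSum F j x ∂μ
  have hone : (1 : ℝ≥0∞) ≤ (s + 1) ^ q := ENNReal.one_le_rpow le_add_self hq
  have hone' : (1 : ℝ≥0∞) ≤ 2 ^ s := one_le_pow₀ one_le_two
  have hchain : ∫⁻ x in S, chainError F j s c x ∂μ ≤ F j c * μ S + 2 ^ s * H := by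
    simp only [chainError]
    rw [lintegral_add_left measurable_const, setLIntegral_const,
      lintegral_const_mul'' _ (aemeasurable_tailSum h.aemeasurable j).restrict]
    gcongr
    exact lintegral_mono_set hS₁
  calc ∫⁻ x in S, scaleError q R U F j s c x ∂μ
      = (ρ ^ q)⁻¹ * ∫⁻ x in S, Metric.infEDist x (U (j + s) x).carrier ^ q ∂μ +
          (s + 1) ^ q * ∫⁻ x in S, chainError F j s c x ∂μ := by
        have hD := ((h.aemeasurable_infEDist (j + s)).pow_const q).restrict (s := S)
        simp only [scaleError]
        rw [lintegral_add_left' (hD.const_mul _), lintegral_const_mul'' _ hD,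
          lintegral_const_mul'' _ (h.aemeasurable_chainError j s c).restrict]
    _ ≤ 1 * (L * (2 ^ s * H)) + (s + 1) ^ q * (1 * (F j c * μ S) + 2 ^ s * H) := by
        rw [one_mul, one_mul]
        exact add_le_add (h.setLIntegral_infEDist_self_le hc hS₀ s) (mul_le_mul' le_rfl hchain)
    _ ≤ (s + 1) ^ q * (L * (2 ^ s * (F j c * μ S + H))) +
          (s + 1) ^ q * (2 ^ s * (F j c * μ S) + 2 ^ s * H) := by
        gcongr
        exact le_add_self
    _ = _ := by ring

lemma lintegral_lintegral_projDefect_le (h : IsApproxSystem k (2 * p) C K₀ K₁ R L E μ U F)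
    (hk : 1 ≤ k) (hC : 1 ≤ C) (hp : 1 ≤ p) (hK₀ : 2 ≤ K₀) (hK₁ : K₀ ≤ K₁) {c : Heisenberg n}
    (hc : c ∈ E) {j : ℕ} {S : Set (Heisenberg n)} (hS : MeasurableSet S) (hSE : S ⊆ E)
    (hSc : S ⊆ Metric.ball c (K₀ / 4 * scale R j)) {d : ℝ≥0∞}
    (hd : ENNReal.ofReal (scale R j) ≤ κ * d) :
    ∫⁻ x in S, ∫⁻ y in S, ((U j c).projDefect x y / d) ^ p ∂μ ∂μ ≤
      innerConst k p C K₀ κ * (∑' s : ℕ, 2⁻¹ ^ s * ((s : ℝ≥0∞) + 1) ^ (2 * p)) * (L + 1) *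
        ENNReal.ofReal (scale R j) ^ k *
        (F j c * μ S + ∫⁻ x in Metric.ball c (K₁ * scale R j), tailSum F j x ∂μ) := by
  have hr := scale_pos h.R_pos j
  set ρ := fun s => ENNReal.ofReal (scale R (j + s))
  set G := F j c * μ S + ∫⁻ x in Metric.ball c (K₁ * scale R j), tailSum F j x ∂μ
  have hterm : ∀ s, 2⁻¹ ^ s * ρ s ^ k * ∫⁻ x in S, scaleError (2 * p) R U F j s c x ∂μ ≤
      2⁻¹ ^ s * (s + 1) ^ (2 * p) * ((L + 1) * ENNReal.ofReal (scale R j) ^ k * G) := fun s =>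
    calc 2⁻¹ ^ s * ρ s ^ k * ∫⁻ x in S, scaleError (2 * p) R U F j s c x ∂μ
        ≤ 2⁻¹ ^ s * (2⁻¹ ^ s * ENNReal.ofReal (scale R j) ^ k) *
            ((s + 1) ^ (2 * p) * 2 ^ s * (L + 1) * G) := by
          gcongr
          · exact ofReal_scale_add_pow_le hk R j s
          · exact h.setLIntegral_scaleError_le (by linarith) hc
              (hSc.trans (Metric.ball_subset_ball (by nlinarith)))
              (hSc.trans (Metric.ball_subset_ball (by nlinarith))) s
      _ = 2⁻¹ ^ s * 2 ^ s *
            (2⁻¹ ^ s * (s + 1) ^ (2 * p) * ((L + 1) * ENNReal.ofReal (scale R j) ^ k * G)) := by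
          ring
      _ = _ := by rw [ennreal_inv_two_pow_mul_two_pow, one_mul]
  have hmeas : ∀ s, AEMeasurable (scaleError (2 * p) R U F j s c) (μ.restrict S) := fun s =>
    (h.aemeasurable_scaleError j s c).restrict
  calc ∫⁻ x in S, ∫⁻ y in S, ((U j c).projDefect x y / d) ^ p ∂μ ∂μ
      ≤ ∫⁻ x in S, innerConst k p C K₀ κ *
          ∑' s : ℕ, 2⁻¹ ^ s * ρ s ^ k * scaleError (2 * p) R U F j s c x ∂μ :=
        setLIntegral_mono' hS fun x hx =>
          h.lintegral_projDefect_le hC hp hK₀ hc (hSE hx) hS hSc hx hd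
    _ = innerConst k p C K₀ κ *
          ∑' s : ℕ, 2⁻¹ ^ s * ρ s ^ k * ∫⁻ x in S, scaleError (2 * p) R U F j s c x ∂μ := by
        rw [lintegral_const_mul'' _ (AEMeasurable.tsum fun s => (hmeas s).const_mul _),
          lintegral_tsum fun s => (hmeas s).const_mul _]
        simp only [lintegral_const_mul'' _ (hmeas _)]
    _ ≤ innerConst k p C K₀ κ * ∑' s : ℕ,
          2⁻¹ ^ s * (s + 1) ^ (2 * p) * ((L + 1) * ENNReal.ofReal (scale R j) ^ k * G) := by
        exact mul_le_mul' le_rfl (ENNReal.tsum_le_tsum hterm)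
    _ = _ := by
        rw [ENNReal.tsum_mul_right]
        ring

lemma iotaOne_rpow_le (h : IsApproxSystem k (2 * p) C K₀ K₁ R L E μ U F) (hk : 1 ≤ k)
    (hC : 1 ≤ C) (hp : 1 ≤ p) (hK₀ : 2 ≤ K₀) (hK₁ : K₀ ≤ K₁) {c : Heisenberg n} (hc : c ∈ E)
    {j : ℕ} {S : Set (Heisenberg n)} (hS : MeasurableSet S) (hSE : S ⊆ E)
    (hSc : S ⊆ Metric.ball c (K₀ / 4 * scale R j))
    (hdiam : ENNReal.ofReal (scale R j) ≤ κ * Metric.ediam S)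
    (hμS : ENNReal.ofReal (scale R j) ^ k ≤ κ * μ S) :
    iotaOne μ p (U j c).proj S ^ p ≤ iotaConst k p C K₀ L κ *
      (F j c + (ENNReal.ofReal (scale R j) ^ k)⁻¹ *
        ∫⁻ x in Metric.ball c (K₁ * scale R j), tailSum F j x ∂μ) := by
  have hr := scale_pos h.R_pos j
  set ρk := ENNReal.ofReal (scale R j) ^ k
  set H := ∫⁻ x in Metric.ball c (K₁ * scale R j), tailSum F j x ∂μ
  set A := innerConst k p C K₀ κ * (∑' s : ℕ, 2⁻¹ ^ s * ((s : ℝ≥0∞) + 1) ^ (2 * p)) * (L + 1)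
  have hρ0 : ρk ≠ 0 := pow_ne_zero k (ofReal_scale_ne_zero h.R_pos j)
  have hμ0 : μ S ≠ 0 := by
    intro h0
    rw [h0, mul_zero, nonpos_iff_eq_zero] at hμS
    exact hρ0 hμS
  have hμtop : μ S ≠ ⊤ := ne_top_of_le_ne_top ENNReal.ofReal_ne_top
    ((measure_mono hSc).trans (h.upper c hc _ (by positivity)))
  have hratio : (μ S)⁻¹ * ρk ≤ κ := by
    rw [mul_comm, ← div_eq_mul_inv]
    exact ENNReal.div_le_of_le_mul hμS
  have hinv : (μ S)⁻¹ ≤ κ * ρk⁻¹ := by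
    rw [← div_eq_mul_inv, ENNReal.le_div_iff_mul_le (.inl hρ0) (.inl (by finiteness))]
    exact hratio
  have hiota : iotaOne μ p (U j c).proj S ^ p = (μ S)⁻¹ * (μ S)⁻¹ *
      ∫⁻ x in S, ∫⁻ y in S, ((U j c).projDefect x y / Metric.ediam S) ^ p ∂μ ∂μ := by
    rw [iotaOne, ← ENNReal.rpow_mul, one_div_mul_cancel (by positivity), ENNReal.rpow_one,
      ENNReal.inv_pow, sq]
    simp only [HorizontalPlane.projDefect, dist_comm]
  calc iotaOne μ p (U j c).proj S ^ p ≤ (μ S)⁻¹ * (μ S)⁻¹ * (A * ρk * (F j c * μ S + H)) := by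
        rw [hiota]
        gcongr
        exact h.lintegral_lintegral_projDefect_le hk hC hp hK₀ hK₁ hc hS hSE hSc hdiam
    _ = A * ((μ S)⁻¹ * ρk) * ((μ S)⁻¹ * μ S * F j c + (μ S)⁻¹ * H) := by ring
    _ ≤ A * κ * (F j c + κ * ρk⁻¹ * H) := by
        rw [ENNReal.inv_mul_cancel hμ0 hμtop, one_mul]
        gcongr
    _ ≤ A * κ * ((κ + 1) * F j c + (κ + 1) * ρk⁻¹ * H) := by
        gcongr
        · exact le_mul_of_one_le_left zero_le le_add_self
        · exact le_self_add
    _ = _ := by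
        rw [iotaConst]
        ring

end IsApproxSystem

end Heisenberg

/-! ### Regular sets and dyadic cubes -/

section RegularSets

variable {X : Type*} [MetricSpace X] [MeasurableSpace X] [BorelSpace X] {k : ℕ} {C : ℝ} {E : Set X}

namespace IsRegularSet

lemma nonempty {s : ℝ} (h : IsRegularSet s C E) : E.Nonempty := by
  rw [nonempty_iff_ne_empty]
  rintro rfl
  simpa using h.ediam_pos

lemma restrict_compl_eq_zero {s : ℝ} (h : IsRegularSet s C E) :
    (μH[s] : Measure X).restrict E Eᶜ = 0 := by
  rw [Measure.restrict_apply h.isClosed.measurableSet.compl, compl_inter_self, measure_empty]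

lemma ae_mem {s : ℝ} (h : IsRegularSet s C E) : ∀ᵐ x ∂(μH[s] : Measure X).restrict E, x ∈ E :=
  h.restrict_compl_eq_zero

lemma isUpperRegular (h : IsRegularSet (k : ℝ) C E) :
    IsUpperRegular k C E ((μH[(k : ℝ)] : Measure X).restrict E) := by
  intro x hx r hr
  rw [Measure.restrict_apply measurableSet_ball]
  have hC := h.one_le
  rcases lt_or_ge (ENNReal.ofReal r) (2 * Metric.ediam E) with hsmall | hlarge
  · simpa using h.upper x hx r hr hsmall
  -- a large ball contains no more of `E` than the ball of radius `3 / 2 * diam E`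
  have hfin : Metric.ediam E ≠ ⊤ := by
    intro ht
    rw [ht, ENNReal.mul_top (by simp), top_le_iff] at hlarge
    exact ENNReal.ofReal_ne_top hlarge
  set D := (Metric.ediam E).toReal
  have hD : 0 < D := ENNReal.toReal_pos h.ediam_pos.ne' hfin
  have hDE : 2 * Metric.ediam E = ENNReal.ofReal (2 * D) := by
    rw [ENNReal.ofReal_mul zero_le_two, ENNReal.ofReal_toReal hfin, ENNReal.ofReal_ofNat]
  rw [hDE, ENNReal.ofReal_le_ofReal_iff hr.le] at hlarge
  have hupper := h.upper x hx (3 / 2 * D) (by positivity) (by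
    rw [hDE, ENNReal.ofReal_lt_ofReal_iff (by positivity)]
    linarith)
  rw [Real.rpow_natCast] at hupper
  refine (measure_mono ?_).trans (hupper.trans (ENNReal.ofReal_le_ofReal ?_))
  · rintro y ⟨-, hy⟩
    refine ⟨?_, hy⟩
    have hyx : dist y x ≤ D := by
      rw [dist_edist]
      exact ENNReal.toReal_mono hfin (Metric.edist_le_ediam_of_mem hy hx)
    rw [Metric.mem_ball]
    linarith
  · gcongr
    linarith

lemma le_measure_ball (h : IsRegularSet (k : ℝ) C E) {x : X} (hx : x ∈ E) {r : ℝ} (hr : 0 < r)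
    (hrE : ENNReal.ofReal r ≤ Metric.ediam E) :
    ENNReal.ofReal (C⁻¹ * r ^ k) ≤ (μH[(k : ℝ)] : Measure X).restrict E (Metric.ball x r) := by
  have hr2 : ENNReal.ofReal r < 2 * Metric.ediam E := by
    rcases eq_or_ne (Metric.ediam E) ⊤ with htop | hfin
    · rw [htop, ENNReal.mul_top two_ne_zero]
      exact ENNReal.ofReal_lt_top
    · rw [two_mul]
      exact hrE.trans_lt (ENNReal.lt_add_right hfin h.ediam_pos.ne')
  rw [Measure.restrict_apply measurableSet_ball]
  simpa using h.lower x hx r hr hr2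

lemma sigmaFinite (h : IsRegularSet (k : ℝ) C E) :
    SigmaFinite ((μH[(k : ℝ)] : Measure X).restrict E) := by
  obtain ⟨x, hx⟩ := h.nonempty
  refine ⟨⟨⟨fun i => Metric.ball x (i + 1), fun _ => trivial, fun i => ?_, ?_⟩⟩⟩
  · exact (h.isUpperRegular x hx _ (by positivity)).trans_lt ENNReal.ofReal_lt_top
  · refine eq_univ_of_forall fun y => ?_
    obtain ⟨i, hi⟩ := exists_nat_gt (dist y x)
    exact mem_iUnion.2 ⟨i, by rw [Metric.mem_ball]; linarith⟩

end IsRegularSet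

end RegularSets

section DyadicIndex

variable {X : Type*} [MetricSpace X] {E : Set X}

lemma mem_dyadicIndex_of_le {i j : ℤ} (hi : i ∈ dyadicIndex E) (hij : i ≤ j) :
    j ∈ dyadicIndex E :=
  (ENNReal.ofReal_le_ofReal (zpow_le_zpow_right₀ one_le_two (neg_le_neg hij))).trans hi

lemma add_natCast_mem_dyadicIndex {J : ℤ} (hJ : J ∈ dyadicIndex E) (t : ℕ) :
    J + t ∈ dyadicIndex E :=
  mem_dyadicIndex_of_le hJ (by omega)

lemma exists_isLeast_dyadicIndex (hpos : 0 < Metric.ediam E) (hfin : Metric.ediam E ≠ ⊤) :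
    ∃ a : ℤ, IsLeast (dyadicIndex E) a ∧ Metric.ediam E ≤ ENNReal.ofReal (2 * (2 : ℝ) ^ (-a)) := by
  have hD : 0 < (Metric.ediam E).toReal := ENNReal.toReal_pos hpos.ne' hfin
  obtain ⟨b, hb, hb'⟩ := exists_mem_Ico_zpow hD one_lt_two
  have hmem : ∀ j : ℤ, j ∈ dyadicIndex E ↔ (2 : ℝ) ^ (-j) ≤ (Metric.ediam E).toReal := fun j =>
    ENNReal.ofReal_le_iff_le_toReal hfin
  refine ⟨-b, ⟨(hmem _).2 (by rwa [neg_neg]), fun j hj => ?_⟩, ?_⟩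
  · have := (zpow_lt_zpow_iff_right₀ one_lt_two).1 (((hmem j).1 hj).trans_lt hb')
    omega
  · rw [neg_neg, mul_comm, ← zpow_add_one₀ two_ne_zero]
    exact (ENNReal.le_ofReal_iff_toReal_le hfin (by positivity)).2 hb'.le

end DyadicIndex

/-- The cube of generation `j` of the system `Δ` containing the point `x`; it is written as a union
so that it makes sense for an arbitrary family. -/
def cubeAt {X : Type*} (Δ : ℤ → Set (Set X)) (j : ℤ) (x : X) : Set X := ⋃₀ {Q ∈ Δ j | x ∈ Q}

namespace IsDyadicSystem

variable {X : Type*} [MetricSpace X] [MeasurableSpace X] {c₀ : ℝ} {E : Set X}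
  {Δ : ℤ → Set (Set X)}

lemma cubeAt_eq (h : IsDyadicSystem E c₀ Δ) {j : ℤ} (hj : j ∈ dyadicIndex E) {Q : Set X}
    (hQ : Q ∈ Δ j) {x : X} (hx : x ∈ Q) : cubeAt Δ j x = Q := by
  have hsingle : {Q ∈ Δ j | x ∈ Q} = {Q} := by
    ext Q'
    constructor
    · rintro ⟨hQ', hx'⟩
      exact (h.pairwiseDisjoint j hj).elim hQ' hQ (not_disjoint_iff.2 ⟨x, hx', hx⟩)
    · rintro rfl
      exact ⟨hQ, hx⟩
  rw [cubeAt, hsingle, sUnion_singleton]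

lemma exists_mem (h : IsDyadicSystem E c₀ Δ) {j : ℤ} (hj : j ∈ dyadicIndex E) {x : X}
    (hx : x ∈ E) : ∃ Q ∈ Δ j, x ∈ Q := by
  rwa [h.cover j hj] at hx

lemma cubeAt_mem (h : IsDyadicSystem E c₀ Δ) {j : ℤ} (hj : j ∈ dyadicIndex E) {x : X}
    (hx : x ∈ E) : cubeAt Δ j x ∈ Δ j := by
  obtain ⟨Q, hQ, hxQ⟩ := h.exists_mem hj hx
  rwa [h.cubeAt_eq hj hQ hxQ]

lemma mem_cubeAt (h : IsDyadicSystem E c₀ Δ) {j : ℤ} (hj : j ∈ dyadicIndex E) {x : X}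
    (hx : x ∈ E) : x ∈ cubeAt Δ j x := by
  obtain ⟨Q, hQ, hxQ⟩ := h.exists_mem hj hx
  rwa [h.cubeAt_eq hj hQ hxQ]

lemma subset_of_le (h : IsDyadicSystem E c₀ Δ) {i j : ℤ} (hi : i ∈ dyadicIndex E)
    (hij : i ≤ j) {Q Q' : Set X} (hQ : Q ∈ Δ i) (hQ' : Q' ∈ Δ j) {x : X} (hx : x ∈ Q)
    (hx' : x ∈ Q') : Q' ⊆ Q :=
  (h.nested i hi j (mem_dyadicIndex_of_le hi hij) hij Q hQ Q' hQ').resolve_right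
    (Set.nonempty_iff_ne_empty.1 ⟨x, hx, hx'⟩)

lemma sUnion_subcubes_eq (h : IsDyadicSystem E c₀ Δ) {i j : ℤ} (hi : i ∈ dyadicIndex E)
    (hij : i ≤ j) {A : Set X} (hA : A ∈ Δ i) : ⋃₀ {Q ∈ Δ j | Q ⊆ A} = A := by
  refine (sUnion_subset fun Q hQ => hQ.2).antisymm fun x hx => ?_
  obtain ⟨Q, hQ, hxQ⟩ := h.exists_mem (mem_dyadicIndex_of_le hi hij) (h.subset i hi A hA hx)
  exact ⟨Q, ⟨hQ, h.subset_of_le hi hij hA hQ hx hxQ⟩, hxQ⟩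

lemma dist_le (h : IsDyadicSystem E c₀ Δ) (hc₀ : 0 < c₀) {j : ℤ} (hj : j ∈ dyadicIndex E)
    {Q : Set X} (hQ : Q ∈ Δ j) {x y : X} (hx : x ∈ Q) (hy : y ∈ Q) :
    dist x y ≤ c₀⁻¹ * (2 : ℝ) ^ (-j) := by
  have hxy := (Metric.edist_le_ediam_of_mem hx hy).trans (h.ediam_le j hj Q hQ)
  rwa [edist_dist, ENNReal.ofReal_le_ofReal_iff (by positivity)] at hxy

lemma update_singleton_self (h : IsDyadicSystem E c₀ Δ) (hE : MeasurableSet E)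
    (hne : E.Nonempty) {a : ℤ} (ha : IsLeast (dyadicIndex E) a)
    (hdiam : Metric.ediam E ≤ ENNReal.ofReal (c₀⁻¹ * (2 : ℝ) ^ (-a))) :
    IsDyadicSystem E c₀ (Function.update Δ a {E}) := by
  have hself : Function.update Δ a {E} a = {E} := Function.update_self ..
  have hother : ∀ {j : ℤ}, j ≠ a → Function.update Δ a {E} j = Δ j := fun hj =>
    Function.update_of_ne hj ..
  have hcases : ∀ {j : ℤ} {Q : Set X}, Q ∈ Function.update Δ a {E} j →
      (j = a ∧ Q = E) ∨ Q ∈ Δ j := by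
    intro j Q hQ
    rcases eq_or_ne j a with rfl | hja
    · exact Or.inl ⟨rfl, by rwa [hself] at hQ⟩
    · exact Or.inr (by rwa [hother hja] at hQ)
  have hsub : ∀ j ∈ dyadicIndex E, ∀ Q ∈ Function.update Δ a {E} j, Q ⊆ E := by
    intro j hj Q hQ
    rcases hcases hQ with ⟨-, rfl⟩ | hQ
    exacts [subset_rfl, h.subset j hj Q hQ]
  have hlater : ∀ {i j : ℤ}, i ∈ dyadicIndex E → i ≠ a → i ≤ j → j ≠ a := fun hi hia hij =>
    (((ha.2 hi).lt_of_ne' hia).trans_le hij).ne'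
  refine ⟨hsub, fun j hj Q hQ => ?_, fun j hj => ?_, fun j hj => ?_, fun i hi j hj hij Q hQ Q' hQ'
    => ?_, fun i hi j hj hij Q' hQ' => ?_, fun j hj Q hQ => ?_, fun j hj Q hQ => ?_⟩
  · rcases hcases hQ with ⟨-, rfl⟩ | hQ
    exacts [hE, h.measurableSet j hj Q hQ]
  · rcases eq_or_ne j a with rfl | hja
    · rw [hself]; exact pairwiseDisjoint_singleton _ _
    · rw [hother hja]; exact h.pairwiseDisjoint j hj
  · rcases eq_or_ne j a with rfl | hja
    · rw [hself, sUnion_singleton]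
    · rw [hother hja]; exact h.cover j hj
  · rcases eq_or_ne i a with rfl | hia
    · rw [hself, mem_singleton_iff] at hQ
      exact Or.inl (hQ ▸ hsub j hj Q' hQ')
    · rw [hother hia] at hQ
      rw [hother (hlater hi hia hij)] at hQ'
      exact h.nested i hi j hj hij Q hQ Q' hQ'
  · rcases eq_or_ne i a with rfl | hia
    · exact ⟨E, ⟨by rw [hself]; rfl, hsub j hj Q' hQ'⟩, fun Q hQ => by simpa [hself] using hQ.1⟩
    · rw [hother (hlater hi hia hij.le)] at hQ'
      rw [hother hia]
      exact h.ancestor i hi j hj hij Q' hQ'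
  · rcases hcases hQ with ⟨rfl, rfl⟩ | hQ
    exacts [hdiam, h.ediam_le j hj Q hQ]
  · rcases hcases hQ with ⟨-, rfl⟩ | hQ
    exacts [hne.imp fun x hx => ⟨hx, inter_subset_right⟩, h.center j hj Q hQ]

end IsDyadicSystem

section RegularDyadic

variable {X : Type*} [MetricSpace X] [MeasurableSpace X] [BorelSpace X] {k : ℕ} {C c₀ : ℝ}
  {E : Set X} {Δ : ℤ → Set (Set X)}

namespace IsDyadicSystem

lemma le_measure (h : IsDyadicSystem E c₀ Δ) (hE : IsRegularSet (k : ℝ) C E) (hc₀ : 0 < c₀)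
    (hc₀' : c₀ ≤ 1 / 2) {j : ℤ} (hj : j ∈ dyadicIndex E) {Q : Set X} (hQ : Q ∈ Δ j) :
    ENNReal.ofReal (C⁻¹ * (c₀ * (2 : ℝ) ^ (-j)) ^ k) ≤
      (μH[(k : ℝ)] : Measure X).restrict E Q := by
  obtain ⟨x, hx, hxQ⟩ := h.center j hj Q hQ
  have hle : c₀ * (2 : ℝ) ^ (-j) ≤ 2 ^ (-j) := mul_le_of_le_one_left (by positivity) (by linarith)
  refine (hE.le_measure_ball hx (by positivity)
    ((ENNReal.ofReal_le_ofReal hle).trans hj)).trans ?_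
  rw [Measure.restrict_apply measurableSet_ball,
    Measure.restrict_apply (h.measurableSet j hj Q hQ)]
  exact measure_mono fun y hy => ⟨hxQ hy, hy.2⟩

lemma measure_pos (h : IsDyadicSystem E c₀ Δ) (hE : IsRegularSet (k : ℝ) C E) (hc₀ : 0 < c₀)
    (hc₀' : c₀ ≤ 1 / 2) {j : ℤ} (hj : j ∈ dyadicIndex E) {Q : Set X} (hQ : Q ∈ Δ j) :
    0 < (μH[(k : ℝ)] : Measure X).restrict E Q := by
  have hC := hE.one_le
  exact (ENNReal.ofReal_pos.2 (by positivity)).trans_le (h.le_measure hE hc₀ hc₀' hj hQ)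

lemma nonempty (h : IsDyadicSystem E c₀ Δ) (hE : IsRegularSet (k : ℝ) C E) (hc₀ : 0 < c₀)
    (hc₀' : c₀ ≤ 1 / 2) {j : ℤ} (hj : j ∈ dyadicIndex E) {Q : Set X} (hQ : Q ∈ Δ j) :
    Q.Nonempty :=
  nonempty_of_measure_ne_zero (h.measure_pos hE hc₀ hc₀' hj hQ).ne'

lemma measure_ne_top (h : IsDyadicSystem E c₀ Δ) (hE : IsRegularSet (k : ℝ) C E) (hc₀ : 0 < c₀)
    {j : ℤ} (hj : j ∈ dyadicIndex E) {Q : Set X} (hQ : Q ∈ Δ j) :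
    (μH[(k : ℝ)] : Measure X).restrict E Q ≠ ⊤ := by
  rcases Q.eq_empty_or_nonempty with rfl | ⟨x, hx⟩
  · simp
  have hball : Q ⊆ Metric.ball x (c₀⁻¹ * (2 : ℝ) ^ (-j) + 1) := fun y hy =>
    Metric.mem_ball.2 ((h.dist_le hc₀ hj hQ hy hx).trans_lt (lt_add_one _))
  exact ne_top_of_le_ne_top ENNReal.ofReal_ne_top
    ((measure_mono hball).trans (hE.isUpperRegular x (h.subset j hj Q hQ hx) _ (by positivity)))

lemma le_ediam (h : IsDyadicSystem E c₀ Δ) (hk : 1 ≤ k) (hE : IsRegularSet (k : ℝ) C E)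
    (hc₀ : 0 < c₀) (hc₀' : c₀ ≤ 1 / 2) {j : ℤ} (hj : j ∈ dyadicIndex E) {Q : Set X}
    (hQ : Q ∈ Δ j) : ENNReal.ofReal (c₀ / (2 * C ^ 2) * (2 : ℝ) ^ (-j)) ≤ Metric.ediam Q := by
  by_contra! hsmall
  have hC := hE.one_le
  obtain ⟨x, hx⟩ := h.nonempty hE hc₀ hc₀' hj hQ
  set a := c₀ * (2 : ℝ) ^ (-j) with ha
  have ha0 : 0 < a := by positivity
  have hr : c₀ / (2 * C ^ 2) * (2 : ℝ) ^ (-j) = (2 * C ^ 2)⁻¹ * a := by rw [ha]; ring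
  rw [hr] at hsmall
  have hQr : Q ⊆ Metric.ball x ((2 * C ^ 2)⁻¹ * a) := by
    intro y hy
    have hyx := (Metric.edist_le_ediam_of_mem hy hx).trans_lt hsmall
    rwa [edist_dist, ENNReal.ofReal_lt_ofReal_iff (by positivity)] at hyx
  have hmeas := (h.le_measure hE hc₀ hc₀' hj hQ).trans ((measure_mono hQr).trans
    (hE.isUpperRegular x (h.subset j hj Q hQ hx) _ (by positivity)))
  rw [ENNReal.ofReal_le_ofReal_iff (by positivity)] at hmeas
  have hpow : ((2 * C ^ 2)⁻¹ : ℝ) ^ k ≤ (2 * C ^ 2)⁻¹ :=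
    pow_le_of_le_one (by positivity) (inv_le_one_of_one_le₀ (by nlinarith)) (by omega)
  have hcontra : C⁻¹ * a ^ k ≤ C⁻¹ * a ^ k / 2 :=
    calc C⁻¹ * a ^ k ≤ C * ((2 * C ^ 2)⁻¹ ^ k * a ^ k) := by rwa [← mul_pow]
      _ ≤ C * ((2 * C ^ 2)⁻¹ * a ^ k) := by gcongr
      _ = C⁻¹ * a ^ k / 2 := by field_simp
  have : 0 < C⁻¹ * a ^ k := by positivity
  linarith

lemma countable (h : IsDyadicSystem E c₀ Δ) (hE : IsRegularSet (k : ℝ) C E) (hc₀ : 0 < c₀)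
    (hc₀' : c₀ ≤ 1 / 2) {j : ℤ} (hj : j ∈ dyadicIndex E) : (Δ j).Countable := by
  have := hE.sigmaFinite
  have hcount := Measure.countable_meas_pos_of_disjoint_iUnion
    (μ := (μH[(k : ℝ)] : Measure X).restrict E) (As := fun Q : Δ j => (Q : Set X))
    (fun Q => h.measurableSet j hj Q Q.2)
    (fun Q Q' hne => h.pairwiseDisjoint j hj Q.2 Q'.2 (fun he => hne (Subtype.ext he)))
  have huniv : {Q : Δ j | 0 < (μH[(k : ℝ)] : Measure X).restrict E Q} = univ :=
    eq_univ_of_forall fun Q => h.measure_pos hE hc₀ hc₀' hj Q.2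
  rw [huniv] at hcount
  exact countable_coe_iff.1 (countable_univ_iff.1 hcount)

lemma lintegral_sUnion (h : IsDyadicSystem E c₀ Δ) (hE : IsRegularSet (k : ℝ) C E)
    (hc₀ : 0 < c₀) (hc₀' : c₀ ≤ 1 / 2) {j : ℤ} (hj : j ∈ dyadicIndex E) {T : Set (Set X)}
    (hT : T ⊆ Δ j) (μ : Measure X) (f : X → ℝ≥0∞) :
    ∫⁻ x in ⋃₀ T, f x ∂μ = ∑' Q : T, ∫⁻ x in Q.1, f x ∂μ := by
  rw [sUnion_eq_biUnion]
  exact lintegral_biUnion ((h.countable hE hc₀ hc₀' hj).mono hT)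
    (fun Q hQ => h.measurableSet j hj Q (hT hQ)) ((h.pairwiseDisjoint j hj).subset hT) f

lemma aemeasurable_of_eqOn_cubes (h : IsDyadicSystem E c₀ Δ) (hE : IsRegularSet (k : ℝ) C E)
    (hc₀ : 0 < c₀) (hc₀' : c₀ ≤ 1 / 2) {j : ℤ} (hj : j ∈ dyadicIndex E) {f : X → ℝ≥0∞}
    (hf : ∀ Q ∈ Δ j, ∃ g : X → ℝ≥0∞, Measurable g ∧ EqOn f g Q) :
    AEMeasurable f ((μH[(k : ℝ)] : Measure X).restrict E) := by
  have hcover := h.cover j hj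
  rw [sUnion_eq_iUnion] at hcover
  have : Countable (Δ j) := countable_coe_iff.2 (h.countable hE hc₀ hc₀' hj)
  rw [hcover, aemeasurable_iUnion_iff]
  intro Q
  obtain ⟨g, hg, hfg⟩ := hf Q Q.2
  exact ⟨g, hg, (ae_restrict_iff' (h.measurableSet j hj Q Q.2)).2 (Filter.Eventually.of_forall hfg)⟩

lemma lintegral_ball_le_of_cubes (h : IsDyadicSystem E c₀ Δ) (hE : IsRegularSet (k : ℝ) C E)
    (hc₀ : 0 < c₀) (hc₀' : c₀ ≤ 1 / 2) {j : ℤ} (hj : j ∈ dyadicIndex E) {μ : Measure X}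
    (hμ : ∀ᵐ x ∂μ, x ∈ E) {f g : X → ℝ≥0∞} {K : ℝ≥0∞}
    (hfg : ∀ Q ∈ Δ j, ∫⁻ x in Q, f x ∂μ ≤ K * ∫⁻ x in Q, g x ∂μ) (c : X) {r r' : ℝ}
    (hr : r + c₀⁻¹ * (2 : ℝ) ^ (-j) ≤ r') :
    ∫⁻ x in Metric.ball c r, f x ∂μ ≤ K * ∫⁻ x in Metric.ball c r', g x ∂μ := by
  set T : Set (Set X) := {Q ∈ Δ j | (Q ∩ Metric.ball c r).Nonempty}
  have hT : T ⊆ Δ j := fun Q hQ => hQ.1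
  have hcover : Metric.ball c r ≤ᵐ[μ] ⋃₀ T := by
    filter_upwards [hμ] with x hxE hxc
    obtain ⟨Q, hQ, hxQ⟩ := h.exists_mem hj hxE
    exact ⟨Q, ⟨hQ, x, hxQ, hxc⟩, hxQ⟩
  have hball : ⋃₀ T ⊆ Metric.ball c r' := by
    refine sUnion_subset ?_
    rintro Q ⟨hQ, x, hxQ, hxc⟩ y hy
    have hyx := h.dist_le hc₀ hj hQ hy hxQ
    rw [Metric.mem_ball] at hxc ⊢
    linarith [dist_triangle y x c]
  calc ∫⁻ x in Metric.ball c r, f x ∂μ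
      ≤ ∫⁻ x in ⋃₀ T, f x ∂μ := lintegral_mono_set' hcover
    _ = ∑' Q : T, ∫⁻ x in Q.1, f x ∂μ := h.lintegral_sUnion hE hc₀ hc₀' hj hT μ f
    _ ≤ ∑' Q : T, K * ∫⁻ x in Q.1, g x ∂μ := ENNReal.tsum_le_tsum fun Q => hfg Q.1 (hT Q.2)
    _ = K * ∫⁻ x in ⋃₀ T, g x ∂μ := by
        rw [ENNReal.tsum_mul_left, h.lintegral_sUnion hE hc₀ hc₀' hj hT μ g]
    _ ≤ K * ∫⁻ x in Metric.ball c r', g x ∂μ := by gcongr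

lemma lintegral_cubeAt (h : IsDyadicSystem E c₀ Δ) (hE : IsRegularSet (k : ℝ) C E)
    (hc₀ : 0 < c₀) (hc₀' : c₀ ≤ 1 / 2) {i j : ℤ} (hi : i ∈ dyadicIndex E) (hij : i ≤ j)
    {A : Set X} (hA : A ∈ Δ i) (g : Set X → ℝ≥0∞) (μ : Measure X) :
    ∫⁻ x in A, g (cubeAt Δ j x) ∂μ = ∑' Q : {Q ∈ Δ j | Q ⊆ A}, g Q.1 * μ Q.1 := by
  have hj := mem_dyadicIndex_of_le hi hij
  nth_rw 1 [← h.sUnion_subcubes_eq hi hij hA]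
  rw [h.lintegral_sUnion hE hc₀ hc₀' hj (fun Q hQ => hQ.1)]
  refine tsum_congr fun Q => ?_
  have hconst : EqOn (fun x => g (cubeAt Δ j x)) (fun _ => g Q.1) Q.1 := fun x hx =>
    congrArg g (h.cubeAt_eq hj Q.2.1 hx)
  rw [setLIntegral_congr_fun (h.measurableSet j hj Q.1 Q.2.1) hconst, setLIntegral_const]

lemma encard_generations_le (h : IsDyadicSystem E c₀ Δ) (hk : 1 ≤ k)
    (hE : IsRegularSet (k : ℝ) C E) (hc₀ : 0 < c₀) (hc₀' : c₀ ≤ 1 / 2) {N : ℕ}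
    (hN : 2 * C ^ 2 / c₀ ^ 2 < 2 ^ N) {J : ℤ} (hJ : J ∈ dyadicIndex E) (Q : Set X) :
    {t : ℕ | Q ∈ Δ (J + t)}.encard ≤ N := by
  have hC := hE.one_le
  have hdiff : ∀ {s t : ℕ}, Q ∈ Δ (J + s) → Q ∈ Δ (J + t) → s ≤ t → t < s + N := by
    intro s t hs ht hst
    have hdiam := (h.le_ediam hk hE hc₀ hc₀' (add_natCast_mem_dyadicIndex hJ s) hs).trans
      (h.ediam_le _ (add_natCast_mem_dyadicIndex hJ t) Q ht)
    have hscale : (2 : ℝ) ^ (-(J + (s : ℤ))) = 2 ^ (t - s) * 2 ^ (-(J + (t : ℤ))) := by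
      rw [← zpow_natCast, ← zpow_add₀ two_ne_zero]
      congr 1
      omega
    rw [ENNReal.ofReal_le_ofReal_iff (by positivity), hscale, ← mul_assoc] at hdiam
    have hle : c₀ / (2 * C ^ 2) * 2 ^ (t - s) ≤ c₀⁻¹ :=
      le_of_mul_le_mul_right hdiam (by positivity)
    have hpow : (2 : ℝ) ^ (t - s) ≤ 2 * C ^ 2 / c₀ ^ 2 :=
      calc (2 : ℝ) ^ (t - s) = c₀ / (2 * C ^ 2) * 2 ^ (t - s) * (2 * C ^ 2 / c₀) := by field_simp
        _ ≤ c₀⁻¹ * (2 * C ^ 2 / c₀) := by gcongr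
        _ = 2 * C ^ 2 / c₀ ^ 2 := by field_simp
    have := (pow_lt_pow_iff_right₀ one_lt_two).1 (hpow.trans_lt hN)
    omega
  classical
  by_cases hex : ∃ t : ℕ, Q ∈ Δ (J + t)
  · have hsub : {t : ℕ | Q ∈ Δ (J + t)} ⊆ Finset.Ico (Nat.find hex) (Nat.find hex + N) :=
      fun t ht => Finset.mem_coe.2 (Finset.mem_Ico.2
        ⟨Nat.find_min' hex ht, hdiff (Nat.find_spec hex) ht (Nat.find_min' hex ht)⟩)
    refine (encard_le_encard hsub).trans ?_
    rw [encard_coe_eq_coe_finsetCard, Nat.card_Ico, Nat.add_sub_cancel_left]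
  · rw [not_exists] at hex
    rw [eq_empty_of_forall_notMem (s := {t : ℕ | Q ∈ Δ (J + t)}) hex, encard_empty]
    exact zero_le

lemma tsum_lintegral_cubeAt_le (h : IsDyadicSystem E c₀ Δ) (hk : 1 ≤ k)
    (hE : IsRegularSet (k : ℝ) C E) (hc₀ : 0 < c₀) (hc₀' : c₀ ≤ 1 / 2) {N : ℕ}
    (hN : 2 * C ^ 2 / c₀ ^ 2 < 2 ^ N) {J : ℤ} (hJ : J ∈ dyadicIndex E) {A : Set X}
    (hA : A ∈ Δ J) (g : Set X → ℝ≥0∞) (μ : Measure X) :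
    ∑' t : ℕ, ∫⁻ x in A, g (cubeAt Δ (J + t) x) ∂μ ≤
      N * ∑' Q : {Q : Set X // Q ∈ dyadicCubes E Δ ∧ Q ⊆ A}, g Q.1 * μ Q.1 := by
  set f : Set X → ℝ≥0∞ := fun Q => g Q * μ Q
  have hindicator : ∀ (t : ℕ) (Q : Set X), {Q ∈ Δ (J + t) | Q ⊆ A}.indicator f Q =
      {t : ℕ | Q ∈ Δ (J + t)}.indicator
        (fun _ => {Q | Q ∈ dyadicCubes E Δ ∧ Q ⊆ A}.indicator f Q) t := by
    intro t Q
    have hmem : Q ∈ Δ (J + t) → Q ∈ dyadicCubes E Δ := fun hQ =>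
      mem_iUnion₂.2 ⟨J + t, add_natCast_mem_dyadicIndex hJ t, hQ⟩
    by_cases hQ : Q ∈ Δ (J + t) <;> by_cases hQA : Q ⊆ A <;> simp [indicator, hQ, hQA, hmem]
  calc ∑' t : ℕ, ∫⁻ x in A, g (cubeAt Δ (J + t) x) ∂μ
      = ∑' t : ℕ, ∑' Q : Set X, {Q ∈ Δ (J + t) | Q ⊆ A}.indicator f Q := by
        refine tsum_congr fun t => ?_
        rw [h.lintegral_cubeAt hE hc₀ hc₀' hJ (by omega) hA g μ]
        exact tsum_subtype _ f
    _ = ∑' Q : Set X, ∑' t : ℕ, {t : ℕ | Q ∈ Δ (J + t)}.indicator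
          (fun _ => {Q | Q ∈ dyadicCubes E Δ ∧ Q ⊆ A}.indicator f Q) t := by
        rw [ENNReal.tsum_comm]
        simp only [hindicator]
    _ ≤ ∑' Q : Set X, N * {Q | Q ∈ dyadicCubes E Δ ∧ Q ⊆ A}.indicator f Q := by
        refine ENNReal.tsum_le_tsum fun Q => ?_
        rw [← tsum_subtype, ENNReal.tsum_set_const]
        gcongr
        exact_mod_cast h.encard_generations_le hk hE hc₀ hc₀' hN hJ Q
    _ = N * ∑' Q : {Q : Set X // Q ∈ dyadicCubes E Δ ∧ Q ⊆ A}, f Q := by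
        rw [ENNReal.tsum_mul_left, ← tsum_subtype]
        rfl

lemma tsum_cubes_le (h : IsDyadicSystem E c₀ Δ) (hE : IsRegularSet (k : ℝ) C E) (hc₀ : 0 < c₀)
    (hc₀' : c₀ ≤ 1 / 2) {J : ℤ} (hJ : J ∈ dyadicIndex E) {A : Set X} (hA : A ∈ Δ J)
    (g : Set X → ℝ≥0∞) (μ : Measure X) :
    ∑' Q : {Q : Set X // Q ∈ dyadicCubes E Δ ∧ Q ⊆ A}, g Q.1 * μ Q.1 ≤
      ∑' t : ℕ, ∫⁻ x in A, g (cubeAt Δ (J + t) x) ∂μ := by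
  have hgen : {Q | Q ∈ dyadicCubes E Δ ∧ Q ⊆ A} ⊆ ⋃ t : ℕ, {Q ∈ Δ (J + t) | Q ⊆ A} := by
    rintro Q ⟨hQ, hQA⟩
    obtain ⟨j, hj, hQj⟩ := mem_iUnion₂.1 hQ
    rcases le_total J j with hJj | hjJ
    · refine mem_iUnion.2 ⟨(j - J).toNat, ?_, hQA⟩
      rwa [Int.toNat_of_nonneg (by omega), add_sub_cancel]
    · obtain ⟨x, hx⟩ := h.nonempty hE hc₀ hc₀' hj hQj
      have hQeq : Q = A := hQA.antisymm (h.subset_of_le hj hjJ hQj hA hx (hQA hx))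
      exact mem_iUnion.2 ⟨0, by simpa [hQeq] using hA⟩
  calc ∑' Q : {Q : Set X // Q ∈ dyadicCubes E Δ ∧ Q ⊆ A}, g Q.1 * μ Q.1
      ≤ ∑' Q : ⋃ t : ℕ, {Q ∈ Δ (J + t) | Q ⊆ A}, g Q.1 * μ Q.1 :=
        ENNReal.tsum_mono_subtype (fun Q => g Q * μ Q) hgen
    _ ≤ ∑' t : ℕ, ∑' Q : {Q ∈ Δ (J + t) | Q ⊆ A}, g Q.1 * μ Q.1 :=
        ENNReal.tsum_iUnion_le_tsum (fun Q => g Q * μ Q) _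
    _ = ∑' t : ℕ, ∫⁻ x in A, g (cubeAt Δ (J + t) x) ∂μ := tsum_congr fun t =>
        (h.lintegral_cubeAt hE hc₀ hc₀' hJ (by omega) hA g μ).symm

end IsDyadicSystem

end RegularDyadic

section DilateCube

variable {X : Type*} [MetricSpace X]

lemma dilateCube_subset (E : Set X) (K : ℝ) (Q : Set X) : dilateCube E K Q ⊆ E := fun _ h => h.1

lemma measurableSet_dilateCube [MeasurableSpace X] [OpensMeasurableSpace X] {E : Set X}
    (hE : MeasurableSet E) (K : ℝ) (Q : Set X) : MeasurableSet (dilateCube E K Q) :=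
  hE.inter (measurableSet_le measurable_infEDist measurable_const)

lemma subset_dilateCube {E Q : Set X} (h : Q ⊆ E) (K : ℝ) : Q ⊆ dilateCube E K Q := fun x hx =>
  ⟨h hx, by rw [Metric.infEDist_zero_of_mem hx]; exact zero_le⟩

lemma dilateCube_self (E : Set X) (K : ℝ) : dilateCube E K E = E :=
  (dilateCube_subset E K E).antisymm (subset_dilateCube subset_rfl K)

lemma mem_dilateCube_two {E Q : Set X} {x : X} :
    x ∈ dilateCube E 2 Q ↔ x ∈ E ∧ Metric.infEDist x Q ≤ Metric.ediam Q := by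
  rw [dilateCube, mem_ofPred_eq, show (2 - 1 : ℝ) = 1 by norm_num, ENNReal.ofReal_one, one_mul]

lemma ediam_dilateCube_two_le (E Q : Set X) :
    Metric.ediam (dilateCube E 2 Q) ≤ 3 * Metric.ediam Q := by
  rcases eq_or_ne (Metric.ediam Q) ⊤ with htop | hfin
  · simp only [htop, ENNReal.mul_top three_ne_zero, le_top]
  have hsub : dilateCube E 2 Q ⊆ Metric.cthickening ((Metric.ediam Q).toNNReal : ℝ) Q := by
    intro x hx
    rw [Metric.mem_cthickening_iff, ENNReal.ofReal_coe_nnreal, ENNReal.coe_toNNReal hfin]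
    exact (mem_dilateCube_two.1 hx).2
  refine (Metric.ediam_mono hsub).trans ((Metric.ediam_cthickening_le _).trans_eq ?_)
  rw [ENNReal.coe_toNNReal hfin]
  ring

lemma inter_ball_subset_dilateCube_two {E Q : Set X} {x : X} (hx : x ∈ Q) {r : ℝ}
    (hr : ENNReal.ofReal r ≤ Metric.ediam Q) : E ∩ Metric.ball x r ⊆ dilateCube E 2 Q := by
  rintro y ⟨hyE, hy⟩
  refine mem_dilateCube_two.2 ⟨hyE, (Metric.infEDist_le_edist_of_mem hx).trans (le_trans ?_ hr)⟩
  rw [edist_dist]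
  exact ENNReal.ofReal_le_ofReal (Metric.mem_ball.1 hy).le

end DilateCube

section Averages

variable {X : Type*} [MetricSpace X] [MeasurableSpace X] {μ : Measure X} {q : ℝ}

lemma exists_betaOne_le {ι : Type*} (hq : 0 < q) (𝒱 : ι → Set X) {S : Set X}
    (h : betaNumber μ q 𝒱 S ^ q ≠ ⊤) {ε : ℝ≥0∞} (hε : 0 < ε) :
    ∃ i, betaOne μ q (𝒱 i) S ^ q ≤ betaNumber μ q 𝒱 S ^ q + ε := by
  by_contra! hcon
  have hle : (betaNumber μ q 𝒱 S ^ q + ε) ^ (1 / q) ≤ betaNumber μ q 𝒱 S :=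
    le_iInf fun i => by
      rw [one_div, ENNReal.rpow_inv_le_iff hq]
      exact (hcon i).le
  rw [one_div, ENNReal.rpow_inv_le_iff hq] at hle
  exact (ENNReal.lt_add_right h hε.ne').not_ge hle

variable [BorelSpace X]

lemma lintegral_infEDist_rpow_le (hq : 0 < q) (V S : Set X) (hS : 0 < Metric.ediam S)
    (hS' : Metric.ediam S ≠ ⊤) (hμ : μ S ≠ ⊤) :
    ∫⁻ x in S, Metric.infEDist x V ^ q ∂μ ≤ Metric.ediam S ^ q * μ S * betaOne μ q V S ^ q := by
  rcases eq_or_ne (μ S) 0 with h0 | h0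
  · rw [setLIntegral_measure_zero _ _ h0]
    exact zero_le
  have hbeta : betaOne μ q V S ^ q =
      (μ S)⁻¹ * ((∫⁻ x in S, Metric.infEDist x V ^ q ∂μ) * (Metric.ediam S ^ q)⁻¹) := by
    unfold betaOne
    rw [← ENNReal.rpow_mul, one_div_mul_cancel hq.ne', ENNReal.rpow_one,
      ← lintegral_mul_const _ (measurable_infEDist.pow_const q)]
    simp_rw [ENNReal.div_rpow_of_nonneg _ _ hq.le, div_eq_mul_inv]
  have hcancel : μ S * (μ S)⁻¹ = 1 := ENNReal.mul_inv_cancel h0 hμ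
  have hcancel' : Metric.ediam S ^ q * (Metric.ediam S ^ q)⁻¹ = 1 :=
    ENNReal.mul_inv_cancel (by simp [hS.ne', hS']) (by simp [hS.ne', hS'])
  apply le_of_eq
  calc ∫⁻ x in S, Metric.infEDist x V ^ q ∂μ
      = (Metric.ediam S ^ q * (Metric.ediam S ^ q)⁻¹) * (μ S * (μ S)⁻¹) *
        ∫⁻ x in S, Metric.infEDist x V ^ q ∂μ := by rw [hcancel, hcancel', one_mul, one_mul]
    _ = Metric.ediam S ^ q * μ S * betaOne μ q V S ^ q := by rw [hbeta]; ring

lemma lintegral_lintegral_ball [SecondCountableTopology X] {ν : Measure X} [SFinite μ] [SFinite ν]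
    {f : X → ℝ≥0∞} (hf : AEMeasurable f ν) (r : ℝ) :
    ∫⁻ w, ∫⁻ x in Metric.ball w r, f x ∂ν ∂μ = ∫⁻ x, f x * μ (Metric.ball x r) ∂ν := by
  set D : Set (X × X) := {z | dist z.2 z.1 < r}
  have hD : MeasurableSet D := measurableSet_lt (measurable_snd.dist measurable_fst)
    measurable_const
  have hinner : ∀ w, ∫⁻ x in Metric.ball w r, f x ∂ν =
      ∫⁻ x, D.indicator (fun z => f z.2) (w, x) ∂ν := fun w =>
    (lintegral_indicator measurableSet_ball f).symm
  have hswap : ∀ x, ∫⁻ w, D.indicator (fun z => f z.2) (w, x) ∂μ = f x * μ (Metric.ball x r) := by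
    intro x
    rw [← setLIntegral_const, ← lintegral_indicator measurableSet_ball, Metric.ball]
    simp_rw [dist_comm _ x]
    rfl
  simp_rw [hinner, ← hswap]
  exact lintegral_lintegral_swap (hf.comp_snd.indicator hD)

lemma lintegral_lintegral_ball_le [SecondCountableTopology X] [SFinite μ] {f : X → ℝ≥0∞}
    (hf : AEMeasurable f μ) {r : ℝ} {Q N : Set X} (hQ : MeasurableSet Q)
    (hQN : ∀ w ∈ Q, Metric.ball w r ⊆ N) {B : ℝ≥0∞} (hB : ∀ᵐ x ∂μ, μ (Metric.ball x r) ≤ B) :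
    ∫⁻ w in Q, ∫⁻ x in Metric.ball w r, f x ∂μ ∂μ ≤ B * ∫⁻ x in N, f x ∂μ :=
  calc ∫⁻ w in Q, ∫⁻ x in Metric.ball w r, f x ∂μ ∂μ
      ≤ ∫⁻ w in Q, ∫⁻ x in Metric.ball w r, f x ∂μ.restrict N ∂μ := by
        refine setLIntegral_mono' hQ fun w hw => ?_
        rw [restrict_restrict measurableSet_ball, inter_eq_left.2 (hQN w hw)]
    _ ≤ ∫⁻ w, ∫⁻ x in Metric.ball w r, f x ∂μ.restrict N ∂μ := setLIntegral_le_lintegral _ _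
    _ = ∫⁻ x in N, f x * μ (Metric.ball x r) ∂μ := lintegral_lintegral_ball hf.restrict r
    _ ≤ ∫⁻ x in N, B * f x ∂μ := by
        refine lintegral_mono_ae ((ae_restrict_of_ae hB).mono fun x hx => ?_)
        rw [mul_comm]
        gcongr
    _ = B * ∫⁻ x in N, f x ∂μ := lintegral_const_mul'' _ hf.restrict

end Averages

section AncestorSet

variable {X : Type*} [MetricSpace X] {c₀ : ℝ} {E : Set X} {Δ : ℤ → Set (Set X)}

open Classical in
/-- The enlarged cube `2Q` of generation `i` around a point, where `i` is allowed to be too small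
to be a generation of cubes: the whole set `E` is then used. -/
def ancestorSet (E : Set X) (Δ : ℤ → Set (Set X)) (i : ℤ) (x : X) : Set X :=
  if i ∈ dyadicIndex E then dilateCube E 2 (cubeAt Δ i x) else E

lemma ancestorSet_of_mem {i : ℤ} (hi : i ∈ dyadicIndex E) (x : X) :
    ancestorSet E Δ i x = dilateCube E 2 (cubeAt Δ i x) := if_pos hi

lemma ancestorSet_of_notMem {i : ℤ} (hi : i ∉ dyadicIndex E) (x : X) :
    ancestorSet E Δ i x = E := if_neg hi

variable [MeasurableSpace X]

namespace IsDyadicSystem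

lemma mem_ancestorSet (h : IsDyadicSystem E c₀ Δ) (i : ℤ) {x : X} (hx : x ∈ E) :
    x ∈ ancestorSet E Δ i x := by
  by_cases hi : i ∈ dyadicIndex E
  · rw [ancestorSet_of_mem hi]
    exact subset_dilateCube (h.subset i hi _ (h.cubeAt_mem hi hx)) 2 (h.mem_cubeAt hi hx)
  · rwa [ancestorSet_of_notMem hi]

lemma ediam_ancestorSet_le (h : IsDyadicSystem E c₀ Δ) (hc₀ : 0 < c₀) (hc₀' : c₀ ≤ 1 / 2)
    (i : ℤ) {x : X} (hx : x ∈ E) :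
    Metric.ediam (ancestorSet E Δ i x) ≤ ENNReal.ofReal (3 * c₀⁻¹ * (2 : ℝ) ^ (-i)) := by
  by_cases hi : i ∈ dyadicIndex E
  · rw [ancestorSet_of_mem hi, mul_assoc, ENNReal.ofReal_mul zero_le_three, ENNReal.ofReal_ofNat]
    exact (ediam_dilateCube_two_le _ _).trans
      (mul_le_mul_right (h.ediam_le i hi _ (h.cubeAt_mem hi hx)) 3)
  · rw [ancestorSet_of_notMem hi]
    refine (not_le.1 hi).le.trans (ENNReal.ofReal_le_ofReal ?_)
    have hinv : 1 ≤ c₀⁻¹ := (one_le_inv₀ hc₀).2 (by linarith)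
    exact le_mul_of_one_le_left (by positivity) (by linarith)

lemma ancestorSet_eq_of_mem (h : IsDyadicSystem E c₀ Δ) {i j : ℤ} (hj : j ∈ dyadicIndex E)
    (hij : i ≤ j) {Q : Set X} (hQ : Q ∈ Δ j) {x y : X} (hx : x ∈ Q) (hy : y ∈ Q) :
    ancestorSet E Δ i x = ancestorSet E Δ i y := by
  by_cases hi : i ∈ dyadicIndex E
  · have hxE := h.subset j hj Q hQ hx
    have hsub := h.subset_of_le hi hij (h.cubeAt_mem hi hxE) hQ (h.mem_cubeAt hi hxE) hx
    rw [ancestorSet_of_mem hi, ancestorSet_of_mem hi,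
      h.cubeAt_eq hi (h.cubeAt_mem hi hxE) (hsub hy)]
  · rw [ancestorSet_of_notMem hi, ancestorSet_of_notMem hi]

variable [BorelSpace X] {k : ℕ} {C : ℝ}

lemma inter_ball_subset_ancestorSet (h : IsDyadicSystem E c₀ Δ) (hk : 1 ≤ k)
    (hE : IsRegularSet (k : ℝ) C E) (hc₀ : 0 < c₀) (hc₀' : c₀ ≤ 1 / 2) (i : ℤ) {x : X}
    (hx : x ∈ E) :
    E ∩ Metric.ball x (c₀ / (2 * C ^ 2) * (2 : ℝ) ^ (-i)) ⊆ ancestorSet E Δ i x := by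
  by_cases hi : i ∈ dyadicIndex E
  · rw [ancestorSet_of_mem hi]
    exact inter_ball_subset_dilateCube_two (h.mem_cubeAt hi hx)
      (h.le_ediam hk hE hc₀ hc₀' hi (h.cubeAt_mem hi hx))
  · rw [ancestorSet_of_notMem hi]
    exact inter_subset_left

lemma ediam_ancestorSet_pos (h : IsDyadicSystem E c₀ Δ) (hk : 1 ≤ k)
    (hE : IsRegularSet (k : ℝ) C E) (hc₀ : 0 < c₀) (hc₀' : c₀ ≤ 1 / 2) (i : ℤ) {x : X}
    (hx : x ∈ E) : 0 < Metric.ediam (ancestorSet E Δ i x) := by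
  by_cases hi : i ∈ dyadicIndex E
  · have hC := hE.one_le
    have hQ := h.cubeAt_mem hi hx
    rw [ancestorSet_of_mem hi]
    exact (ENNReal.ofReal_pos.2 (by positivity)).trans_le
      ((h.le_ediam hk hE hc₀ hc₀' hi hQ).trans
        (Metric.ediam_mono (subset_dilateCube (h.subset i hi _ hQ) 2)))
  · rw [ancestorSet_of_notMem hi]
    exact hE.ediam_pos

lemma lintegral_infEDist_ball_le (h : IsDyadicSystem E c₀ Δ) (hk : 1 ≤ k)
    (hE : IsRegularSet (k : ℝ) C E) (hc₀ : 0 < c₀) (hc₀' : c₀ ≤ 1 / 2) (i : ℤ) {x : X}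
    (hx : x ∈ E) {q : ℝ} (hq : 0 < q) (V : Set X) {D : ℝ} (hD : D = 3 * c₀⁻¹ * (2 : ℝ) ^ (-i)) :
    ∫⁻ y in Metric.ball x (c₀ / (2 * C ^ 2) * (2 : ℝ) ^ (-i)), Metric.infEDist y V ^ q
        ∂(μH[(k : ℝ)] : Measure X).restrict E ≤
      ENNReal.ofReal D ^ q * ENNReal.ofReal (C * (2 * D) ^ k) *
        betaOne ((μH[(k : ℝ)] : Measure X).restrict E) q V (ancestorSet E Δ i x) ^ q := by
  set μ := (μH[(k : ℝ)] : Measure X).restrict E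
  set S := ancestorSet E Δ i x
  have hD₀ : 0 < D := by rw [hD]; positivity
  have hdiam : Metric.ediam S ≤ ENNReal.ofReal D := hD ▸ h.ediam_ancestorSet_le hc₀ hc₀' i hx
  have hball : S ⊆ Metric.ball x (2 * D) := fun y hy => by
    have hyx := (Metric.edist_le_ediam_of_mem hy (h.mem_ancestorSet i hx)).trans hdiam
    rw [edist_dist, ENNReal.ofReal_le_ofReal_iff hD₀.le] at hyx
    exact Metric.mem_ball.2 (by linarith)
  have hμS : μ S ≤ ENNReal.ofReal (C * (2 * D) ^ k) :=
    (measure_mono hball).trans (hE.isUpperRegular x hx _ (by positivity))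
  have hsub : Metric.ball x (c₀ / (2 * C ^ 2) * (2 : ℝ) ^ (-i)) ≤ᵐ[μ] S := by
    filter_upwards [hE.ae_mem] with y hyE hy
    exact h.inter_ball_subset_ancestorSet hk hE hc₀ hc₀' i hx ⟨hyE, hy⟩
  calc ∫⁻ y in Metric.ball x (c₀ / (2 * C ^ 2) * (2 : ℝ) ^ (-i)), Metric.infEDist y V ^ q ∂μ
      ≤ ∫⁻ y in S, Metric.infEDist y V ^ q ∂μ := lintegral_mono_set' hsub
    _ ≤ Metric.ediam S ^ q * μ S * betaOne μ q V S ^ q :=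
        lintegral_infEDist_rpow_le hq V S (h.ediam_ancestorSet_pos hk hE hc₀ hc₀' i hx)
          (hdiam.trans_lt ENNReal.ofReal_lt_top).ne (hμS.trans_lt ENNReal.ofReal_lt_top).ne
    _ ≤ _ := by gcongr

end IsDyadicSystem

namespace GLem

variable [BorelSpace X] {k : ℕ} {C : ℝ} {g : Set X → ℝ≥0∞} {q : ℝ} {M : ℝ≥0}

lemma le_of_mem_dyadicCubes (hG : GLem (k : ℝ) c₀ E g q M) (hE : IsRegularSet (k : ℝ) C E)
    (h : IsDyadicSystem E c₀ Δ) (hc₀ : 0 < c₀) (hc₀' : c₀ ≤ 1 / 2) {Q : Set X}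
    (hQ : Q ∈ dyadicCubes E Δ) : g (dilateCube E 2 Q) ^ q ≤ M := by
  obtain ⟨j, hj, hQj⟩ := mem_iUnion₂.1 hQ
  set μ := (μH[(k : ℝ)] : Measure X).restrict E
  have hterm : g (dilateCube E 2 Q) ^ q * μ Q ≤ M * μ Q :=
    (ENNReal.le_tsum (f := fun Q' : {Q' : Set X // Q' ∈ dyadicCubes E Δ ∧ Q' ⊆ Q} =>
      g (dilateCube E 2 Q'.1) ^ q * μ Q'.1) ⟨Q, hQ, subset_rfl⟩).trans (hG Δ h Q hQ)
  exact (ENNReal.mul_le_mul_iff_left (h.measure_pos hE hc₀ hc₀' hj hQj).ne'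
    (h.measure_ne_top hE hc₀ hj hQj)).1 hterm

lemma le_self (hG : GLem (k : ℝ) c₀ E g q M) (hE : IsRegularSet (k : ℝ) C E)
    (h : IsDyadicSystem E c₀ Δ) (hc₀ : 0 < c₀) (hc₀' : c₀ ≤ 1 / 2) (hfin : Metric.ediam E ≠ ⊤) :
    g E ^ q ≤ M := by
  obtain ⟨a, ha, hdiam⟩ := exists_isLeast_dyadicIndex hE.ediam_pos hfin
  have hinv : 2 ≤ c₀⁻¹ := by rw [le_inv_comm₀ two_pos hc₀]; linarith
  have hΔ := h.update_singleton_self hE.isClosed.measurableSet hE.nonempty ha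
    (hdiam.trans (ENNReal.ofReal_le_ofReal (by gcongr)))
  have hmem : E ∈ dyadicCubes E (Function.update Δ a {E}) :=
    mem_iUnion₂.2 ⟨a, ha.1, by rw [Function.update_self]; rfl⟩
  simpa only [dilateCube_self] using hG.le_of_mem_dyadicCubes hE hΔ hc₀ hc₀' hmem

lemma ancestorSet_le (hG : GLem (k : ℝ) c₀ E g q M) (hE : IsRegularSet (k : ℝ) C E)
    (h : IsDyadicSystem E c₀ Δ) (hc₀ : 0 < c₀) (hc₀' : c₀ ≤ 1 / 2) (i : ℤ) {x : X}
    (hx : x ∈ E) : g (ancestorSet E Δ i x) ^ q ≤ M := by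
  by_cases hi : i ∈ dyadicIndex E
  · rw [ancestorSet_of_mem hi]
    exact hG.le_of_mem_dyadicCubes hE h hc₀ hc₀' (mem_iUnion₂.2 ⟨i, hi, h.cubeAt_mem hi hx⟩)
  · rw [ancestorSet_of_notMem hi]
    exact hG.le_self hE h hc₀ hc₀' ((not_le.1 hi).trans ENNReal.ofReal_lt_top).ne

lemma tsum_lintegral_ancestorSet_le (hG : GLem (k : ℝ) c₀ E g q M) (hk : 1 ≤ k)
    (hE : IsRegularSet (k : ℝ) C E) (h : IsDyadicSystem E c₀ Δ) (hc₀ : 0 < c₀)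
    (hc₀' : c₀ ≤ 1 / 2) {N : ℕ} (hN : 2 * C ^ 2 / c₀ ^ 2 < 2 ^ N) (m : ℕ) {J : ℤ}
    (hJ : J ∈ dyadicIndex E) {A : Set X} (hA : A ∈ Δ J) :
    ∑' t : ℕ, ∫⁻ x in A, g (ancestorSet E Δ (J + t - m) x) ^ q
        ∂(μH[(k : ℝ)] : Measure X).restrict E ≤
      (m + N) * M * (μH[(k : ℝ)] : Measure X).restrict E A := by
  set μ := (μH[(k : ℝ)] : Measure X).restrict E
  set a : ℕ → ℝ≥0∞ := fun t => ∫⁻ x in A, g (ancestorSet E Δ (J + t - m) x) ^ q ∂μ with ha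
  have hearly : ∀ t, a t ≤ M * μ A := fun t => by
    rw [← setLIntegral_const]
    exact setLIntegral_mono' (h.measurableSet J hJ A hA) fun x hx =>
      hG.ancestorSet_le hE h hc₀ hc₀' _ (h.subset J hJ A hA hx)
  have hlate : ∀ t, a (t + m) = ∫⁻ x in A, g (dilateCube E 2 (cubeAt Δ (J + t) x)) ^ q ∂μ := by
    intro t
    have hidx : J + ((t + m : ℕ) : ℤ) - m = J + t := by omega
    simp_rw [ha, hidx, ancestorSet_of_mem (add_natCast_mem_dyadicIndex hJ t)]
  calc ∑' t, a t = ∑ t ∈ Finset.range m, a t + ∑' t, a (t + m) :=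
        (ENNReal.summable.sum_add_tsum_nat_add' (k := m)).symm
    _ ≤ m * (M * μ A) + N * (M * μ A) := by
        gcongr
        · simpa only [Finset.sum_const, Finset.card_range, nsmul_eq_mul] using
            Finset.sum_le_sum fun t (_ : t ∈ Finset.range m) => hearly t
        · simp_rw [hlate]
          exact (h.tsum_lintegral_cubeAt_le hk hE hc₀ hc₀' hN hJ hA
            (fun Q => g (dilateCube E 2 Q) ^ q) μ).trans
              (mul_le_mul_right (hG Δ h A (mem_iUnion₂.2 ⟨J, hJ, hA⟩)) _)
    _ = (m + N) * M * μ A := by ring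

end GLem

end AncestorSet

/-! ### Carleson sums -/

lemma two_zpow_neg_add (J : ℤ) (t : ℕ) :
    (2 : ℝ) ^ (-(J + t)) = scale ((2 : ℝ) ^ (-J)) t := by
  rw [scale, neg_add, zpow_add₀ two_ne_zero, zpow_neg 2 (t : ℤ), zpow_natCast, div_eq_mul_inv]

lemma two_zpow_neg_add_sub (J : ℤ) (t m : ℕ) :
    (2 : ℝ) ^ (-(J + t - m)) = 2 ^ m * scale ((2 : ℝ) ^ (-J)) t := by
  rw [← two_zpow_neg_add, neg_sub, sub_eq_add_neg, zpow_add₀ two_ne_zero, zpow_natCast]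

lemma scale_le {R : ℝ} (hR : 0 ≤ R) (t : ℕ) : scale R t ≤ R :=
  div_le_self hR (one_le_pow₀ one_le_two)

section CubeSize

variable {X : Type*} [MetricSpace X] [MeasurableSpace X] {k : ℕ} {C c₀ : ℝ} {E : Set X}
  {Δ : ℤ → Set (Set X)} {μ : Measure X}

lemma IsUpperRegular.measure_ball_mul_le (h : IsUpperRegular k C E μ) {x : X} (hx : x ∈ E)
    {K r : ℝ} (hK : 0 < K) (hr : 0 < r) :
    μ (Metric.ball x (K * r)) ≤ ENNReal.ofReal (C * K ^ k) * ENNReal.ofReal r ^ k := by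
  refine (h x hx _ (mul_pos hK hr)).trans_eq ?_
  rw [← ENNReal.ofReal_pow hr.le, ← ENNReal.ofReal_mul' (by positivity), mul_pow, mul_assoc]

/-- The constant in the lower bounds for the diameter and the measure of a dyadic cube. -/
def cubeSizeConst (k : ℕ) (C c₀ : ℝ) : ℝ≥0∞ := ENNReal.ofReal (2 * C ^ 2 / c₀ + C / c₀ ^ k)

namespace IsDyadicSystem

variable [BorelSpace X]

lemma ofReal_le_mul_ediam (h : IsDyadicSystem E c₀ Δ) (hk : 1 ≤ k)
    (hE : IsRegularSet (k : ℝ) C E) (hc₀ : 0 < c₀) (hc₀' : c₀ ≤ 1 / 2) {j : ℤ}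
    (hj : j ∈ dyadicIndex E) {Q : Set X} (hQ : Q ∈ Δ j) :
    ENNReal.ofReal ((2 : ℝ) ^ (-j)) ≤ cubeSizeConst k C c₀ * Metric.ediam Q := by
  have hC := hE.one_le
  calc ENNReal.ofReal ((2 : ℝ) ^ (-j))
      = ENNReal.ofReal (2 * C ^ 2 / c₀) *
          ENNReal.ofReal (c₀ / (2 * C ^ 2) * (2 : ℝ) ^ (-j)) := by
        rw [← ENNReal.ofReal_mul (by positivity)]
        congr 1
        field_simp
    _ ≤ cubeSizeConst k C c₀ * Metric.ediam Q := by
        gcongr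
        · exact ENNReal.ofReal_le_ofReal (le_add_of_nonneg_right (by positivity))
        · exact h.le_ediam hk hE hc₀ hc₀' hj hQ

lemma ofReal_pow_le_mul_measure (h : IsDyadicSystem E c₀ Δ) (hE : IsRegularSet (k : ℝ) C E)
    (hc₀ : 0 < c₀) (hc₀' : c₀ ≤ 1 / 2) {j : ℤ} (hj : j ∈ dyadicIndex E) {Q : Set X}
    (hQ : Q ∈ Δ j) :
    ENNReal.ofReal ((2 : ℝ) ^ (-j)) ^ k ≤
      cubeSizeConst k C c₀ * (μH[(k : ℝ)] : Measure X).restrict E Q := by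
  have hC := hE.one_le
  calc ENNReal.ofReal ((2 : ℝ) ^ (-j)) ^ k
      = ENNReal.ofReal (C / c₀ ^ k) *
          ENNReal.ofReal (C⁻¹ * (c₀ * (2 : ℝ) ^ (-j)) ^ k) := by
        rw [← ENNReal.ofReal_mul (by positivity), ← ENNReal.ofReal_pow (by positivity), mul_pow]
        congr 1
        field_simp
    _ ≤ cubeSizeConst k C c₀ * (μH[(k : ℝ)] : Measure X).restrict E Q := by
        gcongr
        · exact ENNReal.ofReal_le_ofReal (le_add_of_nonneg_left (by positivity))
        · exact h.le_measure hE hc₀ hc₀' hj hQ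

lemma lintegral_infEDist_piecewise_le (h : IsDyadicSystem E c₀ Δ)
    (hE : IsRegularSet (k : ℝ) C E) (hc₀ : 0 < c₀) (hc₀' : c₀ ≤ 1 / 2) {j : ℤ}
    (hj : j ∈ dyadicIndex E) {V : X → Set X} {F : X → ℝ≥0∞}
    (hV : ∀ Q ∈ Δ j, ∀ x ∈ Q, ∀ y ∈ Q, V x = V y) (hF : ∀ Q ∈ Δ j, ∀ x ∈ Q, ∀ y ∈ Q, F x = F y)
    {q K : ℝ} (hK : c₀⁻¹ < K)
    (hVF : ∀ x ∈ E, ∫⁻ y in Metric.ball x (K * (2 : ℝ) ^ (-j)), Metric.infEDist y (V x) ^ q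
        ∂(μH[(k : ℝ)] : Measure X).restrict E ≤
      F x * ENNReal.ofReal ((2 : ℝ) ^ (-j)) ^ (q + k))
    (c : X) {r r' : ℝ} (hr : r + c₀⁻¹ * (2 : ℝ) ^ (-j) ≤ r') :
    ∫⁻ x in Metric.ball c r, Metric.infEDist x (V x) ^ q
        ∂(μH[(k : ℝ)] : Measure X).restrict E ≤
      cubeSizeConst k C c₀ * ENNReal.ofReal ((2 : ℝ) ^ (-j)) ^ q *
        ∫⁻ x in Metric.ball c r', F x ∂(μH[(k : ℝ)] : Measure X).restrict E := by
  set μ := (μH[(k : ℝ)] : Measure X).restrict E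
  set ρ := ENNReal.ofReal ((2 : ℝ) ^ (-j)) with hρ
  have hρ₀ : ρ ≠ 0 := by rw [hρ]; simp only [ne_eq, ENNReal.ofReal_eq_zero, not_le]; positivity
  refine h.lintegral_ball_le_of_cubes hE hc₀ hc₀' hj hE.ae_mem (fun Q hQ => ?_) c hr
  obtain ⟨x, hx⟩ := h.nonempty hE hc₀ hc₀' hj hQ
  have hQm := h.measurableSet j hj Q hQ
  have hball : Q ⊆ Metric.ball x (K * (2 : ℝ) ^ (-j)) := fun y hy =>
    Metric.mem_ball.2 ((h.dist_le hc₀ hj hQ hy hx).trans_lt (by gcongr))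
  calc ∫⁻ y in Q, Metric.infEDist y (V y) ^ q ∂μ
      = ∫⁻ y in Q, Metric.infEDist y (V x) ^ q ∂μ :=
        setLIntegral_congr_fun hQm fun y hy => by simp only [hV Q hQ y hy x hx]
    _ ≤ F x * ρ ^ (q + k) := (lintegral_mono_set hball).trans (hVF x (h.subset j hj Q hQ hx))
    _ = F x * ρ ^ q * ρ ^ k := by
        rw [ENNReal.rpow_add _ _ hρ₀ ENNReal.ofReal_ne_top, ENNReal.rpow_natCast, mul_assoc]
    _ ≤ F x * ρ ^ q * (cubeSizeConst k C c₀ * μ Q) := by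
        gcongr
        exact h.ofReal_pow_le_mul_measure hE hc₀ hc₀' hj hQ
    _ = cubeSizeConst k C c₀ * ρ ^ q * ∫⁻ _ in Q, F x ∂μ := by
        rw [setLIntegral_const]
        ring
    _ = cubeSizeConst k C c₀ * ρ ^ q * ∫⁻ y in Q, F y ∂μ := by
        rw [setLIntegral_congr_fun hQm fun y hy => hF Q hQ x hx y hy]

end IsDyadicSystem

end CubeSize

section Carleson

variable {X : Type*} [MeasurableSpace X] {μ : Measure X} {F : ℕ → X → ℝ≥0∞}

lemma tsum_lintegral_tailSum_le (hF : ∀ t, AEMeasurable (F t) μ) (N : Set X) :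
    ∑' t : ℕ, ∫⁻ x in N, tailSum F t x ∂μ ≤ 2 * ∑' t : ℕ, ∫⁻ x in N, F t x ∂μ := by
  have hswap : ∀ t, ∫⁻ x in N, tailSum F t x ∂μ =
      ∑' l : ℕ, 2⁻¹ ^ l * ∫⁻ x in N, F (t + l) x ∂μ := by
    intro t
    unfold tailSum
    rw [lintegral_tsum fun l => (hF (t + l)).restrict.const_mul _]
    exact tsum_congr fun l => lintegral_const_mul'' _ (hF (t + l)).restrict
  calc ∑' t : ℕ, ∫⁻ x in N, tailSum F t x ∂μ
      = ∑' l : ℕ, ∑' t : ℕ, 2⁻¹ ^ l * ∫⁻ x in N, F (t + l) x ∂μ := by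
        simp_rw [hswap]
        exact ENNReal.tsum_comm
    _ ≤ ∑' l : ℕ, 2⁻¹ ^ l * ∑' t : ℕ, ∫⁻ x in N, F t x ∂μ := by
        refine ENNReal.tsum_le_tsum fun l => ?_
        rw [ENNReal.tsum_mul_left]
        refine mul_le_mul_right ?_ _
        exact ENNReal.tsum_comp_le_tsum_of_injective (add_left_injective l)
          (fun t => ∫⁻ x in N, F t x ∂μ)
    _ = 2 * ∑' t : ℕ, ∫⁻ x in N, F t x ∂μ := by
        rw [ENNReal.tsum_mul_right, ENNReal.tsum_geometric, ENNReal.one_sub_inv_two, inv_inv]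

variable [MetricSpace X] [BorelSpace X] {k : ℕ} {C c₀ : ℝ} {E : Set X} {Δ : ℤ → Set (Set X)}

namespace IsDyadicSystem

lemma lintegral_ball_le_of_carleson (h : IsDyadicSystem E c₀ Δ) (hE : IsRegularSet (k : ℝ) C E)
    (hc₀ : 0 < c₀) (hc₀' : c₀ ≤ 1 / 2) {J : ℤ} (hJ : J ∈ dyadicIndex E) {f : X → ℝ≥0∞}
    {a : ℝ≥0∞}
    (hf : ∀ A ∈ Δ J, ∫⁻ x in A, f x ∂(μH[(k : ℝ)] : Measure X).restrict E ≤
      a * (μH[(k : ℝ)] : Measure X).restrict E A)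
    {Q : Set X} (hQ : Q ∈ Δ J) {w : X} (hw : w ∈ E) {K : ℝ} (hK : 0 < K) :
    ∫⁻ x in Metric.ball w (K * (2 : ℝ) ^ (-J)), f x ∂(μH[(k : ℝ)] : Measure X).restrict E ≤
      ENNReal.ofReal (C * (K + c₀⁻¹) ^ k) * cubeSizeConst k C c₀ * a *
        (μH[(k : ℝ)] : Measure X).restrict E Q := by
  set μ := (μH[(k : ℝ)] : Measure X).restrict E
  set B := Metric.ball w ((K + c₀⁻¹) * (2 : ℝ) ^ (-J))
  calc ∫⁻ x in Metric.ball w (K * (2 : ℝ) ^ (-J)), f x ∂μ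
      ≤ a * ∫⁻ _ in B, 1 ∂μ :=
        h.lintegral_ball_le_of_cubes hE hc₀ hc₀' hJ hE.ae_mem
          (by simpa only [setLIntegral_one] using hf) w (add_mul K _ _).ge
    _ = a * μ B := by rw [setLIntegral_one]
    _ ≤ a * (ENNReal.ofReal (C * (K + c₀⁻¹) ^ k) * (cubeSizeConst k C c₀ * μ Q)) := by
        gcongr
        refine (hE.isUpperRegular.measure_ball_mul_le hw (by positivity) (by positivity)).trans ?_
        gcongr
        exact h.ofReal_pow_le_mul_measure hE hc₀ hc₀' hJ hQ
    _ = _ := by ring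

lemma lintegral_average_ball_le [SecondCountableTopology X] (h : IsDyadicSystem E c₀ Δ)
    (hE : IsRegularSet (k : ℝ) C E) (hc₀ : 0 < c₀) {J : ℤ} (hJ : J ∈ dyadicIndex E)
    {f : X → ℝ≥0∞} (hf : AEMeasurable f ((μH[(k : ℝ)] : Measure X).restrict E))
    {Q : Set X} (hQ : Q ∈ Δ J) {w : X} (hw : w ∈ Q) {K : ℝ} (hK : 0 < K) {r : ℝ} (hr : 0 < r)
    (hrJ : r ≤ (2 : ℝ) ^ (-J)) :
    ∫⁻ z in Q, (ENNReal.ofReal r ^ k)⁻¹ * ∫⁻ x in Metric.ball z (K * r), f x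
        ∂(μH[(k : ℝ)] : Measure X).restrict E ∂(μH[(k : ℝ)] : Measure X).restrict E ≤
      ENNReal.ofReal (C * K ^ k) * ∫⁻ x in Metric.ball w ((K + c₀⁻¹) * (2 : ℝ) ^ (-J)), f x
        ∂(μH[(k : ℝ)] : Measure X).restrict E := by
  set μ := (μH[(k : ℝ)] : Measure X).restrict E
  set N := Metric.ball w ((K + c₀⁻¹) * (2 : ℝ) ^ (-J))
  have := hE.sigmaFinite
  have hr₀ : ENNReal.ofReal r ≠ 0 := (ENNReal.ofReal_pos.2 hr).ne'
  have hsub : ∀ z ∈ Q, Metric.ball z (K * r) ⊆ N := fun z hz =>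
    Metric.ball_subset_ball' (by
      rw [add_mul]
      exact add_le_add (by gcongr) (h.dist_le hc₀ hJ hQ hz hw))
  have hball : ∀ᵐ x ∂μ, μ (Metric.ball x (K * r)) ≤
      ENNReal.ofReal (C * K ^ k) * ENNReal.ofReal r ^ k :=
    hE.ae_mem.mono fun x hx => hE.isUpperRegular.measure_ball_mul_le hx hK hr
  calc ∫⁻ z in Q, (ENNReal.ofReal r ^ k)⁻¹ * ∫⁻ x in Metric.ball z (K * r), f x ∂μ ∂μ
      = (ENNReal.ofReal r ^ k)⁻¹ * ∫⁻ z in Q, ∫⁻ x in Metric.ball z (K * r), f x ∂μ ∂μ :=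
        lintegral_const_mul' _ _ (ENNReal.inv_ne_top.2 (pow_ne_zero k hr₀))
    _ ≤ (ENNReal.ofReal r ^ k)⁻¹ *
          (ENNReal.ofReal (C * K ^ k) * ENNReal.ofReal r ^ k * ∫⁻ x in N, f x ∂μ) := by
        gcongr
        exact lintegral_lintegral_ball_le hf (h.measurableSet J hJ Q hQ) hsub hball
    _ = (ENNReal.ofReal r ^ k)⁻¹ * ENNReal.ofReal r ^ k *
          (ENNReal.ofReal (C * K ^ k) * ∫⁻ x in N, f x ∂μ) := by ring
    _ = ENNReal.ofReal (C * K ^ k) * ∫⁻ x in N, f x ∂μ := by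
        rw [ENNReal.inv_mul_cancel (pow_ne_zero k hr₀) (by finiteness), one_mul]

end IsDyadicSystem

/-- The constant in the sum over all subcubes of a cube of error terms and their averaged tails
over balls enlarged by the factor `K`. -/
def carlesonConst (k : ℕ) (C c₀ K : ℝ) : ℝ≥0∞ :=
  1 + 2 * ENNReal.ofReal (C * K ^ k) * ENNReal.ofReal (C * (K + c₀⁻¹ + c₀⁻¹) ^ k) *
    cubeSizeConst k C c₀

lemma IsDyadicSystem.tsum_lintegral_tailSum_ball_le [SecondCountableTopology X]
    (h : IsDyadicSystem E c₀ Δ) (hE : IsRegularSet (k : ℝ) C E) (hc₀ : 0 < c₀)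
    (hc₀' : c₀ ≤ 1 / 2) {J : ℤ} (hJ : J ∈ dyadicIndex E)
    (hF : ∀ t, AEMeasurable (F t) ((μH[(k : ℝ)] : Measure X).restrict E)) {a : ℝ≥0∞}
    (ha : ∀ A ∈ Δ J, ∑' t : ℕ, ∫⁻ x in A, F t x ∂(μH[(k : ℝ)] : Measure X).restrict E ≤
      a * (μH[(k : ℝ)] : Measure X).restrict E A)
    {K : ℝ} (hK : 0 < K) {Q : Set X} (hQ : Q ∈ Δ J) :
    ∑' t : ℕ, ∫⁻ w in Q, (F t w + (ENNReal.ofReal (scale ((2 : ℝ) ^ (-J)) t) ^ k)⁻¹ *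
        ∫⁻ x in Metric.ball w (K * scale ((2 : ℝ) ^ (-J)) t), tailSum F t x
          ∂(μH[(k : ℝ)] : Measure X).restrict E) ∂(μH[(k : ℝ)] : Measure X).restrict E ≤
      carlesonConst k C c₀ K * a * (μH[(k : ℝ)] : Measure X).restrict E Q := by
  set μ := (μH[(k : ℝ)] : Measure X).restrict E
  obtain ⟨w₀, hw₀⟩ := h.nonempty hE hc₀ hc₀' hJ hQ
  have hR : 0 < (2 : ℝ) ^ (-J) := by positivity
  set N := Metric.ball w₀ ((K + c₀⁻¹) * (2 : ℝ) ^ (-J))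
  set B := ENNReal.ofReal (C * K ^ k)
  have hsum : ∀ A : Set X, ∑' t, ∫⁻ x in A, F t x ∂μ = ∫⁻ x in A, ∑' t, F t x ∂μ := fun A =>
    (lintegral_tsum fun t => (hF t).restrict).symm
  have hN : ∑' t, ∫⁻ x in N, F t x ∂μ ≤
      ENNReal.ofReal (C * (K + c₀⁻¹ + c₀⁻¹) ^ k) * cubeSizeConst k C c₀ * a * μ Q := by
    rw [hsum]
    exact h.lintegral_ball_le_of_carleson hE hc₀ hc₀' hJ (fun A hA => hsum A ▸ ha A hA) hQ
      (h.subset J hJ Q hQ hw₀) (by positivity)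
  calc _ ≤ ∑' t, (∫⁻ w in Q, F t w ∂μ + B * ∫⁻ x in N, tailSum F t x ∂μ) := by
        refine ENNReal.tsum_le_tsum fun t => ?_
        rw [lintegral_add_left' (hF t).restrict]
        gcongr
        exact h.lintegral_average_ball_le hE hc₀ hJ (aemeasurable_tailSum hF t) hQ hw₀ hK
          (scale_pos hR t) (scale_le hR.le t)
    _ = ∑' t, ∫⁻ w in Q, F t w ∂μ + B * ∑' t, ∫⁻ x in N, tailSum F t x ∂μ := by
        rw [ENNReal.tsum_add, ENNReal.tsum_mul_left]
    _ ≤ a * μ Q + B * (2 * ∑' t, ∫⁻ x in N, F t x ∂μ) := by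
        gcongr
        exacts [ha Q hQ, tsum_lintegral_tailSum_le hF N]
    _ ≤ a * μ Q + B * (2 * (ENNReal.ofReal (C * (K + c₀⁻¹ + c₀⁻¹) ^ k) *
          cubeSizeConst k C c₀ * a * μ Q)) := by gcongr
    _ = carlesonConst k C c₀ K * a * μ Q := by
        rw [carlesonConst]
        ring

end Carleson

/-! ### Nearly optimal planes -/

section Ancestors

variable {X : Type*} [MetricSpace X] {k : ℕ} {C c₀ : ℝ}
  {E : Set X} {Δ : ℤ → Set (Set X)} {J : ℤ}

/-- The constant in the passage from the number `β_{q,V}` of the ancestor of a cube, `m`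
generations above it, to the distances from `V` on a ball around a point of the cube. -/
def approxConst (k : ℕ) (q C c₀ : ℝ) (m : ℕ) : ℝ≥0∞ :=
  ENNReal.ofReal (3 * c₀⁻¹ * 2 ^ m) ^ q * ENNReal.ofReal (C * (2 * (3 * c₀⁻¹ * 2 ^ m)) ^ k)

lemma approxConst_ne_top {q : ℝ} (hq : 0 ≤ q) (m : ℕ) : approxConst k q C c₀ m ≠ ⊤ := by
  unfold approxConst
  finiteness

/-- The error, at the point `x` and on the scale `2 ^ (-(J + t))`, of the approximation by planes
which are optimal up to `ε t` for the coefficients `g` of the ancestors `m` generations above. -/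
def ancestorError (k : ℕ) (q C c₀ : ℝ) (m : ℕ) (E : Set X) (Δ : ℤ → Set (Set X)) (J : ℤ)
    (g : Set X → ℝ≥0∞) (ε : ℕ → ℝ≥0∞) (t : ℕ) (x : X) : ℝ≥0∞ :=
  approxConst k q C c₀ m * (g (ancestorSet E Δ (J + t - m) x) ^ q + ε t)

lemma ancestorError_pos (hc₀ : 0 < c₀) (hC : 0 < C) {q : ℝ} (m : ℕ) (g : Set X → ℝ≥0∞)
    {ε : ℕ → ℝ≥0∞} (hε : ∀ t, 0 < ε t) (t : ℕ) (x : X) :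
    0 < ancestorError k q C c₀ m E Δ J g ε t x := by
  have hconst : 0 < approxConst k q C c₀ m :=
    ENNReal.mul_pos
      (ENNReal.rpow_pos (ENNReal.ofReal_pos.2 (by positivity)) ENNReal.ofReal_ne_top).ne'
      (ENNReal.ofReal_pos.2 (by positivity)).ne'
  exact ENNReal.mul_pos hconst.ne' ((hε t).trans_le le_add_self).ne'

variable [MeasurableSpace X]

lemma IsDyadicSystem.ancestorError_eq_of_mem (h : IsDyadicSystem E c₀ Δ)
    (hJ : J ∈ dyadicIndex E) (q : ℝ) (m : ℕ) (g : Set X → ℝ≥0∞) (ε : ℕ → ℝ≥0∞) {t : ℕ}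
    {Q : Set X} (hQ : Q ∈ Δ (J + t)) {x y : X} (hx : x ∈ Q) (hy : y ∈ Q) :
    ancestorError k q C c₀ m E Δ J g ε t x = ancestorError k q C c₀ m E Δ J g ε t y := by
  rw [ancestorError, ancestorError, h.ancestorSet_eq_of_mem (add_natCast_mem_dyadicIndex hJ t)
    (sub_le_self _ (Int.natCast_nonneg m)) hQ hx hy]

variable [BorelSpace X]

lemma IsDyadicSystem.lintegral_infEDist_ball_le_approxConst (h : IsDyadicSystem E c₀ Δ)
    (hk : 1 ≤ k) (hE : IsRegularSet (k : ℝ) C E) (hc₀ : 0 < c₀) (hc₀' : c₀ ≤ 1 / 2) {m : ℕ}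
    (hm : 32 * C ^ 2 / c₀ ^ 2 ≤ 2 ^ m) {q : ℝ} (hq : 0 < q) {V : Set X} {t : ℕ} {x : X}
    (hx : x ∈ E) {b : ℝ≥0∞}
    (hb : betaOne ((μH[(k : ℝ)] : Measure X).restrict E) q V
      (ancestorSet E Δ (J + t - m) x) ^ q ≤ b) :
    ∫⁻ y in Metric.ball x (16 / c₀ * scale ((2 : ℝ) ^ (-J)) t), Metric.infEDist y V ^ q
        ∂(μH[(k : ℝ)] : Measure X).restrict E ≤
      approxConst k q C c₀ m * b * ENNReal.ofReal (scale ((2 : ℝ) ^ (-J)) t) ^ (q + k) := by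
  have hC := hE.one_le
  set ρ := scale ((2 : ℝ) ^ (-J)) t
  have hρ : 0 < ρ := scale_pos (by positivity) t
  set A := 3 * c₀⁻¹ * 2 ^ m
  have hA₀ : 0 < A := by positivity
  have hradius : 16 / c₀ * ρ ≤ c₀ / (2 * C ^ 2) * (2 : ℝ) ^ (-(J + t - m)) := by
    rw [two_zpow_neg_add_sub, ← mul_assoc]
    gcongr
    calc 16 / c₀ = c₀ / (2 * C ^ 2) * (32 * C ^ 2 / c₀ ^ 2) := by
          field_simp
          norm_num
      _ ≤ c₀ / (2 * C ^ 2) * 2 ^ m := by gcongr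
  refine (lintegral_mono_set (Metric.ball_subset_ball hradius)).trans ?_
  refine (h.lintegral_infEDist_ball_le hk hE hc₀ hc₀' (J + t - m) hx hq V (D := A * ρ)
    (by rw [two_zpow_neg_add_sub, ← mul_assoc])).trans ?_
  have hρ₀ : ENNReal.ofReal ρ ≠ 0 := (ENNReal.ofReal_pos.2 hρ).ne'
  have hpow : ENNReal.ofReal (A * ρ) ^ q = ENNReal.ofReal A ^ q * ENNReal.ofReal ρ ^ q := by
    rw [ENNReal.ofReal_mul hA₀.le, ENNReal.mul_rpow_of_nonneg _ _ hq.le]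
  have hmeasure : ENNReal.ofReal (C * (2 * (A * ρ)) ^ k) =
      ENNReal.ofReal (C * (2 * A) ^ k) * ENNReal.ofReal ρ ^ k := by
    rw [← ENNReal.ofReal_pow hρ.le, ← ENNReal.ofReal_mul (by positivity), ← mul_assoc 2 A, mul_pow,
      mul_assoc]
  rw [hpow, hmeasure, ENNReal.rpow_add _ _ hρ₀ ENNReal.ofReal_ne_top, ENNReal.rpow_natCast]
  exact (mul_le_mul_right hb _).trans_eq (by rw [approxConst]; ring)

lemma GLem.tsum_lintegral_ancestorError_le {g : Set X → ℝ≥0∞} {q : ℝ} {M : ℝ≥0}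
    (hG : GLem (k : ℝ) c₀ E g q M) (hk : 1 ≤ k) (hE : IsRegularSet (k : ℝ) C E)
    (h : IsDyadicSystem E c₀ Δ) (hc₀ : 0 < c₀) (hc₀' : c₀ ≤ 1 / 2) (hq : 0 ≤ q) {m : ℕ}
    (hm : 2 * C ^ 2 / c₀ ^ 2 < 2 ^ m) (ε : ℕ → ℝ≥0∞) (hJ : J ∈ dyadicIndex E) {A : Set X}
    (hA : A ∈ Δ J) :
    ∑' t : ℕ, ∫⁻ x in A, ancestorError k q C c₀ m E Δ J g ε t x
        ∂(μH[(k : ℝ)] : Measure X).restrict E ≤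
      approxConst k q C c₀ m * (2 * m * M + ∑' t, ε t) *
        (μH[(k : ℝ)] : Measure X).restrict E A := by
  set μ := (μH[(k : ℝ)] : Measure X).restrict E
  have hterm : ∀ t : ℕ, ∫⁻ x in A, ancestorError k q C c₀ m E Δ J g ε t x ∂μ =
      approxConst k q C c₀ m *
        (∫⁻ x in A, g (ancestorSet E Δ (J + t - m) x) ^ q ∂μ + ε t * μ A) := by
    intro t
    unfold ancestorError
    rw [lintegral_const_mul' _ _ (approxConst_ne_top hq m), lintegral_add_right _ measurable_const,
      setLIntegral_const]
  simp_rw [hterm]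
  rw [ENNReal.tsum_mul_left, ENNReal.tsum_add, ENNReal.tsum_mul_right, mul_assoc, add_mul, two_mul]
  gcongr
  exact hG.tsum_lintegral_ancestorSet_le hk hE h hc₀ hc₀' hm m hJ hA

end Ancestors

namespace Heisenberg

variable {n k m : ℕ} {p q C c₀ : ℝ} {E : Set (Heisenberg n)} {M : ℝ≥0}
  {Δ : ℤ → Set (Set (Heisenberg n))} {J : ℤ} {ε : ℕ → ℝ≥0∞}
  {U : ℕ → Heisenberg n → HorizontalPlane n k}

instance : SecondCountableTopology (Heisenberg n) := by
  have hcont : Continuous fun a : EuclideanSpace ℝ (Fin n ⊕ Fin n) × ℝ =>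
      (⟨a.1, a.2⟩ : Heisenberg n) := by
    refine continuous_iff_continuousAt.2 fun a => tendsto_iff_dist_tendsto_zero.2 ?_
    have hdist : Continuous fun b : EuclideanSpace ℝ (Fin n ⊕ Fin n) × ℝ =>
        dist (⟨b.1, b.2⟩ : Heisenberg n) ⟨a.1, a.2⟩ := by
      simp only [dist_def, koranyiNorm, mul_z, mul_t, inv_z, inv_t, omega, PiLp.neg_apply]
      refine Continuous.rpow_const ?_ fun _ => Or.inr (by norm_num)
      fun_prop
    simpa only [dist_self] using hdist.tendsto a
  have : TopologicalSpace.SeparableSpace (Heisenberg n) :=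
    (Function.Surjective.denseRange fun p : Heisenberg n => ⟨(p.z, p.t), rfl⟩).separableSpace hcont
  exact UniformSpace.secondCountable_of_separable _

lemma exists_nearOptimal_planes (hq : 0 < q) (hE : IsRegularSet (k : ℝ) C E)
    (hG : GLem (k : ℝ) c₀ E (horizontalBeta k E q) q M) (hΔ : IsDyadicSystem E c₀ Δ)
    (hc₀ : 0 < c₀) (hc₀' : c₀ ≤ 1 / 2) (hJ : J ∈ dyadicIndex E) (m : ℕ) (hε : ∀ t, 0 < ε t) :
    ∃ U : ℕ → Heisenberg n → HorizontalPlane n k,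
      (∀ t, ∀ x ∈ E, betaOne ((μH[(k : ℝ)] : Measure (Heisenberg n)).restrict E) q
          (U t x).carrier (ancestorSet E Δ (J + t - m) x) ^ q ≤
        horizontalBeta k E q (ancestorSet E Δ (J + t - m) x) ^ q + ε t) ∧
      ∀ t : ℕ, ∀ Q ∈ Δ (J + t), ∀ x ∈ Q, ∀ y ∈ Q, U t x = U t y := by
  have hfin : ∀ i, ∀ x ∈ E, horizontalBeta k E q (ancestorSet E Δ i x) ^ q ≠ ⊤ := fun i x hx =>
    ne_top_of_le_ne_top ENNReal.coe_ne_top (hG.ancestorSet_le hE hΔ hc₀ hc₀' i hx)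
  have hopt : ∀ t S, horizontalBeta k E q S ^ q ≠ ⊤ → ∃ V : HorizontalPlane n k,
      betaOne ((μH[(k : ℝ)] : Measure (Heisenberg n)).restrict E) q V.carrier S ^ q ≤
        horizontalBeta k E q S ^ q + ε t := fun t S hS =>
    exists_betaOne_le hq HorizontalPlane.carrier hS (hε t)
  obtain ⟨x₀, hx₀⟩ := hE.nonempty
  have : Nonempty (HorizontalPlane n k) := ⟨(hopt 0 _ (hfin J x₀ hx₀)).choose⟩
  choose! V hV using hopt
  refine ⟨fun t x => V t (ancestorSet E Δ (J + t - m) x), fun t x hx => hV t _ (hfin _ x hx),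
    fun t Q hQ x hx y hy => ?_⟩
  exact congrArg (V t) (hΔ.ancestorSet_eq_of_mem (add_natCast_mem_dyadicIndex hJ t)
    (sub_le_self _ (Int.natCast_nonneg m)) hQ hx hy)

lemma isApproxSystem_of_nearOptimal (hk : 1 ≤ k) (hq : 0 < q) (hE : IsRegularSet (k : ℝ) C E)
    (hΔ : IsDyadicSystem E c₀ Δ) (hc₀ : 0 < c₀) (hc₀' : c₀ ≤ 1 / 2)
    (hm : 32 * C ^ 2 / c₀ ^ 2 ≤ 2 ^ m) (hJ : J ∈ dyadicIndex E) (hε : ∀ t, 0 < ε t)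
    (hU : ∀ t, ∀ x ∈ E, betaOne ((μH[(k : ℝ)] : Measure (Heisenberg n)).restrict E) q
        (U t x).carrier (ancestorSet E Δ (J + t - m) x) ^ q ≤
      horizontalBeta k E q (ancestorSet E Δ (J + t - m) x) ^ q + ε t)
    (hU' : ∀ t : ℕ, ∀ Q ∈ Δ (J + t), ∀ x ∈ Q, ∀ y ∈ Q, U t x = U t y) :
    IsApproxSystem k q C (16 / c₀) (17 / c₀) ((2 : ℝ) ^ (-J)) (cubeSizeConst k C c₀) E
      ((μH[(k : ℝ)] : Measure (Heisenberg n)).restrict E) U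
      (ancestorError k q C c₀ m E Δ J (horizontalBeta k E q) ε) := by
  have hR : 0 < (2 : ℝ) ^ (-J) := by positivity
  have hC := hE.one_le
  have hinv : 0 < c₀⁻¹ := inv_pos.2 hc₀
  have hindex := fun t : ℕ => add_natCast_mem_dyadicIndex hJ t
  set F := ancestorError k q C c₀ m E Δ J (horizontalBeta k E q) ε
  have hF : ∀ t : ℕ, ∀ Q ∈ Δ (J + t), ∀ x ∈ Q, ∀ y ∈ Q, F t x = F t y :=
    fun t Q hQ x hx y hy => hΔ.ancestorError_eq_of_mem hJ q m _ ε hQ hx hy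
  have happrox : ∀ t, ∀ x ∈ E, _ := fun t x hx =>
    hΔ.lintegral_infEDist_ball_le_approxConst hk hE hc₀ hc₀' hm hq hx (hU t x hx)
  refine ⟨hR, hE.isUpperRegular, hE.restrict_compl_eq_zero, fun t x hx => ?_,
    fun t x _ => ancestorError_pos hc₀ (by linarith) m _ hε t x, happrox, fun j s c _ => ?_,
    fun t => ?_, fun t => ?_⟩
  case refine_1 =>
    refine hE.le_measure_ball hx (scale_pos hR t) ?_
    rw [← two_zpow_neg_add]
    exact hindex t
  case refine_2 =>
    have hscale : scale ((2 : ℝ) ^ (-J)) (j + s) ≤ scale ((2 : ℝ) ^ (-J)) j := by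
      rw [scale_add]
      exact mul_le_of_le_one_left (scale_pos hR j).le (pow_le_one₀ (by norm_num) (by norm_num))
    rw [← two_zpow_neg_add J (j + s)]
    refine hΔ.lintegral_infEDist_piecewise_le hE hc₀ hc₀' (hindex (j + s))
      (V := fun x => (U (j + s) x).carrier)
      (fun Q hQ x hx y hy => by rw [hU' (j + s) Q hQ x hx y hy])
      (hF (j + s)) (K := 16 / c₀) (by rw [div_eq_mul_inv]; linarith) ?_ c ?_
    · rw [two_zpow_neg_add]
      exact happrox (j + s)
    · rw [two_zpow_neg_add, show 17 / c₀ = 16 / c₀ + c₀⁻¹ by ring, add_mul]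
      gcongr
  case refine_3 =>
    refine hΔ.aemeasurable_of_eqOn_cubes hE hc₀ hc₀' (hindex t) fun Q hQ => ?_
    obtain ⟨x, hx⟩ := hΔ.nonempty hE hc₀ hc₀' (hindex t) hQ
    exact ⟨fun _ => F t x, measurable_const, fun y hy => hF t Q hQ y hy x hx⟩
  case refine_4 =>
    refine hΔ.aemeasurable_of_eqOn_cubes hE hc₀ hc₀' (hindex t) fun Q hQ => ?_
    obtain ⟨x, hx⟩ := hΔ.nonempty hE hc₀ hc₀' (hindex t) hQ
    exact ⟨fun y => Metric.infEDist y (U t x).carrier, measurable_infEDist,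
      fun y hy => by simp only [hU' t Q hQ y hy x hx]⟩

lemma IsApproxSystem.horizontalIota_dilateCube_rpow_le {F : ℕ → Heisenberg n → ℝ≥0∞}
    (h : IsApproxSystem k (2 * p) C (16 / c₀) (17 / c₀) ((2 : ℝ) ^ (-J)) (cubeSizeConst k C c₀) E
      ((μH[(k : ℝ)] : Measure (Heisenberg n)).restrict E) U F)
    (hk : 1 ≤ k) (hp : 1 ≤ p) (hE : IsRegularSet (k : ℝ) C E) (hΔ : IsDyadicSystem E c₀ Δ)
    (hc₀ : 0 < c₀) (hc₀' : c₀ ≤ 1 / 2) (hJ : J ∈ dyadicIndex E) {t : ℕ} {Q : Set (Heisenberg n)}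
    (hQ : Q ∈ Δ (J + t)) {w : Heisenberg n} (hw : w ∈ Q) :
    horizontalIota k E p (dilateCube E 2 Q) ^ p ≤
      iotaConst k p C (16 / c₀) (cubeSizeConst k C c₀) (cubeSizeConst k C c₀) *
        (F t w + (ENNReal.ofReal (scale ((2 : ℝ) ^ (-J)) t) ^ k)⁻¹ *
          ∫⁻ x in Metric.ball w (17 / c₀ * scale ((2 : ℝ) ^ (-J)) t), tailSum F t x
            ∂(μH[(k : ℝ)] : Measure (Heisenberg n)).restrict E) := by
  have hindex := add_natCast_mem_dyadicIndex hJ t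
  have hQE := hΔ.subset _ hindex Q hQ
  have hQ2 := subset_dilateCube hQE 2
  have hball : dilateCube E 2 Q ⊆
      Metric.ball w (16 / c₀ / 4 * scale ((2 : ℝ) ^ (-J)) t) := fun y hy => by
    have hρ := scale_pos (R := (2 : ℝ) ^ (-J)) (by positivity) t
    have hdist : edist y w ≤ 3 * ENNReal.ofReal (c₀⁻¹ * (2 : ℝ) ^ (-(J + t))) :=
      (Metric.edist_le_ediam_of_mem hy (hQ2 hw)).trans ((ediam_dilateCube_two_le E Q).trans
        (mul_le_mul_right (hΔ.ediam_le _ hindex Q hQ) 3))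
    rw [two_zpow_neg_add, ← ENNReal.ofReal_ofNat 3, ← ENNReal.ofReal_mul zero_le_three, edist_dist,
      ENNReal.ofReal_le_ofReal_iff (by positivity)] at hdist
    have hlt : 3 * (c₀⁻¹ * scale ((2 : ℝ) ^ (-J)) t) <
        16 / c₀ / 4 * scale ((2 : ℝ) ^ (-J)) t := by
      have : 0 < c₀⁻¹ * scale ((2 : ℝ) ^ (-J)) t := by positivity
      rw [div_eq_mul_inv 16]
      linarith
    exact Metric.mem_ball.2 (hdist.trans_lt hlt)
  have hdiam := hΔ.ofReal_le_mul_ediam hk hE hc₀ hc₀' hindex hQ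
  have hmeas := hΔ.ofReal_pow_le_mul_measure hE hc₀ hc₀' hindex hQ
  rw [two_zpow_neg_add] at hdiam hmeas
  refine (ENNReal.rpow_le_rpow (iInf_le _ (U t w)) (by linarith)).trans ?_
  exact h.iotaOne_rpow_le hk hE.one_le hp (by rw [le_div_iff₀ hc₀]; linarith)
    (by gcongr; norm_num) (hQE hw) (measurableSet_dilateCube hE.isClosed.measurableSet 2 Q)
    (dilateCube_subset E 2 Q) hball (hdiam.trans (mul_le_mul_right (Metric.ediam_mono hQ2) _))
    (hmeas.trans (mul_le_mul_right (measure_mono hQ2) _))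

end Heisenberg

lemma le_mul_of_forall_pos_le_mul_add {x a b : ℝ≥0∞} (ha : a ≠ ⊤)
    (h : ∀ δ, 0 < δ → x ≤ a * (b + δ)) : x ≤ a * b := by
  have hlim : Filter.Tendsto (fun δ => a * (b + δ)) (nhdsWithin 0 (Ioi 0)) (nhds (a * (b + 0))) :=
    (ENNReal.Tendsto.const_mul (tendsto_const_nhds.add Filter.tendsto_id) (Or.inr ha)).mono_left
      nhdsWithin_le_nhds
  rw [add_zero] at hlim
  exact ge_of_tendsto hlim (Filter.eventually_of_mem self_mem_nhdsWithin h)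

namespace Heisenberg

variable {n k m : ℕ} {p C c₀ : ℝ} {E : Set (Heisenberg n)} {M : ℝ≥0}

/-- The constant in the Carleson condition for `ι_p` deduced from the planes which are nearly
optimal for `β_{2p}` of the ancestors `m` generations above. -/
def packingConst (k : ℕ) (p C c₀ : ℝ) (m : ℕ) : ℝ≥0∞ :=
  iotaConst k p C (16 / c₀) (cubeSizeConst k C c₀) (cubeSizeConst k C c₀) *
    carlesonConst k C c₀ (17 / c₀) * approxConst k (2 * p) C c₀ m

lemma packingConst_ne_top (k : ℕ) (hp : 1 ≤ p) (C c₀ : ℝ) (m : ℕ) :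
    packingConst k p C c₀ m ≠ ⊤ := by
  have hsize : cubeSizeConst k C c₀ ≠ ⊤ := ENNReal.ofReal_ne_top
  have hiota := iotaConst_ne_top k hp C (16 / c₀) hsize hsize
  have happrox : approxConst k (2 * p) C c₀ m ≠ ⊤ := approxConst_ne_top (by linarith) m
  unfold packingConst carlesonConst
  finiteness

lemma tsum_horizontalIota_rpow_le_add (hk : 1 ≤ k) (hp : 1 ≤ p)
    (hE : IsRegularSet (k : ℝ) C E)
    (hG : GLem (k : ℝ) c₀ E (horizontalBeta k E (2 * p)) (2 * p) M)
    {Δ : ℤ → Set (Set (Heisenberg n))} (hΔ : IsDyadicSystem E c₀ Δ) (hc₀ : 0 < c₀)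
    (hc₀' : c₀ ≤ 1 / 2) (hm : 32 * C ^ 2 / c₀ ^ 2 ≤ 2 ^ m) {J : ℤ} (hJ : J ∈ dyadicIndex E)
    {Q₀ : Set (Heisenberg n)} (hQ₀ : Q₀ ∈ Δ J) {δ : ℝ≥0∞} (hδ : 0 < δ) :
    ∑' Q : {Q : Set (Heisenberg n) // Q ∈ dyadicCubes E Δ ∧ Q ⊆ Q₀},
        horizontalIota k E p (dilateCube E 2 Q.1) ^ p *
          (μH[(k : ℝ)] : Measure (Heisenberg n)).restrict E Q.1 ≤
      packingConst k p C c₀ m * (2 * m * M + δ) *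
        (μH[(k : ℝ)] : Measure (Heisenberg n)).restrict E Q₀ := by
  have hC := hE.one_le
  have hq : 0 < 2 * p := by linarith
  obtain ⟨ε, hε, hεδ⟩ := ENNReal.exists_pos_sum_of_countable' hδ.ne' ℕ
  obtain ⟨U, hU, hU'⟩ := exists_nearOptimal_planes hq hE hG hΔ hc₀ hc₀' hJ m hε
  have hsys := isApproxSystem_of_nearOptimal hk hq hE hΔ hc₀ hc₀' hm hJ hε hU hU'
  have hcarleson := hΔ.tsum_lintegral_tailSum_ball_le hE hc₀ hc₀' hJ hsys.aemeasurable
    (fun A hA => hG.tsum_lintegral_ancestorError_le hk hE hΔ hc₀ hc₀' hq.le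
      (lt_of_lt_of_le (by gcongr; norm_num) hm) ε hJ hA)
    (K := 17 / c₀) (by positivity) hQ₀
  set μ := (μH[(k : ℝ)] : Measure (Heisenberg n)).restrict E
  have hiota : iotaConst k p C (16 / c₀) (cubeSizeConst k C c₀) (cubeSizeConst k C c₀) ≠ ⊤ :=
    iotaConst_ne_top k hp C _ ENNReal.ofReal_ne_top ENNReal.ofReal_ne_top
  refine (hΔ.tsum_cubes_le hE hc₀ hc₀' hJ hQ₀
    (fun Q => horizontalIota k E p (dilateCube E 2 Q) ^ p) μ).trans ?_
  refine (ENNReal.tsum_le_tsum fun t => setLIntegral_mono' (hΔ.measurableSet J hJ Q₀ hQ₀)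
    fun w hw => hsys.horizontalIota_dilateCube_rpow_le hk hp hE hΔ hc₀ hc₀' hJ
      (hΔ.cubeAt_mem (add_natCast_mem_dyadicIndex hJ t) (hΔ.subset J hJ Q₀ hQ₀ hw))
      (hΔ.mem_cubeAt (add_natCast_mem_dyadicIndex hJ t) (hΔ.subset J hJ Q₀ hQ₀ hw))).trans ?_
  simp_rw [lintegral_const_mul' _ _ hiota]
  rw [ENNReal.tsum_mul_left]
  calc _ ≤ iotaConst k p C (16 / c₀) (cubeSizeConst k C c₀) (cubeSizeConst k C c₀) *
        (carlesonConst k C c₀ (17 / c₀) *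
          (approxConst k (2 * p) C c₀ m * (2 * m * M + δ)) * μ Q₀) := by
        refine mul_le_mul_right (hcarleson.trans ?_) _
        gcongr
    _ = packingConst k p C c₀ m * (2 * m * M + δ) * μ Q₀ := by
        rw [packingConst]
        ring

lemma gLem_horizontalIota (hk : 1 ≤ k) (hp : 1 ≤ p) (hc₀ : 0 < c₀) (hc₀' : c₀ ≤ 1 / 2)
    (hm : 32 * C ^ 2 / c₀ ^ 2 ≤ 2 ^ m) (hE : IsRegularSet (k : ℝ) C E)
    (hG : GLem (k : ℝ) c₀ E (horizontalBeta k E (2 * p)) (2 * p) M) :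
    GLem (k : ℝ) c₀ E (horizontalIota k E p) p
      ((packingConst k p C c₀ m * (2 * m)).toNNReal * M) := by
  intro Δ hΔ Q₀ hQ₀
  obtain ⟨J, hJ, hQ₀J⟩ := mem_iUnion₂.1 hQ₀
  have hconst := packingConst_ne_top k hp C c₀ m
  have hmeasure := hΔ.measure_ne_top hE hc₀ hJ hQ₀J
  rw [ENNReal.coe_mul, ENNReal.coe_toNNReal (by finiteness)]
  refine (le_mul_of_forall_pos_le_mul_add (ENNReal.mul_ne_top hconst hmeasure) (b := 2 * m * M)
    fun δ hδ => ?_).trans_eq (by ring)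
  rw [mul_right_comm]
  exact tsum_horizontalIota_rpow_le_add hk hp hE hG hΔ hc₀ hc₀' hm hJ hQ₀J hδ

end Heisenberg

end

theorem theoremt (k : ℕ) (hk : 1 ≤ k) (p : ℝ) (hp : 1 ≤ p) (C : ℝ) (hC : 1 ≤ C)
    (c₀ : ℝ) (hc₀ : 0 < c₀) (hc₀' : c₀ ≤ 1 / 2) :
    ∃ Chat : ℝ≥0, ∀ n : ℕ, k ≤ n → ∀ (E : Set (Heisenberg n)) (M : ℝ≥0),
      IsRegularSet (k : ℝ) C E →
      GLem (k : ℝ) c₀ E (Heisenberg.horizontalBeta k E (2 * p)) (2 * p) M →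
      GLem (k : ℝ) c₀ E (Heisenberg.horizontalIota k E p) p (Chat * M) := by
  obtain ⟨m, hm⟩ := pow_unbounded_of_one_lt (32 * C ^ 2 / c₀ ^ 2) one_lt_two
  exact ⟨(Heisenberg.packingConst k p C c₀ m * (2 * m)).toNNReal, fun n _ E M hE hG =>
    Heisenberg.gLem_horizontalIota hk hp hc₀ hc₀' hm.le hE hG⟩
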